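/- **Setting.** Let $\ell\ge 1$ and consider the lower-triangular system $$\dot z_j=q_j(\hat z_j,\hat x_j,w),\qquad \dot x_j=f_j(\hat z_j,\hat x_j,w)+b_jx_{j+1},\qquad j=1,\dots,\ell,\quad x_{\ell+1}:=u,$$ with $\hat z_j=\mathrm{col}(z_1,\dots,z_j)$, $z_j\in\mathbb R^{n_j}$, $\hat x_j=\mathrm{col}(x_1,\dots,x_j)$, $x_j\in\mathbb R$, known constants $b_j\neq 0$, and an unknown parameter $w$ in a known compact set $\mathbb W\subset\mathbb R^p$. The functions $q_j,f_j$ are continuously differentiable in all their arguments and $q_j(0,0,w)=0$, $f_j(0,0,w)=0$ for $w\in\mathbb W$. Norms are Euclidean and $\|v_{[a,t]}\|=\sup_{a\le s\le t}\|v(s)\|$. Say that $g$ has finite slope at $0$ if $\limsup_{s\to0^+}g(s)/s<\infty$. Assume that every $z_j$-subsystem is input-to-state stable uniformly in $w\in\mathbb W$: there are $\beta_{z_j}\in\mathcal{KL}$ and $\gamma_{z_j}^z,\gamma_{z_j}^x\in\mathcal K_\infty$ with finite slope at $0$ such that, for all $w\in\mathbb W$ and all continuous inputs $\hat z_{j-1},\hat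 x_j$, $$\|z_j(t)\|\le\max\{\beta_{z_j}(\|z_j(0)\|,t),\ \gamma_{z_j}^z(\|\hat z_{j-1[0,t]}\|),\ \gamma_{z_j}^x(\|\hat x_{j[0,t]}\|)\},\qquad t>0 .$$ **Controller design.** Put $\bar x_1=x_1$, $\bar x_{j}=x_{j}-\vartheta_{j-1}(\bar x_{j-1})$ for $2\le j\le\ell$, and write $\hat{\bar x}_j=\mathrm{col}(\bar x_1,\dots,\bar x_j)$. With $x_{\ell+1}=\vartheta_\ell(\bar x_\ell)+\bar x_{\ell+1}$ the equations become $\dot{\bar x}_j=\bar f_j+b_j(\vartheta_j(\bar x_j)+\bar x_{j+1})$, where $\bar f_1=f_1$ and $\bar f_{j}=f_{j}-\vartheta_{j-1}'(\bar x_{j-1})(\bar f_{j-1}+b_{j-1}x_{j})$. An admissible design consists of constants $c_j>0$, $k_1>2$, $k_j>3$ ($j\ge2$), continuously differentiable functions $\iota_j,\tilde m_j$ (non-negative on $[0,\infty)$), $m_j\ge0$ and even $\psi_j$, and $\bar\gamma_{z_j}^x\in\mathcal K_\infty$ with finite slope at $0$, such that, with $$\bar\iota_j(s)=\tfrac{\iota_j(s)^2s^2}{4c_j},\quad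 \bar m_j(s)=\tfrac{\tilde m_j(s)^2s^2}{4c_j},\quad \bar c_1=c_1,\quad \bar c_j=2c_j\ (j\ge2),$$ $$\vartheta_j(s)=-\big(\bar c_j+\tfrac14b_j^2+m_j(s)+\psi_j(|s|)\big)s/b_j ,\qquad \rho_j(s)=\psi_j(s)s^2,$$ the following hold for every $j$: * $\bar\iota_j,\bar m_j$ are nondecreasing on $[0,\infty)$, $\rho_j\in\mathcal K$, and for all states and all $w\in\mathbb W$: $|\bar f_j|\le\iota_j(\|\hat z_j\|)\|\hat z_j\|+\tilde m_j(\|\hat{\bar x}_{j-1}\|)\|\hat{\bar x}_{j-1}\|+m_j(\bar x_j)|\bar x_j|$ (no middle term for $j=1$); * the $z_j$-subsystem is input-to-state stable, uniformly in $w\in\mathbb W$, as above with $\|\hat{\bar x}_j\|$ and the gain $\bar\gamma_{z_j}^x$ in place of $\|\hat x_j\|$ and $\gamma_{z_j}^x$ (and possibly another $\beta\in\mathcal{KL}$); * for all $s>0$: $\psi_1(s)>k_1\max\{\bar\iota_1(\bar\gamma_{z_1}^x(s))/s^2,\,1\}$ and, for $j\ge2$, $\psi_j(s)>k_j\max\{\bar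 m_j(s)/s^2,\ \bar\iota_j(\gamma_{Z_j}^{X_j}(2s))/s^2,\ 2\}$. Here the gains are computed recursively by $\bar\gamma_{X_1}^{x_2}(s)=\rho_1^{-1}(k_1s^2)$, $\bar\gamma_{X_j}^{x_{j+1}}(s)=2\rho_j^{-1}(k_js^2)$ for $j\ge2$, $\gamma_{Z_1}^{X_1}=\bar\gamma_{z_1}^x$, $\gamma_{Z_j}^{X_j}=2\max\{\bar\gamma_{z_j}^x,\ \bar\gamma_{Z_{j-1}}^{x_j},\ \gamma_{z_j}^z\circ\bar\gamma_{Z_{j-1}}^{x_j}\}$ for $j\ge2$, and $\bar\gamma_{Z_j}^{x_{j+1}}=\gamma_{Z_j}^{X_j}\circ\bar\gamma_{X_j}^{x_{j+1}}$ for all $j$. Finally let $\gamma_\xi^z,\gamma_\xi^x,\gamma_\xi^r\in\mathcal K_\infty$ have finite slope at $0$ and satisfy the $\xi$-bound, for all states, all $w\in\mathbb W$ and all $\bar x_{\ell+1}\in\mathbb R$, $$\big|\vartheta_\ell'(\bar x_\ell)\big(\bar f_\ell+b_\ell(\vartheta_\ell(\bar x_\ell)+\bar x_{\ell+1})\big)\big|\le\max\{\gamma_\xi^z(\|\hat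 z_\ell\|),\gamma_\xi^x(\|\hat{\bar x}_\ell\|),\gamma_\xi^r(|\bar x_{\ell+1}|)\}.$$ **Theorem.** Such a design and such $\gamma_\xi^z,\gamma_\xi^x,\gamma_\xi^r$ exist. For any of them, the function $$\gamma(s)=\max\{\gamma_\xi^z\circ\bar\gamma_{Z_\ell}^{x_{\ell+1}}(s),\ \gamma_\xi^x\circ\bar\gamma_{X_\ell}^{x_{\ell+1}}(s),\ \gamma_\xi^r(s)\}$$ has finite slope at $0$. Moreover, let $\epsilon>1$ and let $\bar\gamma\in\mathcal K_\infty$ have finite slope at $0$ and satisfy $\bar\gamma(s)\ge\epsilon\gamma(s)$ for all $s>0$. Apply the event-triggered controller $u(t)=\vartheta_\ell(\bar x_\ell(t_k))$, $t\in[t_k,t_{k+1})$, with $t_0=0$ and $$t_{k+1}=\inf\{t>t_k:\ (t-t_k)\,\bar\gamma(\|r_{[t_k,t]}\|)\ge\|r_{[t_k,t]}\|\ \text{and}\ \|r_{[t_k,t]}\|\ne0\},\qquad r(t)=\vartheta_\ell(\bar x_\ell(t))-\vartheta_\ell(\bar x_\ell(t_k)),$$ where $\inf\emptyset=\infty$.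 Then the following hold uniformly over $w\in\mathbb W$. 1. From every initial state there is a closed-loop trajectory on $[0,\infty)$, and the origin is globally asymptotically stable: there is $\beta\in\mathcal{KL}$ such that $\|\mathrm{col}(\hat z_\ell(t),\hat x_\ell(t))\|\le\beta(\|\mathrm{col}(\hat z_\ell(0),\hat x_\ell(0))\|,t)$ along every closed-loop trajectory with $w\in\mathbb W$, for as long as it is defined. 2. There is no Zeno behaviour: for every $R>0$ there is $\tau>0$ such that $t_{k+1}-t_k\ge\tau$ for all $k$ with $t_k<\infty$, along every closed-loop trajectory with $w\in\mathbb W$ and initial state of norm at most $R$. -/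

import Mathlib

open Set Filter Topology

noncomputable section

/-- Class `𝒦` functions `[0,∞) → [0,∞)` (values at negative arguments are irrelevant). -/
structure IsClassK (g : ℝ → ℝ) : Prop where
  zero : g 0 = 0
  continuousOn : ContinuousOn g (Ici 0)
  strictMonoOn : StrictMonoOn g (Ici 0)

/-- Class `𝒦_∞`: unbounded class `𝒦` functions. -/
structure IsClassKInf (g : ℝ → ℝ) : Prop extends IsClassK g where
  unbounded : Tendsto g atTop atTop

/-- Class `𝒦ℒ` functions `[0,∞) × [0,∞) → [0,∞)`. -/
structure IsClassKL (β : ℝ → ℝ → ℝ) : Prop where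
  classK : ∀ t, 0 ≤ t → IsClassK (fun s => β s t)
  antitoneOn : ∀ s, 0 ≤ s → AntitoneOn (β s) (Ici 0)
  tendsto_zero : ∀ s, 0 ≤ s → Tendsto (β s) atTop (𝓝 0)

/-- `limsup_{s → 0+} g(s)/s < ∞`. -/
def FiniteSlopeAtZero (g : ℝ → ℝ) : Prop :=
  ∃ C : ℝ, ∀ᶠ s in 𝓝[>] (0 : ℝ), g s / s ≤ C

/-- Euclidean norm of the column vector made of the blocks `v i`, `i ∈ S`. -/
def colNorm {ι : Type} {E : ι → Type} [∀ i, Norm (E i)] (S : Finset ι) (v : ∀ i, E i) : ℝ :=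
  Real.sqrt (∑ i ∈ S, ‖v i‖ ^ 2)

/-- `sup_{a ≤ s ≤ b} v(s)`, for a real signal `v`. -/
def supOn (v : ℝ → ℝ) (a b : ℝ) : ℝ := sSup (v '' Icc a b)

/-- `col(z_1, …, z_ℓ)` with `ℓ = N + 1` and `z_j ∈ ℝ^{n j}`. -/
abbrev ZState {N : ℕ} (n : Fin (N + 1) → ℕ) : Type := ∀ i, EuclideanSpace ℝ (Fin (n i))

/-- `col(x_1, …, x_ℓ)` with `ℓ = N + 1` and `x_j ∈ ℝ`. -/
abbrev XState (N : ℕ) : Type := Fin (N + 1) → ℝ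

/-- Norm of the whole state `col(z_1, …, z_ℓ, x_1, …, x_ℓ)`. -/
def stateNorm {N : ℕ} {n : Fin (N + 1) → ℕ} (z : ZState n) (x : XState N) : ℝ :=
  Real.sqrt (colNorm Finset.univ z ^ 2 + colNorm Finset.univ x ^ 2)

/-- The lower-triangular system of relative degree `ℓ = N + 1` (levels are numbered `0, …, N`),
`z_j' = q_j(z_1..z_j, x_1..x_j, w)`, `x_j' = f_j(z_1..z_j, x_1..x_j, w) + b_j x_{j+1}`,
`x_{ℓ+1} = u`, with an unknown parameter `w` in the compact set `W ⊆ ℝ^p`. -/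
structure LowerTriangularSystem (N p : ℕ) (n : Fin (N + 1) → ℕ) where
  q : (j : Fin (N + 1)) → ZState n → XState N → EuclideanSpace ℝ (Fin p) →
    EuclideanSpace ℝ (Fin (n j))
  f : Fin (N + 1) → ZState n → XState N → EuclideanSpace ℝ (Fin p) → ℝ
  b : Fin (N + 1) → ℝ
  W : Set (EuclideanSpace ℝ (Fin p))
  isCompact_W : IsCompact W
  b_ne_zero : ∀ j, b j ≠ 0
  q_smooth : ∀ j, ContDiff ℝ 1
    (fun a : ZState n × XState N × EuclideanSpace ℝ (Fin p) => q j a.1 a.2.1 a.2.2)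
  f_smooth : ∀ j, ContDiff ℝ 1
    (fun a : ZState n × XState N × EuclideanSpace ℝ (Fin p) => f j a.1 a.2.1 a.2.2)
  q_triangular : ∀ j z z' x x' w, (∀ i ≤ j, z i = z' i) → (∀ i ≤ j, x i = x' i) →
    q j z x w = q j z' x' w
  f_triangular : ∀ j z z' x x' w, (∀ i ≤ j, z i = z' i) → (∀ i ≤ j, x i = x' i) →
    f j z x w = f j z' x' w
  q_zero : ∀ j, ∀ w ∈ W, q j 0 0 w = 0
  f_zero : ∀ j, ∀ w ∈ W, f j 0 0 w = 0

variable {N p : ℕ} {n : Fin (N + 1) → ℕ}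

/-- The `z_j`-subsystem is input-to-state stable, uniformly in `w ∈ W`, with state `z_j` and inputs
`col(z_1..z_{j-1})` (gain `γz`) and `col(y_1..y_j)` (gain `γx`) where `y = coord x`.
All components of `z`, `x` other than `z_j` are arbitrary continuous signals. -/
def ZSubsystemISS (S : LowerTriangularSystem N p n) (j : Fin (N + 1))
    (coord : XState N → XState N) (γz γx : ℝ → ℝ) : Prop :=
  ∃ β : ℝ → ℝ → ℝ, IsClassKL β ∧
    ∀ w ∈ S.W, ∀ T : ℝ, 0 < T → ∀ (z : ℝ → ZState n) (x : ℝ → XState N),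
      ContinuousOn z (Icc 0 T) → ContinuousOn x (Icc 0 T) →
      (∀ t ∈ Ico 0 T, HasDerivWithinAt (fun s => z s j) (S.q j (z t) (x t) w) (Ici t) t) →
      ‖z T j‖ ≤ max (β ‖z 0 j‖ T)
        (max (γz (supOn (fun s => colNorm (Finset.Iio j) (z s)) 0 T))
          (γx (supOn (fun s => colNorm (Finset.Iic j) (coord (x s))) 0 T)))

/-- `x̄_1 = x_1`, `x̄_{j+1} = x_{j+1} - ϑ_j(x̄_j)`. -/
def xbar (θ : Fin (N + 1) → ℝ → ℝ) (x : XState N) : XState N := fun j =>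
  Fin.induction (motive := fun _ => ℝ) (x 0)
    (fun i prev => x i.succ - θ i.castSucc prev) j

/-- The drift `f̄_j` of the transformed equation `x̄_j' = f̄_j + b_j (ϑ_j(x̄_j) + x̄_{j+1})`,
as a function of the original state; recall `ϑ_j(x̄_j) + x̄_{j+1} = x_{j+1}`. -/
def fbar (S : LowerTriangularSystem N p n) (θ : Fin (N + 1) → ℝ → ℝ) (j : Fin (N + 1))
    (z : ZState n) (x : XState N) (w : EuclideanSpace ℝ (Fin p)) : ℝ :=
  Fin.induction (motive := fun _ => ℝ) (S.f 0 z x w)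
    (fun i prev => S.f i.succ z x w -
      deriv (θ i.castSucc) (xbar θ x i.castSucc) * (prev + S.b i.castSucc * x i.succ)) j

/-- The quantities selected in the recursive design: constants `c_j`, `k_j`, bounding functions
`ι_j`, `m_j`, `m̃_j`, gains `γ̄_{z_j}^x` in the new coordinates, and functions `ψ_j`. -/
structure BacksteppingDesign (N : ℕ) where
  c : Fin (N + 1) → ℝ
  k : Fin (N + 1) → ℝ
  iota : Fin (N + 1) → ℝ → ℝ
  m : Fin (N + 1) → ℝ → ℝ
  mtilde : Fin (N + 1) → ℝ → ℝ
  ψ : Fin (N + 1) → ℝ → ℝ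
  γx : Fin (N + 1) → ℝ → ℝ

namespace BacksteppingDesign

variable (D : BacksteppingDesign N)

/-- `ῑ_j(s) = ι_j(s)² s² / (4 c_j)`. -/
def iotabar (j : Fin (N + 1)) (s : ℝ) : ℝ := 1 / (4 * D.c j) * D.iota j s ^ 2 * s ^ 2

/-- `m̄_j(s) = m̃_j(s)² s² / (4 c_j)`. -/
def mbar (j : Fin (N + 1)) (s : ℝ) : ℝ := 1 / (4 * D.c j) * D.mtilde j s ^ 2 * s ^ 2

/-- `c̄_1 = c_1` and `c̄_j = 2 c_j` for `j ≥ 2`. -/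
def cbar (j : Fin (N + 1)) : ℝ := if j = 0 then D.c j else 2 * D.c j

/-- `ϑ_j(s) = -(c̄_j + b_j²/4 + m_j(s) + ψ_j(|s|)) s / b_j`. -/
def θ (b : Fin (N + 1) → ℝ) (j : Fin (N + 1)) (s : ℝ) : ℝ :=
  -(D.cbar j + 1 / 4 * b j ^ 2 + D.m j s + D.ψ j |s|) * s / b j

/-- `ρ_j(s) = ψ_j(s) s²`. -/
def rho (j : Fin (N + 1)) (s : ℝ) : ℝ := D.ψ j s * s ^ 2

/-- Inverse of `ρ_j` on `[0,∞)`. -/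
def rhoInv (j : Fin (N + 1)) : ℝ → ℝ := Function.invFunOn (D.rho j) (Ici 0)

/-- The gain from `x̄_{j+1}` to `col(x̄_1..x̄_j)`: `ρ_1⁻¹(k_1 s²)` for `j = 1` and
`2 ρ_j⁻¹(k_j s²)` for `j ≥ 2`. -/
def gainX (j : Fin (N + 1)) (s : ℝ) : ℝ :=
  if j = 0 then D.rhoInv j (D.k j * s ^ 2) else 2 * D.rhoInv j (D.k j * s ^ 2)

/-- The gain `γ_{Z_j}^{X_j}` from `col(x̄_1..x̄_j)` to `col(z_1..z_j)`: it is `γ̄_{z_1}^x` for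
`j = 1` and `2 max {γ̄_{z_j}^x, γ̄_{Z_{j-1}}^{x_j}, γ_{z_j}^z ∘ γ̄_{Z_{j-1}}^{x_j}}` for `j ≥ 2`,
where `γ̄_{Z_{j-1}}^{x_j} = γ_{Z_{j-1}}^{X_{j-1}} ∘ gainX (j-1)`. -/
def gainZX (γz : Fin (N + 1) → ℝ → ℝ) (j : Fin (N + 1)) : ℝ → ℝ :=
  Fin.induction (motive := fun _ => ℝ → ℝ) (D.γx 0)
    (fun i prev s => 2 * max (D.γx i.succ s)
      (max (prev (D.gainX i.castSucc s)) (γz i.succ (prev (D.gainX i.castSucc s))))) j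

/-- The gain `γ̄_{Z_j}^{x_{j+1}} = γ_{Z_j}^{X_j} ∘ gainX j` from `x̄_{j+1}` to `col(z_1..z_j)`. -/
def gainZ (γz : Fin (N + 1) → ℝ → ℝ) (j : Fin (N + 1)) (s : ℝ) : ℝ :=
  D.gainZX γz j (D.gainX j s)

/-- The selected quantities fulfil the requirements of the recursive design. -/
structure Admissible (S : LowerTriangularSystem N p n) (γz : Fin (N + 1) → ℝ → ℝ) : Prop where
  c_pos : ∀ j, 0 < D.c j
  k_zero : 2 < D.k 0
  k_succ : ∀ i : Fin N, 3 < D.k i.succ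
  iota_smooth : ∀ j, ContDiff ℝ 1 (D.iota j)
  m_smooth : ∀ j, ContDiff ℝ 1 (D.m j)
  mtilde_smooth : ∀ j, ContDiff ℝ 1 (D.mtilde j)
  ψ_smooth : ∀ j, ContDiff ℝ 1 (D.ψ j)
  iota_nonneg : ∀ j s, 0 ≤ s → 0 ≤ D.iota j s
  m_nonneg : ∀ j s, 0 ≤ D.m j s
  mtilde_nonneg : ∀ j s, 0 ≤ s → 0 ≤ D.mtilde j s
  iotabar_mono : ∀ j, MonotoneOn (D.iotabar j) (Ici 0)
  mbar_mono : ∀ j, MonotoneOn (D.mbar j) (Ici 0)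
  /-- Bound on `f̄_j`; for `j = 1` the middle term vanishes, its vector being empty. -/
  fbar_bound : ∀ j z x, ∀ w ∈ S.W, |fbar S (D.θ S.b) j z x w| ≤
    D.iota j (colNorm (Finset.Iic j) z) * colNorm (Finset.Iic j) z +
      D.mtilde j (colNorm (Finset.Iio j) (xbar (D.θ S.b) x)) *
        colNorm (Finset.Iio j) (xbar (D.θ S.b) x) +
      D.m j (xbar (D.θ S.b) x j) * |xbar (D.θ S.b) x j|
  /-- `γ̄_{z_j}^x` is an ISS gain of the `z_j`-subsystem in the new coordinates. -/
  γx_classKInf : ∀ j, IsClassKInf (D.γx j)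
  γx_slope : ∀ j, FiniteSlopeAtZero (D.γx j)
  γx_gain : ∀ j, ZSubsystemISS S j (xbar (D.θ S.b)) (γz j) (D.γx j)
  ψ_even : ∀ j s, D.ψ j (-s) = D.ψ j s
  rho_classK : ∀ j, IsClassK (D.rho j)
  ψ_zero : ∀ s, 0 < s → D.k 0 * max (D.iotabar 0 (D.γx 0 s) / s ^ 2) 1 < D.ψ 0 s
  ψ_succ : ∀ (i : Fin N) (s : ℝ), 0 < s →
    D.k i.succ * max (D.mbar i.succ s / s ^ 2)
      (max (D.iotabar i.succ (D.gainZX γz i.succ (2 * s)) / s ^ 2) 2) < D.ψ i.succ s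

end BacksteppingDesign

/-- `(γξz, γξx, γξr)` bound `ξ = dϑ_ℓ(x̄_ℓ(t))/dt = ϑ_ℓ'(x̄_ℓ) (f̄_ℓ + b_ℓ (ϑ_ℓ(x̄_ℓ) + x̄_{ℓ+1}))`
in terms of `‖col(z_1..z_ℓ)‖`, `‖col(x̄_1..x̄_ℓ)‖` and `|x̄_{ℓ+1}|` (here `v = x̄_{ℓ+1}`). -/
structure XiBound (S : LowerTriangularSystem N p n) (θ : Fin (N + 1) → ℝ → ℝ)
    (γξz γξx γξr : ℝ → ℝ) : Prop where
  z_classKInf : IsClassKInf γξz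
  x_classKInf : IsClassKInf γξx
  r_classKInf : IsClassKInf γξr
  z_slope : FiniteSlopeAtZero γξz
  x_slope : FiniteSlopeAtZero γξx
  r_slope : FiniteSlopeAtZero γξr
  bound : ∀ z x, ∀ w ∈ S.W, ∀ v : ℝ,
    |deriv (θ (Fin.last N)) (xbar θ x (Fin.last N)) *
      (fbar S θ (Fin.last N) z x w +
        S.b (Fin.last N) * (θ (Fin.last N) (xbar θ x (Fin.last N)) + v))| ≤
    max (γξz (colNorm Finset.univ z)) (max (γξx (colNorm Finset.univ (xbar θ x))) (γξr |v|))

/-- `γ(s) = max {γ_ξ^z(γ̄_{Z_ℓ}^{x_{ℓ+1}}(s)), γ_ξ^x(γ̄_{X_ℓ}^{x_{ℓ+1}}(s)), γ_ξ^r(s)}`. -/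
def loopGain (D : BacksteppingDesign N) (γz : Fin (N + 1) → ℝ → ℝ) (γξz γξx γξr : ℝ → ℝ)
    (s : ℝ) : ℝ :=
  max (γξz (D.gainZ γz (Fin.last N) s)) (max (γξx (D.gainX (Fin.last N) s)) (γξr s))

/-- The time interval `[0, T)`, `T ≤ ∞`. -/
def timeDomain (T : EReal) : Set ℝ := {s | 0 ≤ s ∧ (s : EReal) < T}

/-- The value `ϑ_ℓ(x̄_ℓ)` of the continuous-time feedback in the state `x`. -/
def feedback (θ : Fin (N + 1) → ℝ → ℝ) (x : XState N) : ℝ :=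
  θ (Fin.last N) (xbar θ x (Fin.last N))

/-- `‖r_{[a,t]}‖` where `r(s) = ∫_a^s ξ = ϑ_ℓ(x̄_ℓ(s)) - ϑ_ℓ(x̄_ℓ(a))` is the sampling error of the
input with respect to the sampling time `a`. -/
def samplingErrorSup (θ : Fin (N + 1) → ℝ → ℝ) (x : ℝ → XState N) (a t : ℝ) : ℝ :=
  supOn (fun s => |feedback θ (x s) - feedback θ (x a)|) a t

/-- The times in `[0, T)` after the sampling time `a` at which the triggering condition holds:
`(t - a) γ̄(‖r_{[a,t]}‖) ≥ ‖r_{[a,t]}‖` and `‖r_{[a,t]}‖ ≠ 0`. -/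
def triggerTimes (θ : Fin (N + 1) → ℝ → ℝ) (γbar : ℝ → ℝ) (T : EReal) (x : ℝ → XState N)
    (a : EReal) : Set EReal :=
  {τ | ∃ t : ℝ, τ = (t : EReal) ∧ a < t ∧ (t : EReal) < T ∧
    samplingErrorSup θ x a.toReal t ≤ (t - a.toReal) * γbar (samplingErrorSup θ x a.toReal t) ∧
    samplingErrorSup θ x a.toReal t ≠ 0}

/-- `(z, x)` is a trajectory on `[0, T)`, with parameter `w`, of the system under the
event-triggered controller `u(t) = ϑ_ℓ(x̄_ℓ(t_k))`, `t ∈ [t_k, t_{k+1})`, whose sampling times are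
`t_0 = 0` and `t_{k+1} = inf` of the triggering times after `t_k` (`inf ∅ = ∞`: no more samples).
The trajectory is continuous and satisfies the differential equations with right derivatives, the
input being piecewise constant and right continuous. -/
structure IsClosedLoopTrajectory (S : LowerTriangularSystem N p n) (θ : Fin (N + 1) → ℝ → ℝ)
    (γbar : ℝ → ℝ) (w : EuclideanSpace ℝ (Fin p)) (T : EReal) (t : ℕ → EReal)
    (z : ℝ → ZState n) (x : ℝ → XState N) : Prop where
  horizon_pos : 0 < T
  z_continuousOn : ContinuousOn z (timeDomain T)
  x_continuousOn : ContinuousOn x (timeDomain T)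
  t_zero : t 0 = 0
  t_succ : ∀ k, t (k + 1) = sInf (triggerTimes θ γbar T x (t k))
  covers : ∀ s ∈ timeDomain T, ∃ k, t k ≤ (s : EReal) ∧ (s : EReal) < t (k + 1)
  z_ode : ∀ s ∈ timeDomain T, ∀ j,
    HasDerivWithinAt (fun τ => z τ j) (S.q j (z s) (x s) w) (Ici s) s
  x_ode : ∀ k, ∀ s ∈ timeDomain T, t k ≤ (s : EReal) → (s : EReal) < t (k + 1) → ∀ j,
    HasDerivWithinAt (fun τ => x τ j)
      (S.f j (z s) (x s) w + S.b j *
        Fin.snoc (α := fun _ => ℝ) (x s) (feedback θ (x (t k).toReal)) j.succ) (Ici s) s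

/-- The objectives of event-triggered control, uniformly in `w ∈ W`. -/
structure EventTriggeredObjectives (S : LowerTriangularSystem N p n) (θ : Fin (N + 1) → ℝ → ℝ)
    (γbar : ℝ → ℝ) : Prop where
  /-- From every initial state there is a trajectory defined for all times. -/
  complete : ∀ w ∈ S.W, ∀ (z₀ : ZState n) (x₀ : XState N),
    ∃ t z x, IsClosedLoopTrajectory S θ γbar w ⊤ t z x ∧ z 0 = z₀ ∧ x 0 = x₀
  /-- Global asymptotic stability of the origin. -/
  stable : ∃ β : ℝ → ℝ → ℝ, IsClassKL β ∧
    ∀ w ∈ S.W, ∀ T t z x, IsClosedLoopTrajectory S θ γbar w T t z x →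
      ∀ s ∈ timeDomain T, stateNorm (z s) (x s) ≤ β (stateNorm (z 0) (x 0)) s
  /-- No Zeno behaviour. -/
  zenoFree : ∀ R : ℝ, 0 < R → ∃ τ : ℝ, 0 < τ ∧
    ∀ w ∈ S.W, ∀ T t z x, IsClosedLoopTrajectory S θ γbar w T t z x →
      stateNorm (z 0) (x 0) ≤ R → ∀ k, t k + (τ : EReal) ≤ t (k + 1)

end

/-!
Why the theorem is true.

*Design.* A `C¹` function vanishing at the origin is bounded, on bounded sets, by a multiple of the
norm, uniformly in the compact parameter set (`LinBdd`). This property is stable under the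
operations that produce `f̄_j` from `f_1, …, f_j` and `ϑ_1, …, ϑ_{j-1}`, and a linearly bounded
function has a majorant `L(‖·‖)‖·‖` with `L` smooth, even and increasing. Hence `ι_j`, `m_j`,
`m̃_j`, the gain `γ̄_{z_j}^x` and finally `ψ_j` can be chosen level by level (`exists_admissible`),
and so can the bounds on `ξ = dϑ_ℓ(x̄_ℓ)/dt` (`exists_xiBound`). Gains with a finite slope at `0`
are closed under composition and maxima, which gives the slope of the loop gain.

*Stability.* Completing squares gives the dissipation inequality `d/dt (x̄_j²/2) ≤ -ρ_j(|x̄_j|) +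
ῑ_j(‖ẑ_j‖) + m̄_j(‖(x̄_1, …, x̄_{j-1})‖) + x̄_{j+1}²`, so that `|x̄_j|` is eventually not larger
than `ρ_j⁻¹` of the last three terms. Together with input-to-state stability of the `z_j`, this
yields inequalities between the asymptotic sizes of the blocks (`LoopInequalities`). They are solved
by induction over the levels: the requirements on `ψ_j` make each inner loop a contraction. Here the
gain of the first `j` levels towards `x̄_{j+1}` has to be used with the factor `√2` of the Euclidean
norm of a pair instead of the factor `2` in the statement, since only then it does not exceed the
identity (`sharpGainX_le`). The outer loop is closed by the triggering rule: as long as no sample is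
taken, `γ̄(‖r‖)` is bounded by the supremum of `|ξ|` over the elapsed time, and since `γ̄` is
bounded below by a linear function (the bound on `ξ` controls the linear dependence on `x̄_{ℓ+1}`),
this time is bounded by a constant. Therefore `γ̄(‖r‖)` is at most the supremum of `|ξ|` over a
window of fixed length (`gbar_holdError_le`), and `γ̄ ≥ εγ` closes the loop.

The whole argument is carried out for limits superior along a filter on pairs of a trajectory and a
time (`exists_eventually_le`). The principal filter of a time interval yields uniform stability, and
the filter of times tending to infinity, uniformly over trajectories, yields uniform attractivity.
The two combine to a class `𝒦ℒ` estimate (`exists_classKL`).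

*Dwell time and existence.* On the bounded range of the sampling error `γ̄(s) ≤ Cs`, so that a
triggering time is at least `1/C` after the sampling time. For the existence of trajectories, the
vector field is cut off outside a large ball. The flow of the bounded Lipschitz field with held
inputs is concatenated at the sampling times, and the a priori bound keeps the result inside the
ball (`exists_complete_trajectory`).
-/

/-! ### Gains -/

/-- Gains in the weak sense: `[0,∞) → [0,∞)`, continuous, nondecreasing, zero at zero. Unlike class
`𝒦` functions they may be constant on intervals, so that they are closed under all operations
needed to track the effect of initial conditions. -/
structure IsGain (g : ℝ → ℝ) : Prop where
  zero : g 0 = 0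
  continuousOn : ContinuousOn g (Ici 0)
  monotoneOn : MonotoneOn g (Ici 0)

theorem IsClassK.isGain {g : ℝ → ℝ} (h : IsClassK g) : IsGain g :=
  ⟨h.zero, h.continuousOn, h.strictMonoOn.monotoneOn⟩

namespace IsGain

variable {g h : ℝ → ℝ}

theorem nonneg (hg : IsGain g) {s : ℝ} (hs : 0 ≤ s) : 0 ≤ g s := by
  have := hg.monotoneOn (mem_Ici.2 le_rfl) (mem_Ici.2 hs) hs
  rwa [hg.zero] at this

theorem mono (hg : IsGain g) {s t : ℝ} (hs : 0 ≤ s) (hst : s ≤ t) : g s ≤ g t :=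
  hg.monotoneOn (mem_Ici.2 hs) (mem_Ici.2 (hs.trans hst)) hst

theorem map_max (hg : IsGain g) {s t : ℝ} (hs : 0 ≤ s) (ht : 0 ≤ t) :
    g (max s t) = max (g s) (g t) :=
  hg.monotoneOn.map_max (mem_Ici.2 hs) (mem_Ici.2 ht)

theorem map_le_max (hg : IsGain g) {s t u : ℝ} (hs : 0 ≤ s) (ht : 0 ≤ t) (hu : 0 ≤ u)
    (h : s ≤ max t u) : g s ≤ max (g t) (g u) :=
  (hg.mono hs h).trans (hg.map_max ht hu).le

protected theorem id : IsGain (fun s => s) := ⟨rfl, continuousOn_id, monotone_id.monotoneOn _⟩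

theorem comp (hg : IsGain g) (hh : IsGain h) : IsGain (fun s => g (h s)) :=
  ⟨by rw [hh.zero, hg.zero],
    hg.continuousOn.comp hh.continuousOn fun _ hs => mem_Ici.2 (hh.nonneg hs),
    fun _ hs _ _ hst => hg.mono (hh.nonneg hs) (hh.mono hs hst)⟩

theorem sup (hg : IsGain g) (hh : IsGain h) : IsGain (fun s => max (g s) (h s)) :=
  ⟨by simp [hg.zero, hh.zero], hg.continuousOn.sup hh.continuousOn,
    fun _ hs _ _ hst => max_le_max (hg.mono hs hst) (hh.mono hs hst)⟩

theorem add (hg : IsGain g) (hh : IsGain h) : IsGain (fun s => g s + h s) :=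
  ⟨by simp [hg.zero, hh.zero], hg.continuousOn.add hh.continuousOn,
    fun _ hs _ _ hst => add_le_add (hg.mono hs hst) (hh.mono hs hst)⟩

theorem const_mul (hg : IsGain g) {c : ℝ} (hc : 0 ≤ c) : IsGain (fun s => c * g s) :=
  ⟨by simp [hg.zero], hg.continuousOn.const_mul c,
    fun _ hs _ _ hst => mul_le_mul_of_nonneg_left (hg.mono hs hst) hc⟩

theorem sq (hg : IsGain g) : IsGain (fun s => g s ^ 2) :=
  ⟨by simp [hg.zero], hg.continuousOn.pow 2,
    fun _ hs _ _ hst => pow_le_pow_left₀ (hg.nonneg hs) (hg.mono hs hst) 2⟩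

/-- Finitely many gains have a common majorant. -/
theorem exists_forall_le {ι : Type*} {F : ι → ℝ → ℝ} (s : Finset ι) (hF : ∀ i, IsGain (F i)) :
    ∃ G, IsGain G ∧ ∀ i ∈ s, ∀ t, F i t ≤ G t := by
  classical
  induction s using Finset.induction_on with
  | empty => exact ⟨_, IsGain.id, by simp⟩
  | insert a s _ ih =>
    obtain ⟨G, hG, hle⟩ := ih
    refine ⟨_, (hF a).sup hG, fun i hi t => ?_⟩
    rcases Finset.mem_insert.1 hi with rfl | hi
    · exact le_max_left _ _
    · exact (hle i hi t).trans (le_max_right _ _)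

/-- Right continuity of a gain in the form used for limits superior. -/
theorem exists_gt_lt (hg : IsGain g) {a d : ℝ} (ha : 0 ≤ a) (h : g a < d) :
    ∃ c, a < c ∧ ∀ s, 0 ≤ s → s ≤ c → g s < d := by
  have h1 : ContinuousWithinAt g (Ioi a) a :=
    (hg.continuousOn a ha).mono fun s hs => mem_Ici.2 (ha.trans (le_of_lt hs))
  have h2 : ∀ᶠ s in 𝓝[>] a, g s < d := h1.eventually_lt_const h
  obtain ⟨c, hc, hac⟩ := (h2.and self_mem_nhdsWithin).exists
  exact ⟨c, hac, fun s hs hsc => (hg.mono hs hsc).trans_lt hc⟩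

/-- Left continuity of a gain in the form used for limits superior. -/
theorem exists_lt_gt (hg : IsGain g) {a d : ℝ} (hd : 0 ≤ d) (ha : 0 ≤ a) (h : d < g a) :
    ∃ c, 0 ≤ c ∧ c < a ∧ d < g c := by
  have ha0 : 0 < a := by
    rcases ha.eq_or_lt with rfl | ha
    · rw [hg.zero] at h; exact absurd h (not_lt.2 hd)
    · exact ha
  have h1 : ContinuousWithinAt g (Ico 0 a) a :=
    (hg.continuousOn a ha).mono fun s hs => mem_Ici.2 hs.1
  have h2 : ∀ᶠ s in 𝓝[Ico 0 a] a, d < g s := h1.eventually_const_lt h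
  have : (𝓝[Ico 0 a] a).NeBot := by
    rw [← mem_closure_iff_nhdsWithin_neBot, closure_Ico ha0.ne]; exact ⟨ha, le_rfl⟩
  obtain ⟨c, hc, hac⟩ := (h2.and self_mem_nhdsWithin).exists
  exact ⟨c, hac.1, hac.2, hc⟩

end IsGain

namespace IsClassK

variable {g h : ℝ → ℝ}

theorem pos (hg : IsClassK g) {s : ℝ} (hs : 0 < s) : 0 < g s := by
  have := hg.strictMonoOn (mem_Ici.2 le_rfl) (mem_Ici.2 hs.le) hs
  rwa [hg.zero] at this

theorem nonneg (hg : IsClassK g) {s : ℝ} (hs : 0 ≤ s) : 0 ≤ g s := hg.isGain.nonneg hs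

theorem le_iff_le (hg : IsClassK g) {s t : ℝ} (hs : 0 ≤ s) (ht : 0 ≤ t) : g s ≤ g t ↔ s ≤ t :=
  hg.strictMonoOn.le_iff_le hs ht

theorem comp (hg : IsClassK g) (hh : IsClassK h) : IsClassK (fun s => g (h s)) :=
  ⟨(hg.isGain.comp hh.isGain).zero, (hg.isGain.comp hh.isGain).continuousOn,
    fun _ hs _ ht hst => hg.strictMonoOn (hh.nonneg hs) (hh.nonneg ht) (hh.strictMonoOn hs ht hst)⟩

end IsClassK

namespace IsClassKInf

variable {g h : ℝ → ℝ}

theorem isGain (hg : IsClassKInf g) : IsGain g := hg.toIsClassK.isGain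

theorem comp (hg : IsClassKInf g) (hh : IsClassKInf h) : IsClassKInf (fun s => g (h s)) :=
  ⟨hg.toIsClassK.comp hh.toIsClassK, hg.unbounded.comp hh.unbounded⟩

theorem surjOn (hg : IsClassKInf g) : SurjOn g (Ici 0) (Ici 0) := by
  intro y hy
  obtain ⟨b, hb0, hb⟩ := ((eventually_ge_atTop 0).and
    (hg.unbounded.eventually_ge_atTop y)).exists
  have := intermediate_value_Icc hb0 (hg.continuousOn.mono Icc_subset_Ici_self)
  obtain ⟨s, hs, rfl⟩ := this ⟨by rw [hg.zero]; exact hy, hb⟩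
  exact ⟨s, hs.1, rfl⟩

theorem apply_inv (hg : IsClassKInf g) {y : ℝ} (hy : 0 ≤ y) :
    g (Function.invFunOn g (Ici 0) y) = y := Function.invFunOn_eq (hg.surjOn hy)

theorem inv_nonneg (hg : IsClassKInf g) {y : ℝ} (hy : 0 ≤ y) :
    0 ≤ Function.invFunOn g (Ici 0) y := Function.invFunOn_mem (hg.surjOn hy)

theorem inv_le_iff (hg : IsClassKInf g) {s y : ℝ} (hs : 0 ≤ s) (hy : 0 ≤ y) :
    Function.invFunOn g (Ici 0) y ≤ s ↔ y ≤ g s := by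
  rw [← hg.le_iff_le (hg.inv_nonneg hy) hs, hg.apply_inv hy]

theorem le_inv_iff (hg : IsClassKInf g) {s y : ℝ} (hs : 0 ≤ s) (hy : 0 ≤ y) :
    s ≤ Function.invFunOn g (Ici 0) y ↔ g s ≤ y := by
  rw [← hg.le_iff_le hs (hg.inv_nonneg hy), hg.apply_inv hy]

theorem isGain_inv (hg : IsClassKInf g) : IsGain (Function.invFunOn g (Ici 0)) := by
  set f := Function.invFunOn g (Ici 0)
  have hmono : MonotoneOn f (Ici 0) := fun s hs t ht hst => by
    rw [hg.le_inv_iff (hg.inv_nonneg hs) ht, hg.apply_inv hs]; exact hst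
  refine ⟨le_antisymm ((hg.inv_le_iff le_rfl le_rfl).2 hg.zero.ge)
    (hg.inv_nonneg le_rfl), ?_, hmono⟩
  let e : Ici (0 : ℝ) ≃o Ici (0 : ℝ) :=
    { toFun := fun y => ⟨f y, hg.inv_nonneg y.2⟩
      invFun := fun s => ⟨g s, hg.nonneg s.2⟩
      left_inv := fun y => Subtype.ext (hg.apply_inv y.2)
      right_inv := fun s => Subtype.ext (le_antisymm
        ((hg.inv_le_iff s.2 (hg.nonneg s.2)).2 le_rfl)
        ((hg.le_inv_iff s.2 (hg.nonneg s.2)).2 le_rfl))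
      map_rel_iff' := by
        intro a b
        change f a ≤ f b ↔ (a : ℝ) ≤ b
        rw [hg.le_inv_iff (hg.inv_nonneg a.2) b.2, hg.apply_inv a.2] }
  rw [continuousOn_iff_continuous_domRestrict]
  exact continuous_subtype_val.comp e.continuous

end IsClassKInf

/-- A gain that is bounded by a linear function on bounded sets. -/
structure IsLinGain (g : ℝ → ℝ) : Prop extends IsGain g where
  lin : ∀ R, ∃ C, 0 ≤ C ∧ ∀ s, 0 ≤ s → s ≤ R → g s ≤ C * s

theorem IsGain.isLinGain {g : ℝ → ℝ} (hg : IsGain g) (h : FiniteSlopeAtZero g) : IsLinGain g := by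
  refine ⟨hg, fun R => ?_⟩
  obtain ⟨C, hC⟩ := h
  obtain ⟨δ, hδ, hδC⟩ := (mem_nhdsGT_iff_exists_Ioo_subset).1 hC
  have hδ : 0 < δ := hδ
  have hR : 0 ≤ max R 0 := le_max_right _ _
  refine ⟨max (max C 0) (g (max R 0) / δ), (le_max_right _ _).trans (le_max_left _ _),
    fun s hs hsR => ?_⟩
  rcases hs.eq_or_lt with rfl | hs0
  · simp [hg.zero]
  rcases lt_or_ge s δ with hsδ | hsδ
  · have : g s / s ≤ C := hδC ⟨hs0, hsδ⟩
    rw [div_le_iff₀ hs0] at this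
    exact this.trans (mul_le_mul_of_nonneg_right ((le_max_left _ _).trans (le_max_left _ _)) hs)
  · calc g s ≤ g (max R 0) := hg.mono hs (hsR.trans (le_max_left _ _))
      _ = g (max R 0) / δ * δ := by field_simp
      _ ≤ g (max R 0) / δ * s := mul_le_mul_of_nonneg_left hsδ (div_nonneg (hg.nonneg hR) hδ.le)
      _ ≤ _ := mul_le_mul_of_nonneg_right (le_max_right _ _) hs

namespace IsLinGain

variable {g h : ℝ → ℝ}

theorem finiteSlope (hg : IsLinGain g) : FiniteSlopeAtZero g := by
  obtain ⟨C, -, hC⟩ := hg.lin 1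
  refine ⟨C, ?_⟩
  filter_upwards [Ioo_mem_nhdsGT (zero_lt_one (α := ℝ))] with s hs
  rw [div_le_iff₀ hs.1]
  exact hC s hs.1.le hs.2.le

theorem comp (hg : IsLinGain g) (hh : IsLinGain h) : IsLinGain (fun s => g (h s)) := by
  refine ⟨hg.toIsGain.comp hh.toIsGain, fun R => ?_⟩
  obtain ⟨C, hC0, hC⟩ := hh.lin R
  obtain ⟨C', hC0', hC'⟩ := hg.lin (h R)
  refine ⟨C' * C, mul_nonneg hC0' hC0, fun s hs hsR => ?_⟩
  calc g (h s) ≤ C' * h s := hC' _ (hh.nonneg hs) (hh.mono hs hsR)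
    _ ≤ C' * (C * s) := mul_le_mul_of_nonneg_left (hC s hs hsR) hC0'
    _ = _ := by ring

theorem sup (hg : IsLinGain g) (hh : IsLinGain h) : IsLinGain (fun s => max (g s) (h s)) := by
  refine ⟨hg.toIsGain.sup hh.toIsGain, fun R => ?_⟩
  obtain ⟨C, hC0, hC⟩ := hg.lin R
  obtain ⟨C', hC0', hC'⟩ := hh.lin R
  refine ⟨C + C', add_nonneg hC0 hC0', fun s hs hsR => max_le ?_ ?_⟩
  · nlinarith [hC s hs hsR, mul_nonneg hC0' hs]
  · nlinarith [hC' s hs hsR, mul_nonneg hC0 hs]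

theorem const_mul (hg : IsLinGain g) {c : ℝ} (hc : 0 ≤ c) : IsLinGain (fun s => c * g s) := by
  refine ⟨hg.toIsGain.const_mul hc, fun R => ?_⟩
  obtain ⟨C, hC0, hC⟩ := hg.lin R
  refine ⟨c * C, mul_nonneg hc hC0, fun s hs hsR => ?_⟩
  rw [mul_assoc]
  exact mul_le_mul_of_nonneg_left (hC s hs hsR) hc

protected theorem id : IsLinGain (fun s => s) :=
  ⟨IsGain.id, fun _ => ⟨1, zero_le_one, fun s _ _ => (one_mul s).ge⟩⟩

end IsLinGain

/-! ### Small-gain algebra of the recursive design -/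

namespace BacksteppingDesign

variable {N p : ℕ} {n : Fin (N + 1) → ℕ} {S : LowerTriangularSystem N p n}
  {γz : Fin (N + 1) → ℝ → ℝ} {D : BacksteppingDesign N}

theorem gainZX_succ (i : Fin N) (s : ℝ) : D.gainZX γz i.succ s =
    2 * max (D.γx i.succ s)
      (max (D.gainZ γz i.castSucc s) (γz i.succ (D.gainZ γz i.castSucc s))) := rfl

/-- A function `ρ_j` of class `𝒦` that dominates a quadratic function is unbounded. -/
theorem rho_classKInf_of {j : Fin (N + 1)} (hρ : IsClassK (D.rho j)) (hk : 1 ≤ D.k j)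
    (h : ∀ s, 0 < s → D.k j * s ^ 2 < D.rho j s) : IsClassKInf (D.rho j) := by
  refine ⟨hρ, tendsto_atTop_mono' _ ?_ tendsto_id⟩
  filter_upwards [eventually_ge_atTop 1] with s hs
  have h1 := h s (by linarith)
  simp only [id]
  nlinarith

theorem rhoInv_le_of {j : Fin (N + 1)} (hρ : IsClassK (D.rho j)) (hk : 1 ≤ D.k j)
    (h : ∀ s, 0 < s → D.k j * s ^ 2 < D.rho j s) {s : ℝ} (hs : 0 ≤ s) :
    D.rhoInv j (D.k j * s ^ 2) ≤ s := by
  have hK := rho_classKInf_of hρ hk h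
  refine (hK.inv_le_iff hs (by positivity)).2 ?_
  rcases hs.eq_or_lt with rfl | hs
  · simp [hρ.zero]
  · exact (h s hs).le

theorem isLinGain_gainX_of {j : Fin (N + 1)} (hρ : IsClassK (D.rho j)) (hk : 1 ≤ D.k j)
    (h : ∀ s, 0 < s → D.k j * s ^ 2 < D.rho j s) : IsLinGain (D.gainX j) := by
  have h1 : IsLinGain (fun s => D.rhoInv j (D.k j * s ^ 2)) :=
    ⟨(rho_classKInf_of hρ hk h).isGain_inv.comp (IsGain.id.sq.const_mul (by linarith)),
      fun R => ⟨1, zero_le_one, fun s hs _ => by simpa using rhoInv_le_of hρ hk h hs⟩⟩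
  unfold gainX
  by_cases hj : j = 0
  · simpa only [hj, if_true] using hj ▸ h1
  · simpa only [hj, if_false] using h1.const_mul zero_le_two

theorem isLinGain_gainZX_of (hγz : ∀ j, IsLinGain (γz j)) (j : Fin (N + 1))
    (hX : ∀ i < j, IsLinGain (D.gainX i)) (hγx : ∀ i ≤ j, IsLinGain (D.γx i)) :
    IsLinGain (D.gainZX γz j) := by
  induction j using Fin.induction with
  | zero => exact hγx 0 le_rfl
  | succ i ih =>
    have hlt : i.castSucc < i.succ := Fin.castSucc_lt_succ
    have h1 : IsLinGain (D.gainZ γz i.castSucc) :=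
      (ih (fun k hk => hX k (hk.trans hlt)) fun k hk => hγx k (hk.trans hlt.le)).comp (hX _ hlt)
    exact ((hγx _ le_rfl).sup (h1.sup ((hγz i.succ).comp h1))).const_mul zero_le_two

namespace Admissible

theorem two_lt_k (hD : D.Admissible S γz) (j : Fin (N + 1)) : 2 < D.k j := by
  refine Fin.cases hD.k_zero (fun i => ?_) j
  linarith [hD.k_succ i]

theorem lt_rho_zero (hD : D.Admissible S γz) {s : ℝ} (hs : 0 < s) :
    D.k 0 * D.iotabar 0 (D.γx 0 s) < D.rho 0 s ∧ D.k 0 * s ^ 2 < D.rho 0 s := by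
  have h := hD.ψ_zero s hs
  have hk := hD.k_zero
  have h2 : 0 < s ^ 2 := by positivity
  rw [mul_max_of_nonneg _ _ (by linarith), max_lt_iff] at h
  have h1 := mul_lt_mul_of_pos_right h.1 h2
  have h3 := mul_lt_mul_of_pos_right h.2 h2
  rw [mul_assoc, div_mul_cancel₀ _ h2.ne'] at h1
  rw [mul_one] at h3
  exact ⟨h1, h3⟩

theorem lt_rho_succ (hD : D.Admissible S γz) (i : Fin N) {s : ℝ} (hs : 0 < s) :
    D.k i.succ * D.mbar i.succ s < D.rho i.succ s ∧
    D.k i.succ * D.iotabar i.succ (D.gainZX γz i.succ (2 * s)) < D.rho i.succ s ∧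
    2 * D.k i.succ * s ^ 2 < D.rho i.succ s := by
  have h := hD.ψ_succ i s hs
  have hk := hD.k_succ i
  have h2 : 0 < s ^ 2 := by positivity
  rw [mul_max_of_nonneg _ _ (by linarith), mul_max_of_nonneg _ _ (by linarith), max_lt_iff,
    max_lt_iff] at h
  have h1 := mul_lt_mul_of_pos_right h.1 h2
  have h3 := mul_lt_mul_of_pos_right h.2.1 h2
  have h4 := mul_lt_mul_of_pos_right h.2.2 h2
  rw [mul_assoc, div_mul_cancel₀ _ h2.ne'] at h1 h3
  exact ⟨h1, h3, by rw [rho]; linarith⟩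

theorem sq_lt_rho (hD : D.Admissible S γz) (j : Fin (N + 1)) {s : ℝ} (hs : 0 < s) :
    D.k j * s ^ 2 < D.rho j s := by
  refine Fin.cases (hD.lt_rho_zero hs).2 (fun i => ?_) j
  have h := (hD.lt_rho_succ i hs).2.2
  have : 0 < D.k i.succ * s ^ 2 := mul_pos (by linarith [hD.k_succ i]) (by positivity)
  linarith

theorem rho_classKInf (hD : D.Admissible S γz) (j : Fin (N + 1)) : IsClassKInf (D.rho j) :=
  rho_classKInf_of (hD.rho_classK j) (by linarith [hD.two_lt_k j]) fun _ => hD.sq_lt_rho j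

theorem isGain_rhoInv (hD : D.Admissible S γz) (j : Fin (N + 1)) : IsGain (D.rhoInv j) :=
  (hD.rho_classKInf j).isGain_inv

theorem isGain_iotabar (hD : D.Admissible S γz) (j : Fin (N + 1)) : IsGain (D.iotabar j) := by
  refine ⟨by simp [iotabar], Continuous.continuousOn ?_, hD.iotabar_mono j⟩
  have := (hD.iota_smooth j).continuous
  unfold iotabar
  fun_prop

theorem isGain_mbar (hD : D.Admissible S γz) (j : Fin (N + 1)) : IsGain (D.mbar j) := by
  refine ⟨by simp [mbar], Continuous.continuousOn ?_, hD.mbar_mono j⟩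
  have := (hD.mtilde_smooth j).continuous
  unfold mbar
  fun_prop

theorem rhoInv_le (hD : D.Admissible S γz) (j : Fin (N + 1)) {s : ℝ} (hs : 0 ≤ s) :
    D.rhoInv j (D.k j * s ^ 2) ≤ s :=
  rhoInv_le_of (hD.rho_classK j) (by linarith [hD.two_lt_k j]) (fun _ => hD.sq_lt_rho j) hs

/-- The factor `2` in the last term of the requirement on `ψ_j` is what keeps `√2 ρ_j⁻¹(k_j s²)`
below the identity. -/
theorem sqrt_two_mul_rhoInv_le (hD : D.Admissible S γz) (i : Fin N) {s : ℝ} (hs : 0 ≤ s) :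
    √2 * D.rhoInv i.succ (D.k i.succ * s ^ 2) ≤ s := by
  have hk := hD.two_lt_k i.succ
  have h2 : 0 < √2 := by positivity
  rcases hs.eq_or_lt with rfl | hs
  · simp [(hD.isGain_rhoInv i.succ).zero]
  · rw [← le_div_iff₀' h2]
    refine ((hD.rho_classKInf i.succ).inv_le_iff (by positivity) (by positivity)).2 ?_
    have := (hD.lt_rho_succ i (s := s / √2) (by positivity)).2.2
    rw [div_pow, Real.sq_sqrt (by norm_num)] at this
    linarith

theorem isGain_rhoInv_sq (hD : D.Admissible S γz) (j : Fin (N + 1)) :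
    IsGain (fun s => D.rhoInv j (D.k j * s ^ 2)) :=
  (hD.isGain_rhoInv j).comp (IsGain.id.sq.const_mul (by linarith [hD.two_lt_k j]))

theorem isLinGain_gainX (hD : D.Admissible S γz) (j : Fin (N + 1)) : IsLinGain (D.gainX j) :=
  isLinGain_gainX_of (hD.rho_classK j) (by linarith [hD.two_lt_k j]) fun _ => hD.sq_lt_rho j

theorem isLinGain_gainZX (hD : D.Admissible S γz) (hγz : ∀ j, IsLinGain (γz j))
    (j : Fin (N + 1)) : IsLinGain (D.gainZX γz j) :=
  isLinGain_gainZX_of hγz j (fun i _ => hD.isLinGain_gainX i) fun i _ =>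
    (hD.γx_classKInf i).isGain.isLinGain (hD.γx_slope i)

theorem isLinGain_gainZ (hD : D.Admissible S γz) (hγz : ∀ j, IsLinGain (γz j))
    (j : Fin (N + 1)) : IsLinGain (D.gainZ γz j) :=
  (hD.isLinGain_gainZX hγz j).comp (hD.isLinGain_gainX j)

end Admissible

end BacksteppingDesign

theorem XiBound.isLinGain_loopGain {N p : ℕ} {n : Fin (N + 1) → ℕ}
    {S : LowerTriangularSystem N p n} {γz : Fin (N + 1) → ℝ → ℝ} {D : BacksteppingDesign N}
    {γξz γξx γξr : ℝ → ℝ} (hξ : XiBound S (D.θ S.b) γξz γξx γξr)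
    (hD : D.Admissible S γz) (hγz : ∀ j, IsLinGain (γz j)) :
    IsLinGain (loopGain D γz γξz γξx γξr) :=
  ((hξ.z_classKInf.isGain.isLinGain hξ.z_slope).comp (hD.isLinGain_gainZ hγz _)).sup
    (((hξ.x_classKInf.isGain.isLinGain hξ.x_slope).comp (hD.isLinGain_gainX _)).sup
      (hξ.r_classKInf.isGain.isLinGain hξ.r_slope))

/-- The entry of the preceding level, `0` for the first level. -/
def below {N : ℕ} (Y : Fin (N + 1) → ℝ) : Fin (N + 1) → ℝ :=
  Fin.cases 0 fun i => Y i.castSucc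

/-- The entry of the following level, `r` for the last level. -/
def above {N : ℕ} (Y : Fin (N + 1) → ℝ) (r : ℝ) (j : Fin (N + 1)) : ℝ :=
  Fin.snoc (α := fun _ => ℝ) Y r j.succ

@[simp] theorem below_zero {N : ℕ} (Y : Fin (N + 1) → ℝ) : below Y 0 = 0 := rfl

@[simp] theorem below_succ {N : ℕ} (Y : Fin (N + 1) → ℝ) (i : Fin N) :
    below Y i.succ = Y i.castSucc := rfl

@[simp] theorem above_castSucc {N : ℕ} (Y : Fin (N + 1) → ℝ) (r : ℝ) (i : Fin N) :
    above Y r i.castSucc = Y i.succ := by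
  rw [above, Fin.succ_castSucc, Fin.snoc_castSucc]

@[simp] theorem above_last {N : ℕ} (Y : Fin (N + 1) → ℝ) (r : ℝ) :
    above Y r (Fin.last N) = r := by
  rw [above, Fin.succ_last, Fin.snoc_last]

theorem below_nonneg {N : ℕ} {Y : Fin (N + 1) → ℝ} (hY : ∀ j, 0 ≤ Y j) (j : Fin (N + 1)) :
    0 ≤ below Y j := Fin.cases le_rfl (fun i => hY i.castSucc) j

theorem above_nonneg {N : ℕ} {Y : Fin (N + 1) → ℝ} {r : ℝ} (hY : ∀ j, 0 ≤ Y j) (hr : 0 ≤ r)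
    (j : Fin (N + 1)) : 0 ≤ above Y r j := by
  refine Fin.lastCases ?_ (fun i => ?_) j <;> simp [hr, hY]

/-- The inequalities between the sizes `Z j = ‖col(z_1..z_j)‖`, `X j = ‖col(x̄_1..x̄_j)‖`,
`zs j = ‖z_j‖`, `xs j = |x̄_j|` and the size `r` of the sampling error, which hold for suprema
(with `e` measuring the initial state) as well as for limits superior (with `e = 0`). -/
structure LoopInequalities {N : ℕ} (D : BacksteppingDesign N) (γz : Fin (N + 1) → ℝ → ℝ)
    (e : ℝ) (Z X zs xs : Fin (N + 1) → ℝ) (r : ℝ) : Prop where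
  e_nonneg : 0 ≤ e
  Z_nonneg : ∀ j, 0 ≤ Z j
  X_nonneg : ∀ j, 0 ≤ X j
  zs_nonneg : ∀ j, 0 ≤ zs j
  xs_nonneg : ∀ j, 0 ≤ xs j
  r_nonneg : 0 ≤ r
  Z_le : ∀ j, Z j ≤ √(below Z j ^ 2 + zs j ^ 2)
  X_le : ∀ j, X j ≤ √(below X j ^ 2 + xs j ^ 2)
  xs_le : ∀ j, xs j ≤ X j
  zs_le : ∀ j, zs j ≤ max e (max (γz j (below Z j)) (D.γx j (X j)))
  rho_le : ∀ j, D.rho j (xs j) ≤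
    max e (D.iotabar j (Z j) + D.mbar j (below X j) + above xs r j ^ 2)

theorem sqrt_sq_add_sq_le_sqrt_two_mul_max {a b : ℝ} (ha : 0 ≤ a) (hb : 0 ≤ b) :
    √(a ^ 2 + b ^ 2) ≤ √2 * max a b := by
  rw [Real.sqrt_le_left (by positivity), mul_pow, Real.sq_sqrt (by norm_num)]
  have h1 := pow_le_pow_left₀ ha (le_max_left a b) 2
  have h2 := pow_le_pow_left₀ hb (le_max_right a b) 2
  linarith

theorem sqrt_sq_add_sq_le_two_mul_max {a b : ℝ} (ha : 0 ≤ a) (hb : 0 ≤ b) :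
    √(a ^ 2 + b ^ 2) ≤ 2 * max a b :=
  (sqrt_sq_add_sq_le_sqrt_two_mul_max ha hb).trans <| mul_le_mul_of_nonneg_right
    ((Real.sqrt_le_left (by norm_num)).2 (by norm_num)) (le_max_of_le_left ha)

namespace BacksteppingDesign

variable {N p : ℕ} {n : Fin (N + 1) → ℕ} {S : LowerTriangularSystem N p n}
  {γz : Fin (N + 1) → ℝ → ℝ} {D : BacksteppingDesign N}

/-- The gain from `x̄_{j+1}` to `col(x̄_1..x̄_j)` with the factor `√2` that `gainX` rounds up to
`2`. Only this sharper gain is guaranteed to stay below the identity. -/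
noncomputable def sharpGainX (D : BacksteppingDesign N) (j : Fin (N + 1)) (s : ℝ) : ℝ :=
  if j = 0 then D.rhoInv j (D.k j * s ^ 2) else √2 * D.rhoInv j (D.k j * s ^ 2)

namespace Admissible

theorem sharpGainX_le (hD : D.Admissible S γz) (j : Fin (N + 1)) {s : ℝ} (hs : 0 ≤ s) :
    D.sharpGainX j s ≤ s := by
  refine Fin.cases ?_ (fun i => ?_) j
  · exact hD.rhoInv_le 0 hs
  · simpa [sharpGainX, Fin.succ_ne_zero] using hD.sqrt_two_mul_rhoInv_le i hs

theorem sharpGainX_le_gainX (hD : D.Admissible S γz) (j : Fin (N + 1)) {s : ℝ} (hs : 0 ≤ s) :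
    D.sharpGainX j s ≤ D.gainX j s := by
  unfold sharpGainX gainX
  split_ifs
  · exact le_rfl
  · exact mul_le_mul_of_nonneg_right ((Real.sqrt_le_left (by norm_num)).2 (by norm_num))
      ((hD.isGain_rhoInv_sq j).nonneg hs)

theorem sharpGainX_nonneg (hD : D.Admissible S γz) (j : Fin (N + 1)) {s : ℝ} (hs : 0 ≤ s) :
    0 ≤ D.sharpGainX j s := by
  have := (hD.isGain_rhoInv_sq j).nonneg hs
  unfold sharpGainX
  split_ifs <;> positivity

/-- The inner small-gain step: a bound on `ρ_j(|x̄_j|)` becomes one on `|x̄_j|`. -/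
theorem le_of_rho_le (hD : D.Admissible S γz) (j : Fin (N + 1)) {x M a : ℝ} (hx : 0 ≤ x)
    (hM : 0 ≤ M) (h : D.rho j x ≤ max M (D.k j * a ^ 2)) :
    x ≤ max (D.rhoInv j M) (D.rhoInv j (D.k j * a ^ 2)) := by
  have hk := hD.two_lt_k j
  rw [← (hD.isGain_rhoInv j).map_max hM (by positivity)]
  exact ((hD.rho_classKInf j).le_inv_iff hx (le_max_of_le_left hM)).2 h

/-- The small-gain estimate for the first level. -/
theorem exists_gain_zero (hD : D.Admissible S γz) (hγz : ∀ j, IsLinGain (γz j)) :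
    ∃ Φ, IsGain Φ ∧ ∀ e Z X zs xs r, LoopInequalities D γz e Z X zs xs r →
      X 0 ≤ max (Φ e) (D.sharpGainX 0 (above xs r 0)) ∧
      Z 0 ≤ max (Φ e) (D.gainZ γz 0 (above xs r 0)) := by
  have hι := hD.isGain_iotabar 0
  have hγx := (hD.γx_classKInf 0).isGain
  have hM : IsGain (fun e => e + 3 * D.iotabar 0 e) :=
    IsGain.id.add (hι.const_mul (by norm_num))
  have hΦ₁ := (hD.isGain_rhoInv 0).comp hM
  refine ⟨_, hΦ₁.sup (IsGain.id.sup (hγx.comp hΦ₁)), fun e Z X zs xs r L => ?_⟩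
  have he := L.e_nonneg
  have hx := L.xs_nonneg 0
  set x := xs 0 with hxdef
  set a := above xs r 0 with hadef
  have ha : 0 ≤ a := above_nonneg L.xs_nonneg L.r_nonneg 0
  have hX : X 0 ≤ x := by
    have := L.X_le 0
    rwa [below_zero, zero_pow two_ne_zero, zero_add, Real.sqrt_sq hx] at this
  have hZ : Z 0 ≤ max e (D.γx 0 (X 0)) := by
    have h1 := L.Z_le 0
    rw [below_zero, zero_pow two_ne_zero, zero_add, Real.sqrt_sq (L.zs_nonneg 0)] at h1
    have h2 := L.zs_le 0
    rw [below_zero, (hγz 0).zero, max_eq_right (hγx.nonneg (L.X_nonneg 0))] at h2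
    exact h1.trans h2
  have hρ : D.rho 0 x ≤ max (e + 3 * D.iotabar 0 e) (D.k 0 * a ^ 2) := by
    by_contra! hcon
    obtain ⟨hc1, hc2⟩ := max_lt_iff.1 hcon
    have hk := hD.k_zero
    have hιe := hι.nonneg he
    have hx0 : 0 < x := by
      rcases hx.eq_or_lt with h0 | h0
      · rw [← h0, (hD.rho_classK 0).zero] at hc1; linarith
      · exact h0
    have h1 := L.rho_le 0
    rw [below_zero, (hD.isGain_mbar 0).zero] at h1
    have h2 : D.iotabar 0 (Z 0) ≤ max (D.iotabar 0 e) (D.iotabar 0 (D.γx 0 x)) :=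
      hι.map_le_max (L.Z_nonneg 0) he (hγx.nonneg hx)
        (hZ.trans (max_le_max le_rfl (hγx.mono (L.X_nonneg 0) hX)))
    have h3 := (hD.lt_rho_zero hx0).1
    have h4 := hι.nonneg (hγx.nonneg hx)
    have ha2 : 0 ≤ a ^ 2 := sq_nonneg a
    rcases le_max_iff.1 h1 with h1 | h1
    · linarith
    rcases le_max_iff.1 h2 with h2 | h2 <;> nlinarith
  have hxle := hD.le_of_rho_le 0 hx (hM.nonneg he) hρ
  have hXle := hX.trans hxle
  refine ⟨hXle.trans (max_le_max (le_max_left _ _) le_rfl), ?_⟩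
  have h5 := hγx.map_le_max (L.X_nonneg 0) (hΦ₁.nonneg he) ((hD.isGain_rhoInv_sq 0).nonneg ha) hXle
  refine hZ.trans (max_le ?_ (h5.trans (max_le ?_ ?_)))
  · exact le_max_of_le_left (le_max_of_le_right (le_max_left _ _))
  · exact le_max_of_le_left (le_max_of_le_right (le_max_right _ _))
  · exact le_max_of_le_right le_rfl

/-- The small-gain estimate for a level, given that for the preceding one. The interconnection with
`x̄_{j-1}, …, x̄_1` costs nothing because the sharp gain of the preceding level is at most the
identity, and `k_j > 3` lets the three terms on the right-hand side of the dissipation inequality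
be split. -/
theorem exists_gain_succ (hD : D.Admissible S γz) (hγz : ∀ j, IsLinGain (γz j)) (i : Fin N)
    {Φ : ℝ → ℝ} (hΦ : IsGain Φ)
    (ih : ∀ e Z X zs xs r, LoopInequalities D γz e Z X zs xs r →
      X i.castSucc ≤ max (Φ e) (D.sharpGainX i.castSucc (above xs r i.castSucc)) ∧
      Z i.castSucc ≤ max (Φ e) (D.gainZ γz i.castSucc (above xs r i.castSucc))) :
    ∃ Φ, IsGain Φ ∧ ∀ e Z X zs xs r, LoopInequalities D γz e Z X zs xs r →
      X i.succ ≤ max (Φ e) (D.sharpGainX i.succ (above xs r i.succ)) ∧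
      Z i.succ ≤ max (Φ e) (D.gainZ γz i.succ (above xs r i.succ)) := by
  have hι := hD.isGain_iotabar i.succ
  have hm := hD.isGain_mbar i.succ
  have hγx := (hD.γx_classKInf i.succ).isGain
  have hg := (hγz i.succ).toIsGain
  have hZX := (hD.isLinGain_gainZX hγz i.succ).toIsGain
  have hgZ := (hD.isLinGain_gainZ hγz i.castSucc).toIsGain
  have hΦ₂ := (hΦ.sup (IsGain.id.sup (hg.comp hΦ))).const_mul zero_le_two
  obtain ⟨Φ₃, hΦ₃def, hΦ₃⟩ : ∃ Φ₃ : ℝ → ℝ, (∀ e, Φ₃ e = max (2 * max (Φ e) (max e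
      (γz i.succ (Φ e)))) (D.gainZX γz i.succ (2 * Φ e))) ∧ IsGain Φ₃ :=
    ⟨_, fun _ => rfl, hΦ₂.sup (hZX.comp (hΦ.const_mul zero_le_two))⟩
  obtain ⟨M, hMdef, hM⟩ : ∃ M : ℝ → ℝ, (∀ e, M e = e + (3 * D.iotabar i.succ (Φ₃ e) +
      3 * D.mbar i.succ (Φ e))) ∧ IsGain M :=
    ⟨_, fun _ => rfl, IsGain.id.add (((hι.comp hΦ₃).const_mul zero_le_three).add
      ((hm.comp hΦ).const_mul zero_le_three))⟩
  have hΦ₄ := (hD.isGain_rhoInv i.succ).comp hM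
  have hΦ₅ := (hΦ.sup hΦ₄).const_mul (Real.sqrt_nonneg 2)
  refine ⟨_, hΦ₅.sup (hΦ₂.sup (hZX.comp hΦ₅)), fun e Z X zs xs r L => ?_⟩
  have he := L.e_nonneg
  have hx := L.xs_nonneg i.succ
  have hX0 := L.X_nonneg i.succ
  obtain ⟨ihX, ihZ⟩ := ih e Z X zs xs r L
  rw [above_castSucc] at ihX ihZ
  have hZ' := L.Z_le i.succ
  have hX' := L.X_le i.succ
  have hzs := L.zs_le i.succ
  have hρ' := L.rho_le i.succ
  have hxX := L.xs_le i.succ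
  rw [below_succ] at hZ' hX' hzs hρ'
  set x := xs i.succ
  set a := above xs r i.succ with hadef
  have ha : 0 ≤ a := above_nonneg L.xs_nonneg L.r_nonneg _
  have hΦe := hΦ.nonneg he
  have hXi : X i.castSucc ≤ max (Φ e) x := ihX.trans (max_le_max le_rfl (hD.sharpGainX_le _ hx))
  have hmax : max (X i.castSucc) x ≤ max (Φ e) x := max_le hXi (le_max_right _ _)
  have hXs : X i.succ ≤ √2 * max (Φ e) x :=
    (hX'.trans (sqrt_sq_add_sq_le_sqrt_two_mul_max (L.X_nonneg _) hx)).trans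
      (mul_le_mul_of_nonneg_left hmax (Real.sqrt_nonneg 2))
  have hX2 : X i.succ ≤ max (2 * Φ e) (2 * x) := by
    rw [← mul_max_of_nonneg _ _ zero_le_two]
    exact (hX'.trans (sqrt_sq_add_sq_le_two_mul_max (L.X_nonneg _) hx)).trans
      (mul_le_mul_of_nonneg_left hmax zero_le_two)
  -- the gain from `col(x̄_1..x̄_j)` to `col(z_1..z_j)`, as `|x̄_j| ≤ ‖col(x̄_1..x̄_j)‖`
  have hZs : Z i.succ ≤ max (2 * max (Φ e) (max e (γz i.succ (Φ e))))
      (D.gainZX γz i.succ (X i.succ)) := by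
    have h1 : Z i.castSucc ≤ max (Φ e) (D.gainZ γz i.castSucc (X i.succ)) :=
      ihZ.trans (max_le_max le_rfl (hgZ.mono hx hxX))
    have h2 := hg.map_le_max (L.Z_nonneg _) hΦe (hgZ.nonneg hX0) h1
    refine (hZ'.trans (sqrt_sq_add_sq_le_two_mul_max (L.Z_nonneg _) (L.zs_nonneg _))).trans ?_
    rw [gainZX_succ, ← mul_max_of_nonneg _ _ zero_le_two]
    refine mul_le_mul_of_nonneg_left (max_le ?_ (hzs.trans (max_le ?_ (max_le ?_ ?_)))) zero_le_two
    · refine h1.trans (max_le ?_ ?_) <;> simp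
    · simp
    · refine h2.trans (max_le ?_ ?_) <;> simp
    · simp
  have hZ3 := hZs.trans (max_le_max le_rfl (hZX.map_le_max hX0 (by positivity) (by positivity) hX2))
  rw [← max_assoc, ← hΦ₃def] at hZ3
  have hρ : D.rho i.succ x ≤ max (M e) (D.k i.succ * a ^ 2) := by
    rw [hMdef]
    by_contra! hcon
    obtain ⟨hc1, hc2⟩ := max_lt_iff.1 hcon
    have hk := hD.k_succ i
    have hιe := hι.nonneg (hΦ₃.nonneg he)
    have hme := hm.nonneg hΦe
    have hx0 : 0 < x := by
      rcases hx.eq_or_lt with h0 | h0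
      · rw [← h0, (hD.rho_classK i.succ).zero] at hc1; linarith
      · exact h0
    have h2 := hι.map_le_max (L.Z_nonneg _) (hΦ₃.nonneg he) (hZX.nonneg (by positivity)) hZ3
    have h3 := hm.map_le_max (L.X_nonneg _) hΦe hx hXi
    obtain ⟨h4, h5, -⟩ := hD.lt_rho_succ i hx0
    have h6 := hι.nonneg (hZX.nonneg (s := 2 * x) (by positivity))
    have h7 := hm.nonneg hx
    have ha2 : 0 ≤ a ^ 2 := sq_nonneg a
    rcases le_max_iff.1 hρ' with h1 | h1
    · linarith
    have hb1 : 3 * D.iotabar i.succ (Z i.succ) < D.rho i.succ x := by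
      have := mul_le_mul_of_nonneg_right hk.le h6
      rcases le_max_iff.1 h2 with h2 | h2 <;> linarith
    have hb2 : 3 * D.mbar i.succ (X i.castSucc) < D.rho i.succ x := by
      have := mul_le_mul_of_nonneg_right hk.le h7
      rcases le_max_iff.1 h3 with h3 | h3 <;> linarith
    have hb3 : 3 * a ^ 2 < D.rho i.succ x := by
      have := mul_le_mul_of_nonneg_right hk.le ha2
      linarith
    linarith
  have hxle := hD.le_of_rho_le i.succ hx (hM.nonneg he) hρ
  have hXt : X i.succ ≤ max (√2 * max (Φ e) (D.rhoInv i.succ (M e))) (D.sharpGainX i.succ a) := by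
    refine (hXs.trans (mul_le_mul_of_nonneg_left (max_le_max le_rfl hxle)
      (Real.sqrt_nonneg 2))).trans ?_
    rw [sharpGainX, if_neg (Fin.succ_ne_zero i), ← mul_max_of_nonneg _ _ (Real.sqrt_nonneg 2),
      max_assoc]
  refine ⟨hXt.trans (max_le_max (le_max_left _ _) le_rfl), ?_⟩
  have h8 := hZX.map_le_max hX0 (hΦ₅.nonneg he) (hD.sharpGainX_nonneg _ ha) hXt
  refine hZs.trans (max_le ?_ (h8.trans (max_le ?_ ?_)))
  · exact le_max_of_le_left (le_max_of_le_right (le_max_left _ _))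
  · exact le_max_of_le_left (le_max_of_le_right (le_max_right _ _))
  · exact le_max_of_le_right
      (hZX.mono (hD.sharpGainX_nonneg _ ha) (hD.sharpGainX_le_gainX _ ha))

/-- The cascade of the levels `1, …, j`, seen from its input `x̄_{j+1}`. -/
theorem exists_gain (hD : D.Admissible S γz) (hγz : ∀ j, IsLinGain (γz j)) (j : Fin (N + 1)) :
    ∃ Φ, IsGain Φ ∧ ∀ e Z X zs xs r, LoopInequalities D γz e Z X zs xs r →
      X j ≤ max (Φ e) (D.sharpGainX j (above xs r j)) ∧
      Z j ≤ max (Φ e) (D.gainZ γz j (above xs r j)) := by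
  induction j using Fin.induction with
  | zero => exact hD.exists_gain_zero hγz
  | succ i ih =>
    obtain ⟨Φ, hΦ, h⟩ := ih
    exact hD.exists_gain_succ hγz i hΦ h

/-- The outer small-gain step, which closes the loop through the sampling error. -/
theorem exists_loop_bound (hD : D.Admissible S γz) (hγz : ∀ j, IsLinGain (γz j))
    {γξz γξx γξr γbar : ℝ → ℝ} {ε : ℝ} (hξ : XiBound S (D.θ S.b) γξz γξx γξr) (hε : 1 < ε)
    (hγbar : IsClassKInf γbar)
    (hle : ∀ s, 0 < s → ε * loopGain D γz γξz γξx γξr s ≤ γbar s) :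
    ∃ Φ, IsGain Φ ∧ ∀ e Z X zs xs r, LoopInequalities D γz e Z X zs xs r →
      γbar r ≤ max e (max (γξz (Z (Fin.last N))) (max (γξx (X (Fin.last N))) (γξr r))) →
      Z (Fin.last N) ≤ Φ e ∧ X (Fin.last N) ≤ Φ e ∧ r ≤ Φ e := by
  obtain ⟨Φ, hΦ, h⟩ := hD.exists_gain hγz (Fin.last N)
  have hz := hξ.z_classKInf.isGain
  have hx := hξ.x_classKInf.isGain
  have hgZ := (hD.isLinGain_gainZ hγz (Fin.last N)).toIsGain
  have hgX := (hD.isLinGain_gainX (Fin.last N)).toIsGain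
  have hM := IsGain.id.sup ((hz.comp hΦ).sup (hx.comp hΦ))
  have hΨ := hγbar.isGain_inv.comp hM
  refine ⟨_, hΨ.sup ((hΦ.sup (hgZ.comp hΨ)).sup (hΦ.sup (hgX.comp hΨ))),
    fun e Z X zs xs r L hr => ?_⟩
  obtain ⟨hX, hZ⟩ := h e Z X zs xs r L
  rw [above_last] at hX hZ
  have he := L.e_nonneg
  have hr0 := L.r_nonneg
  replace hX := hX.trans (max_le_max le_rfl (hD.sharpGainX_le_gainX _ hr0))
  have hΦe := hΦ.nonneg he
  have h1 := hz.map_le_max (L.Z_nonneg _) hΦe (hgZ.nonneg hr0) hZ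
  have h2 := hx.map_le_max (L.X_nonneg _) hΦe (hgX.nonneg hr0) hX
  have hrle : r ≤ Function.invFunOn γbar (Ici 0)
      (max e (max (γξz (Φ e)) (γξx (Φ e)))) := by
    refine (hγbar.le_inv_iff hr0 (hM.nonneg he)).2 ?_
    by_contra! hcon
    obtain ⟨hc0, hc⟩ := max_lt_iff.1 hcon
    obtain ⟨hc1, hc2⟩ := max_lt_iff.1 hc
    have hpos : 0 < r := by
      rcases hr0.eq_or_lt with h0 | h0
      · rw [← h0, hγbar.zero] at hc0; linarith
      · exact h0
    have hγ : loopGain D γz γξz γξx γξr r < γbar r := by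
      have h3 := hle r hpos
      have h4 := hγbar.pos hpos
      by_contra! h5
      nlinarith
    rw [loopGain, max_lt_iff, max_lt_iff] at hγ
    obtain ⟨ha, hb, hc⟩ := hγ
    exact absurd hr (not_le.2 (max_lt hc0 (max_lt (h1.trans_lt (max_lt hc1 ha))
      (max_lt (h2.trans_lt (max_lt hc2 hb)) hc))))
  refine ⟨(hZ.trans (max_le_max le_rfl (hgZ.mono hr0 hrle))).trans ?_,
    (hX.trans (max_le_max le_rfl (hgX.mono hr0 hrle))).trans ?_, hrle.trans ?_⟩
  · exact le_max_of_le_right (le_max_left _ _)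
  · exact le_max_of_le_right (le_max_right _ _)
  · exact le_max_left _ _

end Admissible

end BacksteppingDesign

/-! ### Limits superior and the asymptotic small-gain theorem -/

/-- Limit superior along `l` of a nonnegative signal, as the least nonnegative eventual bound. -/
noncomputable def limsupNonneg {P : Type*} (l : Filter P) (y : P → ℝ) : ℝ :=
  sInf {c | 0 ≤ c ∧ ∀ᶠ p in l, y p ≤ c}

section limsupNonneg

variable {P : Type*} {l : Filter P} {y : P → ℝ}

theorem limsupNonneg_nonneg : 0 ≤ limsupNonneg l y := Real.sInf_nonneg fun _ h => h.1

theorem limsupNonneg_le {c : ℝ} (hc : 0 ≤ c) (h : ∀ᶠ p in l, y p ≤ c) : limsupNonneg l y ≤ c :=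
  csInf_le ⟨0, fun _ h => h.1⟩ ⟨hc, h⟩

theorem eventually_le_of_limsupNonneg_lt (hb : ∃ c, ∀ᶠ p in l, y p ≤ c) {c : ℝ}
    (h : limsupNonneg l y < c) : ∀ᶠ p in l, y p ≤ c := by
  obtain ⟨b, hb⟩ := hb
  have hne : {c | 0 ≤ c ∧ ∀ᶠ p in l, y p ≤ c}.Nonempty :=
    ⟨max b 0, le_max_right _ _, hb.mono fun _ h => h.trans (le_max_left _ _)⟩
  obtain ⟨d, hd, hdc⟩ := exists_lt_of_csInf_lt hne h
  exact hd.2.mono fun _ h => h.trans hdc.le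

end limsupNonneg

/-- Asymptotic form, along a filter `l` on pairs of a trajectory and a time, of the estimates for
the blocks of the closed loop. With a principal filter `l` this is a statement about suprema. -/
structure LoopEstimates {N : ℕ} {P : Type*} (D : BacksteppingDesign N) (γz : Fin (N + 1) → ℝ → ℝ)
    (γξz γξx γξr γbar : ℝ → ℝ) (l : Filter P) (e : ℝ) (Z X zs xs : Fin (N + 1) → P → ℝ)
    (r : P → ℝ) : Prop where
  e_nonneg : 0 ≤ e
  zs_nonneg : ∀ j p, 0 ≤ zs j p
  xs_nonneg : ∀ j p, 0 ≤ xs j p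
  r_nonneg : ∀ p, 0 ≤ r p
  Z_eq : ∀ j p, Z j p = √(below (fun i => Z i p) j ^ 2 + zs j p ^ 2)
  X_eq : ∀ j p, X j p = √(below (fun i => X i p) j ^ 2 + xs j p ^ 2)
  Z_bdd : ∀ j, ∃ c, ∀ᶠ p in l, Z j p ≤ c
  X_bdd : ∀ j, ∃ c, ∀ᶠ p in l, X j p ≤ c
  r_bdd : ∃ c, ∀ᶠ p in l, r p ≤ c
  zs_le : ∀ j c₁ c₂ δ, 0 ≤ c₁ → 0 ≤ c₂ → 0 < δ →
    (∀ᶠ p in l, below (fun i => Z i p) j ≤ c₁) → (∀ᶠ p in l, X j p ≤ c₂) →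
    ∀ᶠ p in l, zs j p ≤ max (e + δ) (max (γz j c₁) (D.γx j c₂))
  xs_le : ∀ j c c₁ c₂ c₃, 0 ≤ c → 0 ≤ c₁ → 0 ≤ c₂ → 0 ≤ c₃ →
    (∀ᶠ p in l, Z j p ≤ c₁) → (∀ᶠ p in l, below (fun i => X i p) j ≤ c₂) →
    (∀ᶠ p in l, above (fun i => xs i p) (r p) j ≤ c₃) →
    max e (D.iotabar j c₁ + D.mbar j c₂ + c₃ ^ 2) < D.rho j c → ∀ᶠ p in l, xs j p ≤ c
  r_le : ∀ c₁ c₂ c₃, 0 ≤ c₁ → 0 ≤ c₂ → 0 ≤ c₃ → (∀ᶠ p in l, Z (Fin.last N) p ≤ c₁) →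
    (∀ᶠ p in l, X (Fin.last N) p ≤ c₂) → (∀ᶠ p in l, r p ≤ c₃) →
    ∀ᶠ p in l, γbar (r p) ≤ max e (max (γξz c₁) (max (γξx c₂) (γξr c₃)))

namespace LoopEstimates

variable {N p : ℕ} {n : Fin (N + 1) → ℕ} {S : LowerTriangularSystem N p n} {P : Type*}
  {γz : Fin (N + 1) → ℝ → ℝ} {D : BacksteppingDesign N} {γξz γξx γξr γbar : ℝ → ℝ} {l : Filter P}
  {e : ℝ} {Z X zs xs : Fin (N + 1) → P → ℝ} {r : P → ℝ}

theorem zs_le_Z (L : LoopEstimates D γz γξz γξx γξr γbar l e Z X zs xs r) (j : Fin (N + 1))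
    (q : P) :
    zs j q ≤ Z j q := by
  rw [L.Z_eq]
  exact Real.le_sqrt_of_sq_le (by linarith [sq_nonneg (below (fun i => Z i q) j)])

theorem xs_le_X (L : LoopEstimates D γz γξz γξx γξr γbar l e Z X zs xs r) (j : Fin (N + 1))
    (q : P) :
    xs j q ≤ X j q := by
  rw [L.X_eq]
  exact Real.le_sqrt_of_sq_le (by linarith [sq_nonneg (below (fun i => X i q) j)])

theorem eventually_below_le {Y : Fin (N + 1) → P → ℝ} (hY : ∀ j, ∃ c, ∀ᶠ p in l, Y j p ≤ c)
    (j : Fin (N + 1)) {c : ℝ} (h : below (fun i => limsupNonneg l (Y i)) j < c) :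
    ∀ᶠ p in l, below (fun i => Y i p) j ≤ c := by
  revert h
  refine Fin.cases (fun h => ?_) (fun i h => ?_) j
  · exact Eventually.of_forall fun _ => le_of_lt h
  · exact eventually_le_of_limsupNonneg_lt (hY i.castSucc) h

theorem eventually_above_le {Y : Fin (N + 1) → P → ℝ} (hY : ∀ j, ∃ c, ∀ᶠ p in l, Y j p ≤ c)
    (hr : ∃ c, ∀ᶠ p in l, r p ≤ c) (j : Fin (N + 1)) {c : ℝ}
    (h : above (fun i => limsupNonneg l (Y i)) (limsupNonneg l r) j < c) :
    ∀ᶠ p in l, above (fun i => Y i p) (r p) j ≤ c := by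
  revert h
  refine Fin.lastCases (fun h => ?_) (fun i h => ?_) j
  · simp only [above_last] at h ⊢
    exact eventually_le_of_limsupNonneg_lt hr h
  · simp only [above_castSucc] at h ⊢
    exact eventually_le_of_limsupNonneg_lt (hY i.succ) h

/-- Subadditivity of Euclidean norms passes to limits superior. -/
theorem limsupNonneg_sqrt_le {Y ys : Fin (N + 1) → P → ℝ} (h0 : ∀ j p, 0 ≤ Y j p)
    (hs : ∀ j p, 0 ≤ ys j p)
    (hY : ∀ j, ∃ c, ∀ᶠ p in l, Y j p ≤ c) (hys : ∀ j, ∃ c, ∀ᶠ p in l, ys j p ≤ c)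
    (h : ∀ j p, Y j p = √(below (fun i => Y i p) j ^ 2 + ys j p ^ 2)) (j : Fin (N + 1)) :
    limsupNonneg l (Y j) ≤
      √(below (fun i => limsupNonneg l (Y i)) j ^ 2 + limsupNonneg l (ys j) ^ 2) := by
  set a := below (fun i => limsupNonneg l (Y i)) j with ha
  set b := limsupNonneg l (ys j) with hb
  have hlim : Tendsto (fun δ : ℝ => √((a + δ) ^ 2 + (b + δ) ^ 2)) (𝓝[>] 0)
      (𝓝 (√((a + 0) ^ 2 + (b + 0) ^ 2))) :=
    (Continuous.tendsto (by fun_prop) 0).mono_left nhdsWithin_le_nhds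
  rw [add_zero, add_zero] at hlim
  refine ge_of_tendsto hlim ?_
  filter_upwards [self_mem_nhdsWithin] with δ hδ
  refine limsupNonneg_le (Real.sqrt_nonneg _) ?_
  have h1 := eventually_below_le hY j (c := a + δ) (lt_add_of_pos_right _ hδ)
  have h2 := eventually_le_of_limsupNonneg_lt (hys j) (c := b + δ) (lt_add_of_pos_right _ hδ)
  filter_upwards [h1, h2] with q h1 h2
  rw [h]
  exact Real.sqrt_le_sqrt (add_le_add
    (pow_le_pow_left₀ (below_nonneg (fun i => h0 i q) j) h1 2) (pow_le_pow_left₀ (hs j q) h2 2))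

/-- The estimates along `l` pass to the limits superior: all functions involved are continuous, so
the strict inequalities needed for `c₁`, `c₂`, `c₃`, `c` leave room. -/
theorem loopInequalities (hD : D.Admissible S γz) (hγz : ∀ j, IsLinGain (γz j))
    (L : LoopEstimates D γz γξz γξx γξr γbar l e Z X zs xs r) :
    LoopInequalities D γz e (fun j => limsupNonneg l (Z j)) (fun j => limsupNonneg l (X j))
      (fun j => limsupNonneg l (zs j)) (fun j => limsupNonneg l (xs j)) (limsupNonneg l r) := by
  have hZ0 : ∀ j p, 0 ≤ Z j p := fun j p => (L.Z_eq j p).symm ▸ Real.sqrt_nonneg _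
  have hX0 : ∀ j p, 0 ≤ X j p := fun j p => (L.X_eq j p).symm ▸ Real.sqrt_nonneg _
  have hzs : ∀ j, ∃ c, ∀ᶠ p in l, zs j p ≤ c := fun j =>
    (L.Z_bdd j).imp fun c h => h.mono fun q hq => (L.zs_le_Z j q).trans hq
  have hxs : ∀ j, ∃ c, ∀ᶠ p in l, xs j p ≤ c := fun j =>
    (L.X_bdd j).imp fun c h => h.mono fun q hq => (L.xs_le_X j q).trans hq
  have hbZ : ∀ j, 0 ≤ below (fun i => limsupNonneg l (Z i)) j :=
    below_nonneg fun _ => limsupNonneg_nonneg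
  have hbX : ∀ j, 0 ≤ below (fun i => limsupNonneg l (X i)) j :=
    below_nonneg fun _ => limsupNonneg_nonneg
  have hab : ∀ j, 0 ≤ above (fun i => limsupNonneg l (xs i)) (limsupNonneg l r) j :=
    above_nonneg (fun _ => limsupNonneg_nonneg) limsupNonneg_nonneg
  refine ⟨L.e_nonneg, fun _ => limsupNonneg_nonneg, fun _ => limsupNonneg_nonneg,
    fun _ => limsupNonneg_nonneg, fun _ => limsupNonneg_nonneg, limsupNonneg_nonneg,
    limsupNonneg_sqrt_le hZ0 L.zs_nonneg L.Z_bdd hzs L.Z_eq,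
    limsupNonneg_sqrt_le hX0 L.xs_nonneg L.X_bdd hxs L.X_eq, fun j => ?_, fun j => ?_, fun j => ?_⟩
  · refine le_of_forall_gt_imp_ge_of_dense fun c hc => ?_
    exact limsupNonneg_le (limsupNonneg_nonneg.trans hc.le)
      ((eventually_le_of_limsupNonneg_lt (L.X_bdd j) hc).mono fun q hq => (L.xs_le_X j q).trans hq)
  · refine le_of_forall_gt_imp_ge_of_dense fun d hd => ?_
    simp only [max_lt_iff] at hd
    obtain ⟨hd1, hd2, hd3⟩ := hd
    obtain ⟨c₁, hc₁, h₁⟩ := (hγz j).toIsGain.exists_gt_lt (hbZ j) hd2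
    obtain ⟨c₂, hc₂, h₂⟩ := (hD.γx_classKInf j).isGain.exists_gt_lt limsupNonneg_nonneg hd3
    have hc₁0 := (hbZ j).trans hc₁.le
    have hc₂0 := limsupNonneg_nonneg.trans hc₂.le
    refine limsupNonneg_le (L.e_nonneg.trans hd1.le) ?_
    filter_upwards [L.zs_le j c₁ c₂ (d - e) hc₁0 hc₂0 (sub_pos.2 hd1)
      (eventually_below_le L.Z_bdd j hc₁) (eventually_le_of_limsupNonneg_lt (L.X_bdd j) hc₂)]
      with q hq
    refine hq.trans (max_le (by linarith) (max_le (h₁ _ hc₁0 le_rfl).le (h₂ _ hc₂0 le_rfl).le))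
  · by_contra! hcon
    obtain ⟨he, hcon⟩ := max_lt_iff.1 hcon
    set η := (D.rho j (limsupNonneg l (xs j)) - (D.iotabar j (limsupNonneg l (Z j)) +
      D.mbar j (below (fun i => limsupNonneg l (X i)) j) +
      above (fun i => limsupNonneg l (xs i)) (limsupNonneg l r) j ^ 2)) / 4 with hη
    have hηpos : 0 < η := by rw [hη]; linarith
    obtain ⟨c₁, hc₁, h₁⟩ := (hD.isGain_iotabar j).exists_gt_lt limsupNonneg_nonneg
      (lt_add_of_pos_right (D.iotabar j (limsupNonneg l (Z j))) hηpos)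
    obtain ⟨c₂, hc₂, h₂⟩ := (hD.isGain_mbar j).exists_gt_lt (hbX j)
      (lt_add_of_pos_right (D.mbar j (below (fun i => limsupNonneg l (X i)) j)) hηpos)
    obtain ⟨c₃, hc₃, h₃⟩ := IsGain.id.sq.exists_gt_lt (hab j) (lt_add_of_pos_right
      (above (fun i => limsupNonneg l (xs i)) (limsupNonneg l r) j ^ 2) hηpos)
    have hc₁0 := limsupNonneg_nonneg.trans hc₁.le
    have hc₂0 := (hbX j).trans hc₂.le
    have hc₃0 := (hab j).trans hc₃.le
    have hlt : max e (D.iotabar j c₁ + D.mbar j c₂ + c₃ ^ 2) <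
        D.rho j (limsupNonneg l (xs j)) := by
      refine max_lt he ?_
      have := h₁ _ hc₁0 le_rfl
      have := h₂ _ hc₂0 le_rfl
      have := h₃ _ hc₃0 le_rfl
      linarith
    obtain ⟨c, hc0, hcL, hc⟩ := (hD.rho_classK j).isGain.exists_lt_gt
      (le_max_of_le_left L.e_nonneg) limsupNonneg_nonneg hlt
    exact absurd (limsupNonneg_le hc0 (L.xs_le j c c₁ c₂ c₃ hc0 hc₁0 hc₂0 hc₃0
      (eventually_le_of_limsupNonneg_lt (L.Z_bdd j) hc₁) (eventually_below_le L.X_bdd j hc₂)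
      (eventually_above_le hxs L.r_bdd j hc₃) hc)) (not_le.2 hcL)

theorem gbar_limsup_le (hξ : XiBound S (D.θ S.b) γξz γξx γξr) (hγbar : IsClassKInf γbar)
    (L : LoopEstimates D γz γξz γξx γξr γbar l e Z X zs xs r) :
    γbar (limsupNonneg l r) ≤ max e (max (γξz (limsupNonneg l (Z (Fin.last N))))
      (max (γξx (limsupNonneg l (X (Fin.last N)))) (γξr (limsupNonneg l r)))) := by
  by_contra! hcon
  simp only [max_lt_iff] at hcon
  obtain ⟨he, h1, h2, h3⟩ := hcon
  obtain ⟨c₁, hc₁, h₁⟩ := hξ.z_classKInf.isGain.exists_gt_lt limsupNonneg_nonneg h1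
  obtain ⟨c₂, hc₂, h₂⟩ := hξ.x_classKInf.isGain.exists_gt_lt limsupNonneg_nonneg h2
  obtain ⟨c₃, hc₃, h₃⟩ := hξ.r_classKInf.isGain.exists_gt_lt limsupNonneg_nonneg h3
  have hc₁0 := limsupNonneg_nonneg.trans hc₁.le
  have hc₂0 := limsupNonneg_nonneg.trans hc₂.le
  have hc₃0 := limsupNonneg_nonneg.trans hc₃.le
  obtain ⟨c, hc0, hcL, hc⟩ := hγbar.isGain.exists_lt_gt (le_max_of_le_left L.e_nonneg)
    limsupNonneg_nonneg (max_lt he (max_lt (h₁ _ hc₁0 le_rfl)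
      (max_lt (h₂ _ hc₂0 le_rfl) (h₃ _ hc₃0 le_rfl))))
  refine absurd (limsupNonneg_le hc0 ?_) (not_le.2 hcL)
  filter_upwards [L.r_le c₁ c₂ c₃ hc₁0 hc₂0 hc₃0
    (eventually_le_of_limsupNonneg_lt (L.Z_bdd _) hc₁)
    (eventually_le_of_limsupNonneg_lt (L.X_bdd _) hc₂)
    (eventually_le_of_limsupNonneg_lt L.r_bdd hc₃)] with q hq
  exact (hγbar.le_iff_le (L.r_nonneg q) hc0).1 (hq.trans hc.le)

end LoopEstimates

/-- The nonlinear small-gain theorem for the closed loop, in asymptotic form. -/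
theorem BacksteppingDesign.Admissible.exists_eventually_le {N p : ℕ} {n : Fin (N + 1) → ℕ}
    {S : LowerTriangularSystem N p n} {γz : Fin (N + 1) → ℝ → ℝ} {D : BacksteppingDesign N}
    (hD : D.Admissible S γz) (hγz : ∀ j, IsLinGain (γz j))
    {γξz γξx γξr γbar : ℝ → ℝ} {ε : ℝ} (hξ : XiBound S (D.θ S.b) γξz γξx γξr) (hε : 1 < ε)
    (hγbar : IsClassKInf γbar)
    (hle : ∀ s, 0 < s → ε * loopGain D γz γξz γξx γξr s ≤ γbar s) :
    ∃ Φ, IsGain Φ ∧ ∀ {P : Type} (l : Filter P) (e : ℝ) Z X zs xs r,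
      LoopEstimates D γz γξz γξx γξr γbar l e Z X zs xs r → ∀ c, Φ e < c →
      ∀ᶠ q in l, Z (Fin.last N) q ≤ c ∧ X (Fin.last N) q ≤ c ∧ r q ≤ c := by
  obtain ⟨Φ, hΦ, h⟩ := hD.exists_loop_bound hγz hξ hε hγbar hle
  refine ⟨Φ, hΦ, fun l e Z X zs xs r L c hc => ?_⟩
  obtain ⟨h1, h2, h3⟩ := h _ _ _ _ _ _ (L.loopInequalities hD hγz) (L.gbar_limsup_le hξ hγbar)
  exact (eventually_le_of_limsupNonneg_lt (L.Z_bdd _) (h1.trans_lt hc)).and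
    ((eventually_le_of_limsupNonneg_lt (L.X_bdd _) (h2.trans_lt hc)).and
      (eventually_le_of_limsupNonneg_lt L.r_bdd (h3.trans_lt hc)))

/-! ### Transformed coordinates and the dissipation inequality -/

section colNorm

variable {ι : Type} {E : ι → Type} [∀ i, SeminormedAddCommGroup (E i)]

theorem colNorm_nonneg (s : Finset ι) (v : ∀ i, E i) : 0 ≤ colNorm s v := Real.sqrt_nonneg _

theorem colNorm_sq (s : Finset ι) (v : ∀ i, E i) : colNorm s v ^ 2 = ∑ i ∈ s, ‖v i‖ ^ 2 :=
  Real.sq_sqrt (Finset.sum_nonneg fun _ _ => sq_nonneg _)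

theorem colNorm_mono {s t : Finset ι} (h : s ⊆ t) (v : ∀ i, E i) : colNorm s v ≤ colNorm t v :=
  Real.sqrt_le_sqrt (Finset.sum_le_sum_of_subset_of_nonneg h fun _ _ _ => sq_nonneg _)

theorem norm_le_colNorm {s : Finset ι} {i : ι} (hi : i ∈ s) (v : ∀ i, E i) :
    ‖v i‖ ≤ colNorm s v :=
  Real.le_sqrt_of_sq_le (Finset.single_le_sum (f := fun i => ‖v i‖ ^ 2)
    (fun _ _ => sq_nonneg _) hi)

theorem colNorm_le_sum (s : Finset ι) (v : ∀ i, E i) : colNorm s v ≤ ∑ i ∈ s, ‖v i‖ := by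
  rw [colNorm, Real.sqrt_le_left (Finset.sum_nonneg fun _ _ => norm_nonneg _)]
  exact Finset.sum_sq_le_sq_sum_of_nonneg fun _ _ => norm_nonneg _

theorem continuous_colNorm (s : Finset ι) : Continuous (fun v : ∀ i, E i => colNorm s v) := by
  unfold colNorm; fun_prop

theorem colNorm_zero (s : Finset ι) : colNorm s (fun i => (0 : E i)) = 0 := by
  simp [colNorm]

end colNorm

section colNormFin

variable {N : ℕ} {E : Fin (N + 1) → Type} [∀ i, SeminormedAddCommGroup (E i)]

theorem colNorm_Iio (j : Fin (N + 1)) (v : ∀ i, E i) :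
    colNorm (Finset.Iio j) v = below (fun i => colNorm (Finset.Iic i) v) j := by
  refine Fin.cases ?_ (fun i => ?_) j
  · have : Finset.Iio (0 : Fin (N + 1)) = ∅ := by ext k; simp
    simp [colNorm, this]
  · rw [below_succ]
    congr 1

theorem colNorm_Iic (j : Fin (N + 1)) (v : ∀ i, E i) :
    colNorm (Finset.Iic j) v = √(below (fun i => colNorm (Finset.Iic i) v) j ^ 2 + ‖v j‖ ^ 2) := by
  rw [← colNorm_Iio, colNorm_sq, colNorm, ← Finset.Iio_insert, Finset.sum_insert (by simp),
    add_comm]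

theorem colNorm_Iic_last (v : ∀ i, E i) :
    colNorm (Finset.Iic (Fin.last N)) v = colNorm Finset.univ v := by
  congr 1
  ext k
  simp [Fin.le_last]

end colNormFin

section xbar

variable {N p : ℕ} {n : Fin (N + 1) → ℕ} {S : LowerTriangularSystem N p n}
  {θ : Fin (N + 1) → ℝ → ℝ}

theorem xbar_succ (x : XState N) (i : Fin N) :
    xbar θ x i.succ = x i.succ - θ i.castSucc (xbar θ x i.castSucc) := rfl

theorem fbar_succ (z : ZState n) (x : XState N) (w : EuclideanSpace ℝ (Fin p)) (i : Fin N) :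
    fbar S θ i.succ z x w = S.f i.succ z x w - deriv (θ i.castSucc) (xbar θ x i.castSucc) *
      (fbar S θ i.castSucc z x w + S.b i.castSucc * x i.succ) := rfl

theorem continuous_xbar_apply (j : Fin (N + 1)) (hθ : ∀ i < j, Continuous (θ i)) :
    Continuous fun x => xbar θ x j := by
  induction j using Fin.induction with
  | zero => exact continuous_apply 0
  | succ i ih =>
    simp only [xbar_succ]
    exact (continuous_apply _).sub ((hθ _ (Fin.castSucc_lt_succ)).comp
      (ih fun k hk => hθ k (hk.trans (Fin.castSucc_lt_succ))))

theorem continuous_xbar (hθ : ∀ j, Continuous (θ j)) : Continuous (xbar θ) :=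
  continuous_pi fun j => continuous_xbar_apply j fun i _ => hθ i

theorem continuous_feedback (hθ : ∀ j, Continuous (θ j)) : Continuous (feedback θ) :=
  (hθ _).comp (continuous_xbar_apply _ fun i _ => hθ i)

theorem xbar_map_zero (hθ : ∀ j, θ j 0 = 0) : xbar θ 0 = 0 := by
  funext j
  induction j using Fin.induction with
  | zero => rfl
  | succ i ih => rw [xbar_succ, ih]; simp [hθ]

theorem snoc_eq_above (x : XState N) (u : ℝ) (j : Fin (N + 1)) :
    Fin.snoc (α := fun _ => ℝ) x u j.succ =
      θ j (xbar θ x j) + above (xbar θ x) (u - feedback θ x) j := by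
  refine Fin.lastCases ?_ (fun i => ?_) j
  · rw [above_last, Fin.succ_last, Fin.snoc_last, feedback]; ring
  · rw [above_castSucc, xbar_succ, Fin.succ_castSucc, Fin.snoc_castSucc]; ring

/-- The transformed equations `x̄_j' = f̄_j + b_j (ϑ_j(x̄_j) + x̄_{j+1})`. -/
theorem hasDerivWithinAt_xbar (hθ : ∀ j, Differentiable ℝ (θ j)) {z : ℝ → ZState n}
    {x : ℝ → XState N} {w : EuclideanSpace ℝ (Fin p)} {s u : ℝ}
    (h : ∀ j, HasDerivWithinAt (fun τ => x τ j) (S.f j (z s) (x s) w + S.b j *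
      Fin.snoc (α := fun _ => ℝ) (x s) u j.succ) (Ici s) s) (j : Fin (N + 1)) :
    HasDerivWithinAt (fun τ => xbar θ (x τ) j) (fbar S θ j (z s) (x s) w + S.b j *
      (θ j (xbar θ (x s) j) + above (xbar θ (x s)) (u - feedback θ (x s)) j)) (Ici s) s := by
  rw [← snoc_eq_above]
  induction j using Fin.induction with
  | zero => exact h 0
  | succ i ih =>
    have h1 := (h i.succ).sub (((hθ i.castSucc).differentiableAt.hasDerivAt).comp_hasDerivWithinAt
      s ih)
    refine h1.congr_deriv ?_
    rw [fbar_succ, Fin.succ_castSucc, Fin.snoc_castSucc]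
    ring

end xbar

theorem mul_le_const_mul_sq_add_sq {c : ℝ} (hc : 0 < c) (a b : ℝ) :
    a * b ≤ c * a ^ 2 + 1 / (4 * c) * b ^ 2 := by
  have h : c * a ^ 2 + 1 / (4 * c) * b ^ 2 - a * b = 1 / (4 * c) * (2 * c * a - b) ^ 2 := by
    field_simp
    ring
  have : 0 ≤ 1 / (4 * c) * (2 * c * a - b) ^ 2 := by positivity
  linarith

namespace BacksteppingDesign

variable {N p : ℕ} {n : Fin (N + 1) → ℕ} {S : LowerTriangularSystem N p n}
  {γz : Fin (N + 1) → ℝ → ℝ} {D : BacksteppingDesign N}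

theorem θ_eq {j : Fin (N + 1)} (hψ : ∀ s, D.ψ j (-s) = D.ψ j s) (b : Fin (N + 1) → ℝ) :
    D.θ b j = fun s => -(D.cbar j + 1 / 4 * b j ^ 2 + D.m j s + D.ψ j s) * s / b j := by
  funext s
  have : D.ψ j |s| = D.ψ j s := by
    rcases abs_choice s with h | h <;> rw [h]
    exact hψ s
  rw [θ, this]

theorem contDiff_θ {j : Fin (N + 1)} (hψ : ∀ s, D.ψ j (-s) = D.ψ j s) (hψ1 : ContDiff ℝ 1 (D.ψ j))
    (hm : ContDiff ℝ 1 (D.m j)) (b : Fin (N + 1) → ℝ) : ContDiff ℝ 1 (D.θ b j) := by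
  rw [θ_eq hψ]
  fun_prop

theorem θ_zero (D : BacksteppingDesign N) (b : Fin (N + 1) → ℝ) (j : Fin (N + 1)) :
    D.θ b j 0 = 0 := by simp [θ]

namespace Admissible

theorem contDiff_θ (hD : D.Admissible S γz) (j : Fin (N + 1)) : ContDiff ℝ 1 (D.θ S.b j) :=
  BacksteppingDesign.contDiff_θ (hD.ψ_even j) (hD.ψ_smooth j) (hD.m_smooth j) S.b

theorem differentiable_θ (hD : D.Admissible S γz) (j : Fin (N + 1)) :
    Differentiable ℝ (D.θ S.b j) := (hD.contDiff_θ j).differentiable one_ne_zero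

theorem continuous_θ (hD : D.Admissible S γz) (j : Fin (N + 1)) : Continuous (D.θ S.b j) :=
  (hD.contDiff_θ j).continuous

theorem cbar_pos (hD : D.Admissible S γz) (j : Fin (N + 1)) : 0 < D.cbar j := by
  have := hD.c_pos j
  unfold cbar
  split_ifs <;> linarith

theorem ψ_zero_nonneg (hD : D.Admissible S γz) (j : Fin (N + 1)) : 0 ≤ D.ψ j 0 := by
  have h : Tendsto (D.ψ j) (𝓝[>] 0) (𝓝 (D.ψ j 0)) :=
    ((hD.ψ_smooth j).continuous.tendsto 0).mono_left nhdsWithin_le_nhds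
  refine ge_of_tendsto h ?_
  filter_upwards [self_mem_nhdsWithin] with s hs
  have h1 : 0 < D.ψ j s * s ^ 2 := (hD.rho_classK j).pos hs
  exact (pos_of_mul_pos_left h1 (sq_nonneg s)).le

theorem abs_deriv_θ_zero_mul_pos (hD : D.Admissible S γz) (j : Fin (N + 1)) :
    0 < |deriv (D.θ S.b j) 0 * S.b j| := by
  have hb := S.b_ne_zero j
  set A := fun s => -(D.cbar j + 1 / 4 * S.b j ^ 2 + D.m j s + D.ψ j s) with hA
  have hAd : Differentiable ℝ A := by
    have := (hD.m_smooth j).differentiable one_ne_zero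
    have := (hD.ψ_smooth j).differentiable one_ne_zero
    fun_prop
  have h1 : HasDerivAt (D.θ S.b j) ((deriv A 0 * 0 + A 0 * 1) / S.b j) 0 := by
    rw [θ_eq (hD.ψ_even j)]
    exact ((hAd 0).hasDerivAt.mul (hasDerivAt_id 0)).div_const _
  rw [h1.deriv, mul_zero, zero_add, mul_one, div_mul_cancel₀ _ hb, abs_pos]
  have := hD.cbar_pos j
  have := hD.ψ_zero_nonneg j
  have := hD.m_nonneg j 0
  have := sq_nonneg (S.b j)
  simp only [hA]
  exact ne_of_lt (by linarith)

theorem fbar_map_zero (hD : D.Admissible S γz) (j : Fin (N + 1))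
    {w : EuclideanSpace ℝ (Fin p)} (hw : w ∈ S.W) : fbar S (D.θ S.b) j 0 0 w = 0 := by
  have h := hD.fbar_bound j 0 0 w hw
  rw [xbar_map_zero (D.θ_zero S.b)] at h
  have h1 : colNorm (Finset.Iic j) (0 : ZState n) = 0 := colNorm_zero _
  have h2 : colNorm (Finset.Iio j) (0 : XState N) = 0 := colNorm_zero _
  rw [h1, h2] at h
  simpa using h

/-- The gain `γ_ξ^r` is bounded below by a linear function. As a consequence the triggering
condition bounds the time that elapses between an active sampling error and its sampling time. -/
theorem linear_le_of_xiBound (hD : D.Admissible S γz) {γξz γξx γξr : ℝ → ℝ}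
    (hξ : XiBound S (D.θ S.b) γξz γξx γξr) {w : EuclideanSpace ℝ (Fin p)} (hw : w ∈ S.W)
    {s : ℝ} (hs : 0 ≤ s) :
    |deriv (D.θ S.b (Fin.last N)) 0 * S.b (Fin.last N)| * s ≤ γξr s := by
  have h := hξ.bound 0 0 w hw s
  rw [hD.fbar_map_zero _ hw, xbar_map_zero (D.θ_zero S.b)] at h
  have h1 : colNorm Finset.univ (0 : ZState n) = 0 := colNorm_zero _
  have h2 : colNorm Finset.univ (0 : XState N) = 0 := colNorm_zero _
  rw [h1, h2, hξ.z_classKInf.zero, hξ.x_classKInf.zero, Pi.zero_apply, θ_zero, zero_add, zero_add,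
    abs_of_nonneg hs, max_eq_right (hξ.r_classKInf.nonneg hs),
    max_eq_right (hξ.r_classKInf.nonneg hs), ← mul_assoc, abs_mul, abs_of_nonneg hs] at h
  exact h

/-- The dissipation inequality `d/dt (x̄_j²/2) ≤ -ρ_j(|x̄_j|) + ῑ_j + m̄_j + x̄_{j+1}²`. -/
theorem dissipation (hD : D.Admissible S γz) (j : Fin (N + 1)) (z : ZState n) (x : XState N)
    {w : EuclideanSpace ℝ (Fin p)} (hw : w ∈ S.W) (v : ℝ) :
    xbar (D.θ S.b) x j *
        (fbar S (D.θ S.b) j z x w + S.b j * (D.θ S.b j (xbar (D.θ S.b) x j) + v)) ≤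
      -D.rho j |xbar (D.θ S.b) x j| + (D.iotabar j (colNorm (Finset.Iic j) z) +
        D.mbar j (colNorm (Finset.Iio j) (xbar (D.θ S.b) x)) + v ^ 2) := by
  have hf := hD.fbar_bound j z x w hw
  have hc := hD.c_pos j
  set y := xbar (D.θ S.b) x j
  set F := fbar S (D.θ S.b) j z x w
  set a := colNorm (Finset.Iic j) z with ha
  set d := colNorm (Finset.Iio j) (xbar (D.θ S.b) x) with hd
  have hb := S.b_ne_zero j
  have hθ : S.b j * D.θ S.b j y = -(D.cbar j + 1 / 4 * S.b j ^ 2 + D.m j y + D.ψ j |y|) * y := by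
    rw [θ]; field_simp
  have h1 : y * F ≤ |y| * (D.iota j a * a + D.mtilde j d * d + D.m j y * |y|) :=
    ((le_abs_self _).trans (abs_mul y F).le).trans (mul_le_mul_of_nonneg_left hf (abs_nonneg y))
  have h2 := mul_le_const_mul_sq_add_sq hc |y| (D.iota j a * a)
  have h3 : |y| * (D.mtilde j d * d) ≤ (D.cbar j - D.c j) * y ^ 2 + D.mbar j d := by
    by_cases hj : j = 0
    · have hd0 : d = 0 := by rw [hd, hj, colNorm_Iio, below_zero]
      simp [hd0, cbar, hj, mbar]
    · have := mul_le_const_mul_sq_add_sq hc |y| (D.mtilde j d * d)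
      rw [cbar, if_neg hj, mbar]
      rw [sq_abs, mul_pow, ← mul_assoc] at this
      linarith
  have h4 := sq_nonneg (S.b j * y / 2 - v)
  have h5 : D.rho j |y| = D.ψ j |y| * y ^ 2 := by rw [rho, sq_abs]
  have h6 : D.iotabar j a = 1 / (4 * D.c j) * (D.iota j a * a) ^ 2 := by rw [iotabar]; ring
  have h7 : |y| * (D.m j y * |y|) = D.m j y * y ^ 2 := by rw [← sq_abs y]; ring
  have h8 : y * (F + S.b j * (D.θ S.b j y + v)) =
      y * F - (D.cbar j + 1 / 4 * S.b j ^ 2 + D.m j y + D.ψ j |y|) * y ^ 2 + S.b j * y * v := by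
    rw [mul_add (S.b j), hθ]; ring
  rw [h8, h5, h6]
  rw [sq_abs] at h2
  linarith

end Admissible

end BacksteppingDesign

/-- Comparison lemma: a function that decreases at rate `κ` while it is at least `C`. -/
theorem le_max_of_decreasing_above {f f' : ℝ → ℝ} {a b C κ : ℝ} (hab : a ≤ b) (hκ : 0 < κ)
    (hf : ContinuousOn f (Icc a b)) (hf' : ∀ s ∈ Ico a b, HasDerivWithinAt f (f' s) (Ici s) s)
    (h : ∀ s ∈ Ico a b, C ≤ f s → f' s ≤ -κ) : f b ≤ max C (f a - κ * (b - a)) := by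
  by_cases hex : ∃ s ∈ Icc a b, f s ≤ C
  · obtain ⟨s, hs, hsC⟩ := hex
    refine le_max_of_le_left ?_
    refine image_le_of_deriv_right_lt_deriv_boundary' (B := fun _ => C) (B' := fun _ => 0)
      (hf.mono (Icc_subset_Icc_left hs.1)) (fun τ hτ => hf' τ ⟨hs.1.trans hτ.1, hτ.2⟩) hsC
      continuousOn_const (fun τ _ => hasDerivWithinAt_const _ _ _) (fun τ hτ hτC => ?_)
      (right_mem_Icc.2 hs.2)
    have := h τ ⟨hs.1.trans hτ.1, hτ.2⟩ hτC.ge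
    linarith
  · push Not at hex
    refine le_max_of_le_right ?_
    refine image_le_of_deriv_right_le_deriv_boundary (B := fun s => f a - κ * (s - a))
      (B' := fun _ => -κ) hf hf' (by simp) (by fun_prop) (fun τ _ => ?_)
      (fun τ hτ => h τ hτ (hex τ (Ico_subset_Icc_self hτ)).le) (right_mem_Icc.2 hab)
    have : HasDerivAt (fun s => f a - κ * (s - a)) (0 - κ * (1 - 0)) τ :=
      (hasDerivAt_const _ _).sub (((hasDerivAt_id τ).sub (hasDerivAt_const _ _)).const_mul κ)
    simpa using this.hasDerivWithinAt

/-! ### Linearly bounded functions and their smooth majorants -/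

/-- `g` is bounded by a multiple of the size `σ` on every set on which `σ` is bounded. -/
def LinBdd {A : Type*} (σ g : A → ℝ) : Prop :=
  ∀ R, ∃ C, 0 ≤ C ∧ ∀ a, σ a ≤ R → |g a| ≤ C * σ a

/-- `g` is bounded on every set on which the size `σ` is bounded. -/
def LocBdd {A : Type*} (σ g : A → ℝ) : Prop :=
  ∀ R, ∃ C, 0 ≤ C ∧ ∀ a, σ a ≤ R → |g a| ≤ C

/-- A `C¹`, even majorant, nondecreasing on `[0,∞)`, of a sequence of constants. It is obtained as
`s ↦ 1 + ∫_0^{s²+1} g` from a continuous majorant `g` of a step function. -/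
theorem exists_majorant (C : ℕ → ℝ) : ∃ L : ℝ → ℝ, ContDiff ℝ 1 L ∧ (∀ s, L (-s) = L s) ∧
    MonotoneOn L (Ici 0) ∧ (∀ s, 1 ≤ L s) ∧ ∀ (k : ℕ) (s : ℝ), (k : ℝ) ≤ |s| + 1 → C k ≤ L s := by
  set M : ℝ → ℝ := fun u => ∑ k ∈ Finset.range (⌊√|u| + 1⌋₊ + 1), |C k| with hM
  have hM0 : ∀ u, 0 ≤ M u := fun u => Finset.sum_nonneg fun _ _ => abs_nonneg _
  have hMmono : ∀ u v, |u| ≤ |v| → M u ≤ M v := fun u v huv =>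
    Finset.sum_le_sum_of_subset_of_nonneg (Finset.range_mono (Nat.succ_le_succ
      (Nat.floor_mono (add_le_add_left (Real.sqrt_le_sqrt huv) 1)))) fun _ _ _ => abs_nonneg _
  obtain ⟨g, hg⟩ := exists_continuous_forall_mem_convex_of_local_const
    (t := fun u : ℝ => Ici (M u)) (fun u => convex_Ici _) (fun u => ⟨M (|u| + 1), by
      filter_upwards [Metric.ball_mem_nhds u one_pos] with v hv
      refine hMmono _ _ ?_
      rw [Metric.mem_ball, Real.dist_eq] at hv
      have h1 := abs_sub_abs_le_abs_sub v u
      rw [abs_of_nonneg (by positivity : (0 : ℝ) ≤ |u| + 1)]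
      linarith⟩)
  have hg : ∀ u, M u ≤ g u := hg
  have hg0 : ∀ u, 0 ≤ g u := fun u => (hM0 u).trans (hg u)
  have hint : ∀ a b, IntervalIntegrable g MeasureTheory.volume a b :=
    fun a b => g.continuous.intervalIntegrable a b
  have hadd : ∀ a b : ℝ, (∫ u in (0 : ℝ)..a, g u) + ∫ u in a..b, g u = ∫ u in (0 : ℝ)..b, g u :=
    fun a b => intervalIntegral.integral_add_adjacent_intervals (hint _ _) (hint _ _)
  have hpos : ∀ a b : ℝ, a ≤ b → 0 ≤ ∫ u in a..b, g u :=
    fun a b hab => intervalIntegral.integral_nonneg hab fun u _ => hg0 u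
  have hG : ContDiff ℝ 1 (fun b : ℝ => ∫ u in (0 : ℝ)..b, g u) := by
    have hd : ∀ b, HasDerivAt (fun b : ℝ => ∫ u in (0 : ℝ)..b, g u) (g b) b := fun b =>
      intervalIntegral.integral_hasDerivAt_right (hint _ _)
        (g.continuous.stronglyMeasurableAtFilter _ _) g.continuous.continuousAt
    rw [contDiff_one_iff_deriv]
    refine ⟨fun b => (hd b).differentiableAt, ?_⟩
    have : deriv (fun b : ℝ => ∫ u in (0 : ℝ)..b, g u) = g := funext fun b => (hd b).deriv
    rw [this]
    exact g.continuous
  refine ⟨fun s => 1 + ∫ u in (0 : ℝ)..(s ^ 2 + 1), g u, ?_, fun s => by simp, ?_, ?_, ?_⟩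
  · exact contDiff_const.add (hG.comp (by fun_prop))
  · intro s hs t ht hst
    have h1 : s ^ 2 ≤ t ^ 2 := pow_le_pow_left₀ hs hst 2
    have := hadd (s ^ 2 + 1) (t ^ 2 + 1)
    have := hpos (s ^ 2 + 1) (t ^ 2 + 1) (by linarith)
    change 1 + _ ≤ 1 + _
    linarith
  · intro s
    have := hpos 0 (s ^ 2 + 1) (by positivity)
    linarith
  · intro k s hk
    have h1 := hadd (s ^ 2) (s ^ 2 + 1)
    have h2 := hpos 0 (s ^ 2) (by positivity)
    have h3 : ∫ u in (s ^ 2)..(s ^ 2 + 1), M (s ^ 2) ≤ ∫ u in (s ^ 2)..(s ^ 2 + 1), g u := by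
      refine intervalIntegral.integral_mono_on (by linarith) (by simp) (hint _ _) fun u hu => ?_
      refine (hMmono _ _ ?_).trans (hg u)
      rw [abs_of_nonneg (sq_nonneg s)]
      exact hu.1.trans (le_abs_self u)
    rw [intervalIntegral.integral_const, add_sub_cancel_left, one_smul] at h3
    have h4 : |C k| ≤ M (s ^ 2) := by
      refine Finset.single_le_sum (f := fun k => |C k|) (fun _ _ => abs_nonneg _)
        (Finset.mem_range.2 (Nat.lt_succ_of_le (Nat.le_floor ?_)))
      rwa [abs_of_nonneg (sq_nonneg s), Real.sqrt_sq_eq_abs]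
    have h5 := le_abs_self (C k)
    linarith

namespace LocBdd

variable {A : Type*} {σ τ g h : A → ℝ}

theorem comp {f : ℝ → ℝ} (hf : Continuous f) (hg : LocBdd σ g) :
    LocBdd σ (fun a => f (g a)) := fun R => by
  obtain ⟨C, hC0, hC⟩ := hg R
  obtain ⟨C', hC'⟩ := (isCompact_Icc (a := -C) (b := C)).exists_bound_of_continuousOn
    hf.continuousOn
  exact ⟨max C' 0, le_max_right _ _, fun a ha =>
    (hC' _ (abs_le.1 (hC a ha))).trans (le_max_left _ _)⟩

end LocBdd

namespace LinBdd

variable {A B : Type*} {σ τ g h : A → ℝ}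

theorem locBdd (hg : LinBdd σ g) : LocBdd σ g := fun R => by
  obtain ⟨C, hC0, hC⟩ := hg R
  refine ⟨C * max R 0, mul_nonneg hC0 (le_max_right _ _), fun a ha => (hC a ha).trans
    (mul_le_mul_of_nonneg_left (ha.trans (le_max_left _ _)) hC0)⟩

theorem trans (hg : LinBdd σ g) (hσ : LinBdd τ σ) : LinBdd τ g := fun R => by
  obtain ⟨C', -, hC'⟩ := hσ.locBdd R
  obtain ⟨C, hC0, hC⟩ := hσ R
  obtain ⟨K, hK0, hK⟩ := hg C'
  refine ⟨K * C, mul_nonneg hK0 hC0, fun a ha => (hK a ((le_abs_self _).trans (hC' a ha))).trans ?_⟩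
  rw [mul_assoc]
  exact mul_le_mul_of_nonneg_left ((le_abs_self _).trans (hC a ha)) hK0

theorem of_abs_le (hh : LinBdd σ h) (hle : ∀ a, |g a| ≤ |h a|) : LinBdd σ g := fun R =>
  (hh R).imp fun _ hC => ⟨hC.1, fun a ha => (hle a).trans (hC.2 a ha)⟩

theorem of_abs_le_self (hle : ∀ a, |g a| ≤ σ a) : LinBdd σ g := fun _ =>
  ⟨1, zero_le_one, fun a _ => (hle a).trans (one_mul _).ge⟩

theorem add (hg : LinBdd σ g) (hh : LinBdd σ h) : LinBdd σ (fun a => g a + h a) := fun R => by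
  obtain ⟨C, hC0, hC⟩ := hg R
  obtain ⟨C', hC0', hC'⟩ := hh R
  refine ⟨C + C', add_nonneg hC0 hC0', fun a ha => (abs_add_le _ _).trans ?_⟩
  rw [add_mul]
  exact add_le_add (hC a ha) (hC' a ha)

theorem neg (hg : LinBdd σ g) : LinBdd σ (fun a => -g a) := by
  simpa only [LinBdd, abs_neg] using hg

theorem sub (hg : LinBdd σ g) (hh : LinBdd σ h) : LinBdd σ (fun a => g a - h a) := by
  simpa only [sub_eq_add_neg] using hg.add hh.neg

theorem sum {ι : Type*} (s : Finset ι) {g : ι → A → ℝ} (hg : ∀ i ∈ s, LinBdd σ (g i)) :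
    LinBdd σ (fun a => ∑ i ∈ s, g i a) := by
  classical
  induction s using Finset.induction_on with
  | empty => exact fun R => ⟨0, le_rfl, fun a _ => by simp⟩
  | insert i s hi ih =>
    simp only [Finset.sum_insert hi]
    exact (hg i (Finset.mem_insert_self i s)).add
      (ih fun j hj => hg j (Finset.mem_insert_of_mem hj))

theorem loc_mul (hg : LocBdd σ g) (hh : LinBdd σ h) : LinBdd σ (fun a => g a * h a) := fun R => by
  obtain ⟨C, hC0, hC⟩ := hg R
  obtain ⟨C', hC0', hC'⟩ := hh R
  refine ⟨C * C', mul_nonneg hC0 hC0', fun a ha => ?_⟩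
  rw [abs_mul, mul_assoc]
  exact mul_le_mul (hC a ha) (hC' a ha) (abs_nonneg _) hC0

theorem const_mul (hh : LinBdd σ h) (c : ℝ) : LinBdd σ (fun a => c * h a) :=
  loc_mul (fun _ => ⟨|c|, abs_nonneg c, fun _ _ => le_rfl⟩) hh

theorem comp_right {f : B → A} (hg : LinBdd σ g) : LinBdd (fun b => σ (f b)) (fun b => g (f b)) :=
  fun R => (hg R).imp fun _ hC => ⟨hC.1, fun _ hb => hC.2 _ hb⟩

theorem abs_size (hg : LinBdd σ g) : LinBdd σ (fun a => |g a|) := by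
  simpa only [LinBdd, abs_abs] using hg

/-- A linearly bounded function is bounded by `L(σ)σ` with a single regular function `L`. -/
theorem exists_majorant (hg : LinBdd σ g) (hσ : ∀ a, 0 ≤ σ a) : ∃ L : ℝ → ℝ, ContDiff ℝ 1 L ∧
    (∀ s, L (-s) = L s) ∧ MonotoneOn L (Ici 0) ∧ (∀ s, 1 ≤ L s) ∧ ∀ a, |g a| ≤ L (σ a) * σ a := by
  choose C hC0 hC using fun k : ℕ => hg k
  obtain ⟨L, h1, h2, h3, h4, h5⟩ := _root_.exists_majorant C
  refine ⟨L, h1, h2, h3, h4, fun a => (hC ⌈σ a⌉₊ a (Nat.le_ceil _)).trans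
    (mul_le_mul_of_nonneg_right (h5 _ _ ?_) (hσ a))⟩
  rw [abs_of_nonneg (hσ a)]
  exact (Nat.ceil_lt_add_one (hσ a)).le

end LinBdd

/-- The gain `s ↦ L(s) s` obtained from a majorant `L`. -/
theorem isClassKInf_mul_self {L : ℝ → ℝ} (hL : Continuous L) (hmono : MonotoneOn L (Ici 0))
    (h1 : ∀ s, 1 ≤ L s) : IsClassKInf (fun s => L s * s) ∧ IsLinGain (fun s => L s * s) := by
  have hK : IsClassKInf (fun s => L s * s) := by
    refine ⟨⟨by simp, (hL.mul continuous_id).continuousOn, fun s hs t ht hst => ?_⟩, ?_⟩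
    · have h2 := hmono hs ht hst.le
      have h3 := h1 t
      have hs : 0 ≤ s := hs
      change L s * s < L t * t
      nlinarith
    · refine tendsto_atTop_mono' _ ?_ tendsto_id
      filter_upwards [eventually_ge_atTop 0] with s hs
      simp only [id]
      nlinarith [h1 s]
  refine ⟨hK, hK.isGain, fun R => ⟨L (max R 0), by linarith [h1 (max R 0)], fun s hs hsR => ?_⟩⟩
  exact mul_le_mul_of_nonneg_right
    (hmono hs (mem_Ici.2 (le_max_right _ _)) (hsR.trans (le_max_left _ _))) hs

theorem LinBdd.exists_gain {A : Type*} {σ g : A → ℝ} (hg : LinBdd σ g) (hσ : ∀ a, 0 ≤ σ a) :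
    ∃ G, IsClassKInf G ∧ IsLinGain G ∧ ∀ a, |g a| ≤ G (σ a) := by
  obtain ⟨L, h1, -, h3, h4, h5⟩ := hg.exists_majorant hσ
  obtain ⟨h6, h7⟩ := isClassKInf_mul_self h1.continuous h3 h4
  exact ⟨_, h6, h7, h5⟩

/-- A `C¹` function that vanishes at `0` is bounded by a multiple of the norm on bounded sets,
uniformly over a compact parameter set. -/
theorem linBdd_of_contDiff {E P F : Type*} [NormedAddCommGroup E] [NormedSpace ℝ E]
    [ProperSpace E] [NormedAddCommGroup P] [NormedSpace ℝ P] [NormedAddCommGroup F]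
    [NormedSpace ℝ F] {f : E → P → F} (hf : ContDiff ℝ 1 (fun a : E × P => f a.1 a.2)) {W : Set P}
    (hW : IsCompact W) (h0 : ∀ w ∈ W, f 0 w = 0) :
    LinBdd (fun a : E × W => ‖a.1‖) (fun a => ‖f a.1 a.2‖) := by
  intro R
  obtain ⟨C, hC⟩ := ((isCompact_closedBall (0 : E) R).prod hW).exists_bound_of_continuousOn
    (hf.continuous_fderiv one_ne_zero).continuousOn
  refine ⟨max C 0, le_max_right _ _, fun ⟨y, w, hw⟩ hy => ?_⟩
  have hd : ∀ y', HasFDerivAt (fun y => f y w) ((fderiv ℝ (fun a : E × P => f a.1 a.2) (y', w)).comp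
      (ContinuousLinearMap.inl ℝ E P)) y' := fun y' =>
    (hf.differentiable one_ne_zero (y', w)).hasFDerivAt.comp (f := fun y => (y, w)) y'
      (hasFDerivAt_prodMk_left y' w)
  have := (convex_closedBall (0 : E) R).norm_image_sub_le_of_norm_hasFDerivWithin_le
    (f := fun y => f y w) (C := max C 0) (fun y' _ => (hd y').hasFDerivWithinAt) (fun y' hy' => ?_)
    (x := 0) (y := y) ?_ ?_
  · simpa [h0 w hw] using this
  · refine ((ContinuousLinearMap.opNorm_comp_le _ _).trans (mul_le_mul (hC (y', w) ⟨hy', hw⟩)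
      (ContinuousLinearMap.norm_inl_le_one ℝ E P) (norm_nonneg _)
      ((norm_nonneg _).trans (hC (y', w) ⟨hy', hw⟩)))).trans ?_
    rw [mul_one]; exact le_max_left _ _
  · simpa using (norm_nonneg _).trans hy
  · simpa using hy

theorem linBdd_of_contDiff_real {θ : ℝ → ℝ} (hθ : ContDiff ℝ 1 θ) (h0 : θ 0 = 0) :
    LinBdd (fun s => |s|) θ := by
  have h := linBdd_of_contDiff (E := ℝ) (P := ℝ) (f := fun s _ => θ s) (hθ.comp contDiff_fst)
    (isCompact_singleton (x := (0 : ℝ))) (fun _ _ => h0)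
  intro R
  obtain ⟨C, hC0, hC⟩ := h R
  exact ⟨C, hC0, fun s hs => by simpa using hC (s, ⟨0, rfl⟩) hs⟩

section system

variable {N p : ℕ} {n : Fin (N + 1) → ℕ} (S : LowerTriangularSystem N p n)
  {θ : Fin (N + 1) → ℝ → ℝ}

theorem linBdd_x_of_xbar (j : Fin (N + 1)) (hθ : ∀ i < j, ContDiff ℝ 1 (θ i))
    (hθ0 : ∀ i < j, θ i 0 = 0) {i : Fin (N + 1)} (hi : i ≤ j) :
    LinBdd (fun x : XState N => colNorm (Finset.Iic j) (xbar θ x)) (fun x => x i) := by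
  have hx : ∀ i ≤ j, LinBdd (fun x : XState N => colNorm (Finset.Iic j) (xbar θ x))
      (fun x => xbar θ x i) := fun i hi =>
    LinBdd.of_abs_le_self fun x => norm_le_colNorm (Finset.mem_Iic.2 hi) (xbar θ x)
  induction i using Fin.cases with
  | zero => exact hx 0 hi
  | succ i =>
    have hlt : i.castSucc < j := (Fin.castSucc_lt_succ).trans_le hi
    have h : (fun x : XState N => x i.succ) =
        fun x => xbar θ x i.succ + θ i.castSucc (xbar θ x i.castSucc) := by
      funext x; rw [xbar_succ]; ring
    rw [h]
    exact (hx _ hi).add (((linBdd_of_contDiff_real (hθ _ hlt) (hθ0 _ hlt)).comp_right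
      (f := fun x : XState N => xbar θ x i.castSucc)).trans (hx _ hlt.le).abs_size)

theorem linBdd_colNorm_x_of_xbar (j : Fin (N + 1)) (hθ : ∀ i < j, ContDiff ℝ 1 (θ i))
    (hθ0 : ∀ i < j, θ i 0 = 0) :
    LinBdd (fun x : XState N => colNorm (Finset.Iic j) (xbar θ x))
      (fun x => colNorm (Finset.Iic j) x) :=
  (LinBdd.sum (Finset.Iic j) fun i hi =>
    (linBdd_x_of_xbar j hθ hθ0 (Finset.mem_Iic.1 hi)).abs_size).of_abs_le fun x => by
      rw [abs_of_nonneg (colNorm_nonneg _ _)]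
      exact (colNorm_le_sum _ x).trans (le_abs_self _)

theorem linBdd_xbar (hθ : ∀ i, ContDiff ℝ 1 (θ i)) (hθ0 : ∀ i, θ i 0 = 0) (i : Fin (N + 1)) :
    LinBdd (fun x : XState N => colNorm Finset.univ x) (fun x => xbar θ x i) := by
  have hx : ∀ i, LinBdd (fun x : XState N => colNorm Finset.univ x) (fun x => x i) := fun i =>
    LinBdd.of_abs_le_self fun x => norm_le_colNorm (Finset.mem_univ i) x
  induction i using Fin.induction with
  | zero => exact hx 0
  | succ i ih =>
    simp only [xbar_succ]
    exact (hx _).sub (((linBdd_of_contDiff_real (hθ _) (hθ0 _)).comp_right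
      (f := fun x : XState N => xbar θ x i.castSucc)).trans ih.abs_size)

/-- Size of the states that enter the `j`-th level, in the new coordinates. -/
noncomputable def levelSize (θ : Fin (N + 1) → ℝ → ℝ) (j : Fin (N + 1))
    (a : ZState n × XState N × S.W) : ℝ :=
  colNorm (Finset.Iic j) a.1 + colNorm (Finset.Iic j) (xbar θ a.2.1)

variable {S}

theorem levelSize_nonneg (j : Fin (N + 1)) (a : ZState n × XState N × S.W) :
    0 ≤ levelSize S θ j a := add_nonneg (colNorm_nonneg _ _) (colNorm_nonneg _ _)

theorem linBdd_levelSize_x (j : Fin (N + 1)) (hθ : ∀ i < j, ContDiff ℝ 1 (θ i))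
    (hθ0 : ∀ i < j, θ i 0 = 0) {i : Fin (N + 1)} (hi : i ≤ j) :
    LinBdd (levelSize S θ j) (fun a => a.2.1 i) :=
  ((linBdd_x_of_xbar j hθ hθ0 hi).comp_right
    (f := fun a : ZState n × XState N × S.W => a.2.1)).trans (LinBdd.of_abs_le_self fun a => by
      rw [abs_of_nonneg (colNorm_nonneg _ _)]
      exact le_add_of_nonneg_left (colNorm_nonneg _ _))

theorem linBdd_levelSize_xbar {i j : Fin (N + 1)} (hi : i ≤ j) :
    LinBdd (levelSize S θ j) (fun a => xbar θ a.2.1 i) :=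
  LinBdd.of_abs_le_self fun _ => (norm_le_colNorm (Finset.mem_Iic.2 hi) (xbar θ _)).trans
    (le_add_of_nonneg_left (colNorm_nonneg _ _))

theorem linBdd_levelSize_f (j : Fin (N + 1)) (hθ : ∀ i < j, ContDiff ℝ 1 (θ i))
    (hθ0 : ∀ i < j, θ i 0 = 0) :
    LinBdd (levelSize S θ j) (fun a => S.f j a.1 a.2.1 a.2.2) := by
  -- By triangularity the components of level above `j` can be set to zero.
  let tz : ZState n → ZState n := fun z i => if i ≤ j then z i else 0
  let tx : XState N → XState N := fun x i => if i ≤ j then x i else 0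
  have h := linBdd_of_contDiff (E := ZState n × XState N) (P := EuclideanSpace ℝ (Fin p))
    (f := fun y w => S.f j y.1 y.2 w) ((S.f_smooth j).comp
      (by fun_prop : ContDiff ℝ 1 fun a : (ZState n × XState N) × EuclideanSpace ℝ (Fin p) =>
        (a.1.1, a.1.2, a.2)))
    S.isCompact_W (S.f_zero j)
  have h1 := h.comp_right (f := fun a : ZState n × XState N × S.W => ((tz a.1, tx a.2.1), a.2.2))
  have h2 : (fun a : ZState n × XState N × S.W => ‖S.f j (tz a.1) (tx a.2.1) a.2.2‖) =
      fun a => ‖S.f j a.1 a.2.1 a.2.2‖ := by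
    funext a
    rw [S.f_triangular j (tz a.1) a.1 (tx a.2.1) a.2.1 a.2.2 (fun i hi => if_pos hi)
      (fun i hi => if_pos hi)]
  simp only [h2] at h1
  refine (h1.trans ?_).of_abs_le fun a => by simp
  have h3 : LinBdd (levelSize S θ j) (fun a => colNorm (Finset.Iic j) a.1 +
      ∑ i ∈ Finset.Iic j, |a.2.1 i|) := by
    refine (LinBdd.of_abs_le_self fun a => ?_).add (LinBdd.sum _ fun i hi =>
      (linBdd_levelSize_x j hθ hθ0 (Finset.mem_Iic.1 hi)).abs_size)
    rw [abs_of_nonneg (colNorm_nonneg _ _)]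
    exact le_add_of_nonneg_right (colNorm_nonneg _ _)
  refine h3.of_abs_le fun a => ?_
  have hs : 0 ≤ ∑ i ∈ Finset.Iic j, |a.2.1 i| := Finset.sum_nonneg fun _ _ => abs_nonneg _
  have hc := colNorm_nonneg (Finset.Iic j) a.1
  rw [abs_norm, abs_of_nonneg (add_nonneg hc hs), Prod.norm_def]
  refine max_le ((pi_norm_le_iff_of_nonneg (add_nonneg hc hs)).2 fun i => ?_)
    ((pi_norm_le_iff_of_nonneg (add_nonneg hc hs)).2 fun i => ?_)
  · by_cases hi : i ≤ j
    · simp only [tz, if_pos hi]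
      exact (norm_le_colNorm (Finset.mem_Iic.2 hi) a.1).trans (le_add_of_nonneg_right hs)
    · simp only [tz, if_neg hi, norm_zero]; exact add_nonneg hc hs
  · by_cases hi : i ≤ j
    · simp only [tx, if_pos hi]
      exact (Finset.single_le_sum (f := fun i => |a.2.1 i|) (fun _ _ => abs_nonneg _)
        (Finset.mem_Iic.2 hi)).trans (le_add_of_nonneg_left hc)
    · simp only [tx, if_neg hi, norm_zero]; exact add_nonneg hc hs

theorem levelSize_mono {i j : Fin (N + 1)} (hij : i ≤ j) (a : ZState n × XState N × S.W) :
    levelSize S θ i a ≤ levelSize S θ j a :=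
  add_le_add (colNorm_mono (Finset.Iic_subset_Iic.2 hij) _)
    (colNorm_mono (Finset.Iic_subset_Iic.2 hij) _)

/-- The drift `f̄_j` depends only on the functions `ϑ_i` with `i < j`, and is linearly bounded in
terms of the states of the first `j` levels. This is what makes a level-by-level design possible. -/
theorem linBdd_levelSize_fbar (j : Fin (N + 1)) (hθ : ∀ i < j, ContDiff ℝ 1 (θ i))
    (hθ0 : ∀ i < j, θ i 0 = 0) :
    LinBdd (levelSize S θ j) (fun a => fbar S θ j a.1 a.2.1 a.2.2) := by
  induction j using Fin.induction with
  | zero => exact linBdd_levelSize_f 0 hθ hθ0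
  | succ i ih =>
    have hlt : i.castSucc < i.succ := Fin.castSucc_lt_succ
    simp only [fbar_succ]
    refine (linBdd_levelSize_f _ hθ hθ0).sub (LinBdd.loc_mul ?_ (LinBdd.add ?_ ?_))
    · exact LocBdd.comp ((hθ _ hlt).continuous_deriv le_rfl)
        (linBdd_levelSize_xbar hlt.le).locBdd
    · refine (ih (fun k hk => hθ k (hk.trans hlt)) fun k hk => hθ0 k (hk.trans hlt)).trans
        (LinBdd.of_abs_le_self fun a => ?_)
      rw [abs_of_nonneg (levelSize_nonneg _ _)]
      exact levelSize_mono hlt.le a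
    · exact (linBdd_levelSize_x _ hθ hθ0 le_rfl).const_mul _

end system

/-! ### Existence of an admissible design -/

section congr

variable {N p : ℕ} {n : Fin (N + 1) → ℕ} {S : LowerTriangularSystem N p n}
  {θ θ' : Fin (N + 1) → ℝ → ℝ}

theorem xbar_congr (j : Fin (N + 1)) (h : ∀ i < j, θ i = θ' i) (x : XState N) :
    xbar θ x j = xbar θ' x j := by
  induction j using Fin.induction with
  | zero => rfl
  | succ i ih =>
    have hlt : i.castSucc < i.succ := Fin.castSucc_lt_succ
    rw [xbar_succ, xbar_succ, ih fun k hk => h k (hk.trans hlt), h _ hlt]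

theorem fbar_congr (j : Fin (N + 1)) (h : ∀ i < j, θ i = θ' i) (z : ZState n) (x : XState N)
    (w : EuclideanSpace ℝ (Fin p)) : fbar S θ j z x w = fbar S θ' j z x w := by
  induction j using Fin.induction with
  | zero => rfl
  | succ i ih =>
    have hlt : i.castSucc < i.succ := Fin.castSucc_lt_succ
    rw [fbar_succ, fbar_succ, ih fun k hk => h k (hk.trans hlt), h _ hlt,
      xbar_congr i.castSucc fun k hk => h k (hk.trans hlt)]

theorem colNorm_xbar_congr {j : Fin (N + 1)} (h : ∀ i < j, θ i = θ' i) {s : Finset (Fin (N + 1))}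
    (hs : s ⊆ Finset.Iic j) (x : XState N) : colNorm s (xbar θ x) = colNorm s (xbar θ' x) := by
  unfold colNorm
  congr 1
  refine Finset.sum_congr rfl fun i hi => ?_
  rw [xbar_congr i fun k hk => h k (hk.trans_le (Finset.mem_Iic.1 (hs hi)))]

theorem zSubsystemISS_congr {j : Fin (N + 1)} (h : ∀ i < j, θ i = θ' i) {γz γx : ℝ → ℝ}
    (hI : ZSubsystemISS S j (xbar θ) γz γx) : ZSubsystemISS S j (xbar θ') γz γx := by
  unfold ZSubsystemISS at hI ⊢
  simpa only [colNorm_xbar_congr h (Finset.Subset.refl _)] using hI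

end congr

section coordinates

variable {N p : ℕ} {n : Fin (N + 1) → ℕ} {S : LowerTriangularSystem N p n}
  {θ : Fin (N + 1) → ℝ → ℝ}

theorem le_supOn {v : ℝ → ℝ} {a b s : ℝ} (hv : ContinuousOn v (Icc a b)) (hs : s ∈ Icc a b) :
    v s ≤ supOn v a b :=
  le_csSup (isCompact_Icc.bddAbove_image hv) (mem_image_of_mem v hs)

theorem supOn_le {v : ℝ → ℝ} {a b C : ℝ} (hab : a ≤ b) (h : ∀ s ∈ Icc a b, v s ≤ C) :
    supOn v a b ≤ C :=
  csSup_le ((nonempty_Icc.2 hab).image v) (by rintro _ ⟨s, hs, rfl⟩; exact h s hs)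

/-- Input-to-state stability in the original coordinates implies it in the new coordinates. -/
theorem ZSubsystemISS.comp_gain {j : Fin (N + 1)} {γz γx M : ℝ → ℝ}
    (hI : ZSubsystemISS S j id γz γx) (hθ : ∀ i < j, Continuous (θ i)) (hγx : IsGain γx)
    (hM : IsGain M)
    (hle : ∀ x : XState N, colNorm (Finset.Iic j) x ≤ M (colNorm (Finset.Iic j) (xbar θ x))) :
    ZSubsystemISS S j (xbar θ) γz (fun s => γx (M s)) := by
  obtain ⟨β, hβ, h⟩ := hI
  refine ⟨β, hβ, fun w hw T hT z x hz hx hd => (h w hw T hT z x hz hx hd).trans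
    (max_le_max le_rfl (max_le_max le_rfl ?_))⟩
  have hc : Continuous fun x => colNorm (Finset.Iic j) (xbar θ x) := by
    unfold colNorm
    refine Real.continuous_sqrt.comp (continuous_finsetSum _ fun i hi => ?_)
    exact ((continuous_xbar_apply i fun k hk =>
      hθ k (hk.trans_le (Finset.mem_Iic.1 hi))).norm).pow 2
  have h0 : (0 : ℝ) ∈ Icc 0 T := ⟨le_rfl, hT.le⟩
  refine hγx.mono ((colNorm_nonneg (Finset.Iic j) (x 0)).trans
    (le_supOn (v := fun s => colNorm (Finset.Iic j) (x s)) ?_ h0)) (supOn_le hT.le fun s hs => ?_)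
  · exact (continuous_colNorm _).comp_continuousOn hx
  · exact (hle _).trans (hM.mono (colNorm_nonneg _ _)
      (le_supOn (v := fun s => colNorm (Finset.Iic j) (xbar θ (x s))) (hc.comp_continuousOn hx) hs))

end coordinates

/-- The design with `c_j = 1`, `k_j = 4` and a single bounding function `L_j` in place of `ι_j`,
`m_j` and `m̃_j`. -/
def uniformDesign {N : ℕ} (L ψ γx : Fin (N + 1) → ℝ → ℝ) : BacksteppingDesign N where
  c _ := 1
  k _ := 4
  iota := L
  m := L
  mtilde := L
  ψ := ψ
  γx := γx

/-- The requirements on the `j`-th level of `uniformDesign L ψ γx`. -/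
structure LevelAdmissible {N p : ℕ} {n : Fin (N + 1) → ℕ} (S : LowerTriangularSystem N p n)
    (γz : Fin (N + 1) → ℝ → ℝ) (L ψ γx : Fin (N + 1) → ℝ → ℝ) (j : Fin (N + 1)) : Prop where
  L_smooth : ContDiff ℝ 1 (L j)
  L_mono : MonotoneOn (L j) (Ici 0)
  one_le_L : ∀ s, 1 ≤ L j s
  fbar_bound : ∀ z x, ∀ w ∈ S.W, |fbar S ((uniformDesign L ψ γx).θ S.b) j z x w| ≤
    L j (colNorm (Finset.Iic j) z) * colNorm (Finset.Iic j) z +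
      L j (colNorm (Finset.Iio j) (xbar ((uniformDesign L ψ γx).θ S.b) x)) *
        colNorm (Finset.Iio j) (xbar ((uniformDesign L ψ γx).θ S.b) x) +
      L j (xbar ((uniformDesign L ψ γx).θ S.b) x j) * |xbar ((uniformDesign L ψ γx).θ S.b) x j|
  γx_classKInf : IsClassKInf (γx j)
  γx_lin : IsLinGain (γx j)
  γx_gain : ZSubsystemISS S j (xbar ((uniformDesign L ψ γx).θ S.b)) (γz j) (γx j)
  ψ_smooth : ContDiff ℝ 1 (ψ j)
  ψ_even : ∀ s, ψ j (-s) = ψ j s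
  ψ_mono : MonotoneOn (ψ j) (Ici 0)
  one_le_ψ : ∀ s, 1 ≤ ψ j s
  lt_ψ : ∀ s, 0 < s → 4 * max ((uniformDesign L ψ γx).mbar j s / s ^ 2)
    (max ((uniformDesign L ψ γx).iotabar j ((uniformDesign L ψ γx).gainZX γz j (2 * s)) / s ^ 2) 2) <
      ψ j s

section design

variable {N p : ℕ} {n : Fin (N + 1) → ℕ} {S : LowerTriangularSystem N p n}
  {γz : Fin (N + 1) → ℝ → ℝ} {L ψ γx L' ψ' γx' : Fin (N + 1) → ℝ → ℝ} {j : Fin (N + 1)}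

theorem uniformDesign_θ_congr (hL : L j = L' j) (hψ : ψ j = ψ' j) (b : Fin (N + 1) → ℝ) :
    (uniformDesign L ψ γx).θ b j = (uniformDesign L' ψ' γx').θ b j := by
  funext s
  simp only [BacksteppingDesign.θ, uniformDesign, BacksteppingDesign.cbar, hL, hψ]

theorem uniformDesign_gainX_congr (hψ : ψ j = ψ' j) :
    (uniformDesign L ψ γx).gainX j = (uniformDesign L' ψ' γx').gainX j := by
  have : (uniformDesign L ψ γx).rho j = (uniformDesign L' ψ' γx').rho j := by
    funext s
    simp only [BacksteppingDesign.rho, uniformDesign, hψ]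
  funext s
  simp only [BacksteppingDesign.gainX, BacksteppingDesign.rhoInv, this]
  rfl

theorem uniformDesign_gainZX_congr (j : Fin (N + 1)) (hψ : ∀ i < j, ψ i = ψ' i)
    (hγ : ∀ i ≤ j, γx i = γx' i) :
    (uniformDesign L ψ γx).gainZX γz j = (uniformDesign L' ψ' γx').gainZX γz j := by
  induction j using Fin.induction with
  | zero => exact hγ 0 le_rfl
  | succ i ih =>
    have hlt : i.castSucc < i.succ := Fin.castSucc_lt_succ
    funext s
    simp only [BacksteppingDesign.gainZX_succ, BacksteppingDesign.gainZ,
      ih (fun k hk => hψ k (hk.trans hlt)) (fun k hk => hγ k (hk.trans hlt.le)),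
      uniformDesign_gainX_congr (L := L) (L' := L') (γx := γx) (γx' := γx') (hψ _ hlt)]
    have : (uniformDesign L ψ γx).γx i.succ = (uniformDesign L' ψ' γx').γx i.succ := hγ _ le_rfl
    rw [this]

theorem LevelAdmissible.congr (h : LevelAdmissible S γz L ψ γx j) (hL : ∀ i ≤ j, L i = L' i)
    (hψ : ∀ i ≤ j, ψ i = ψ' i) (hγ : ∀ i ≤ j, γx i = γx' i) :
    LevelAdmissible S γz L' ψ' γx' j := by
  have hθ : ∀ i < j, (uniformDesign L ψ γx).θ S.b i = (uniformDesign L' ψ' γx').θ S.b i :=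
    fun i hi => uniformDesign_θ_congr (hL i hi.le) (hψ i hi.le) S.b
  have hLj := hL j le_rfl
  have hψj := hψ j le_rfl
  have hγj := hγ j le_rfl
  refine ⟨hLj ▸ h.L_smooth, hLj ▸ h.L_mono, hLj ▸ h.one_le_L, fun z x w hw => ?_,
    hγj ▸ h.γx_classKInf, hγj ▸ h.γx_lin, hγj ▸ zSubsystemISS_congr hθ h.γx_gain,
    hψj ▸ h.ψ_smooth, hψj ▸ h.ψ_even, hψj ▸ h.ψ_mono, hψj ▸ h.one_le_ψ, fun s hs => ?_⟩
  · have := h.fbar_bound z x w hw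
    rwa [fbar_congr j hθ, xbar_congr j hθ,
      colNorm_xbar_congr hθ (Finset.Iio_subset_Iic_self), hLj] at this
  · have h1 := h.lt_ψ s hs
    rw [uniformDesign_gainZX_congr (L' := L') j (fun i hi => hψ i hi.le) hγ] at h1
    simpa only [BacksteppingDesign.mbar, BacksteppingDesign.iotabar, uniformDesign, hLj,
      hψj] using h1

theorem contDiff_θ_uniformDesign (h : LevelAdmissible S γz L ψ γx j) :
    ContDiff ℝ 1 ((uniformDesign L ψ γx).θ S.b j) :=
  BacksteppingDesign.contDiff_θ h.ψ_even h.ψ_smooth h.L_smooth S.b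

theorem LevelAdmissible.rho_classK (h : LevelAdmissible S γz L ψ γx j) :
    IsClassK ((uniformDesign L ψ γx).rho j) := by
  have hρ : (uniformDesign L ψ γx).rho j = fun s => ψ j s * s ^ 2 := rfl
  rw [hρ]
  refine ⟨by simp, (h.ψ_smooth.continuous.mul (continuous_pow 2)).continuousOn,
    fun s hs t ht hst => ?_⟩
  have hs : 0 ≤ s := hs
  have h1 := h.ψ_mono hs ht hst.le
  have h2 := h.one_le_ψ s
  have h3 : s ^ 2 < t ^ 2 := pow_lt_pow_left₀ hst hs two_ne_zero
  exact mul_lt_mul' h1 h3 (sq_nonneg s) (by linarith)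

theorem LevelAdmissible.sq_lt_rho (h : LevelAdmissible S γz L ψ γx j) {s : ℝ} (hs : 0 < s) :
    (uniformDesign L ψ γx).k j * s ^ 2 < (uniformDesign L ψ γx).rho j s := by
  change 4 * s ^ 2 < ψ j s * s ^ 2
  refine mul_lt_mul_of_pos_right ?_ (by positivity)
  have h2 := h.lt_ψ s hs
  have h3 := (le_max_right _ _).trans (le_max_right
    ((uniformDesign L ψ γx).mbar j s / s ^ 2)
    (max ((uniformDesign L ψ γx).iotabar j ((uniformDesign L ψ γx).gainZX γz j (2 * s)) / s ^ 2) 2))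
  linarith

theorem LevelAdmissible.isLinGain_gainX (h : LevelAdmissible S γz L ψ γx j) :
    IsLinGain ((uniformDesign L ψ γx).gainX j) :=
  BacksteppingDesign.isLinGain_gainX_of h.rho_classK (by norm_num [uniformDesign])
    fun _ => h.sq_lt_rho

theorem admissible_uniformDesign (h : ∀ j, LevelAdmissible S γz L ψ γx j) :
    (uniformDesign L ψ γx).Admissible S γz := by
  have hbar : ∀ j, MonotoneOn (fun s => 1 / (4 * 1) * L j s ^ 2 * s ^ 2) (Ici 0) := by
    intro j s hs t ht hst
    have h1 := (h j).L_mono hs ht hst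
    have h2 := (h j).one_le_L s
    have hs : 0 ≤ s := hs
    change 1 / (4 * 1) * L j s ^ 2 * s ^ 2 ≤ 1 / (4 * 1) * L j t ^ 2 * t ^ 2
    gcongr
  exact
  { c_pos := fun _ => one_pos
    k_zero := by norm_num [uniformDesign]
    k_succ := fun _ => by norm_num [uniformDesign]
    iota_smooth := fun j => (h j).L_smooth
    m_smooth := fun j => (h j).L_smooth
    mtilde_smooth := fun j => (h j).L_smooth
    ψ_smooth := fun j => (h j).ψ_smooth
    iota_nonneg := fun j s _ => zero_le_one.trans ((h j).one_le_L s)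
    m_nonneg := fun j s => zero_le_one.trans ((h j).one_le_L s)
    mtilde_nonneg := fun j s _ => zero_le_one.trans ((h j).one_le_L s)
    iotabar_mono := hbar
    mbar_mono := hbar
    fbar_bound := fun j => (h j).fbar_bound
    γx_classKInf := fun j => (h j).γx_classKInf
    γx_slope := fun j => (h j).γx_lin.finiteSlope
    γx_gain := fun j => (h j).γx_gain
    ψ_even := fun j => (h j).ψ_even
    rho_classK := fun j => (h j).rho_classK
    ψ_zero := fun s hs => by
      refine lt_of_le_of_lt ?_ ((h 0).lt_ψ s hs)
      refine mul_le_mul_of_nonneg_left (max_le ?_ ?_) (by norm_num [uniformDesign])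
      · refine le_max_of_le_right (le_max_of_le_left ?_)
        have hγ := (h 0).γx_lin.toIsGain
        exact div_le_div_of_nonneg_right (hbar 0 (hγ.nonneg hs.le)
          (hγ.nonneg (by positivity)) (hγ.mono hs.le (by linarith))) (sq_nonneg s)
      · exact le_max_of_le_right (le_max_of_le_right one_le_two)
    ψ_succ := fun i s hs => (h i.succ).lt_ψ s hs }

/-- A smooth even function above a function that is bounded on bounded subsets of `(0, ∞)`. -/
theorem exists_psi {Q : ℝ → ℝ} (hQ : ∀ k : ℕ, ∃ C, ∀ s : ℝ, 0 < s → s ≤ k → Q s ≤ C) :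
    ∃ ψ : ℝ → ℝ, ContDiff ℝ 1 ψ ∧ (∀ s, ψ (-s) = ψ s) ∧ MonotoneOn ψ (Ici 0) ∧ (∀ s, 1 ≤ ψ s) ∧
      ∀ s, 0 < s → Q s < ψ s := by
  choose C hC using hQ
  obtain ⟨ψ, h1, h2, h3, h4, h5⟩ := exists_majorant fun k => C k + 1
  refine ⟨ψ, h1, h2, h3, h4, fun s hs => ?_⟩
  have h6 := hC ⌈s⌉₊ s hs (Nat.le_ceil s)
  have h7 := h5 ⌈s⌉₊ s (by rw [abs_of_pos hs]; exact (Nat.ceil_lt_add_one hs.le).le)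
  linarith

/-- Splitting of the bound on `f̄_j` into the contributions of three blocks. -/
theorem mul_self_le_sum_three {L : ℝ → ℝ} (hL : MonotoneOn L (Ici 0)) (h1 : ∀ s, 1 ≤ L s)
    {s a b c : ℝ} (hs : 0 ≤ s) (ha : 0 ≤ a) (hb : 0 ≤ b) (hc : 0 ≤ c) (h : s ≤ a + b + c) :
    L s * s ≤ 3 * L (3 * a) * a + 3 * L (3 * b) * b + 3 * L (3 * c) * c := by
  have key : ∀ d, 0 ≤ d → s ≤ 3 * d → L s * s ≤ 3 * L (3 * d) * d := fun d hd hsd => by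
    have h2 := hL (mem_Ici.2 hs) (mem_Ici.2 (hs.trans hsd)) hsd
    have h3 := (zero_le_one.trans (h1 s)).trans h2
    calc L s * s ≤ L (3 * d) * (3 * d) := by gcongr
      _ = _ := by ring
  have hp : ∀ d, 0 ≤ d → 0 ≤ 3 * L (3 * d) * d := fun d hd => by
    have := h1 (3 * d)
    positivity
  have h4 := hp a ha
  have h5 := hp b hb
  have h6 := hp c hc
  rcases le_total a b with hab | hab
  · rcases le_total b c with hbc | hbc
    · linarith [key c hc (by linarith)]
    · linarith [key b hb (by linarith)]
  · rcases le_total a c with hac | hac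
    · linarith [key c hc (by linarith)]
    · linarith [key a ha (by linarith)]

/-- One step of the recursive design. -/
theorem exists_levelAdmissible_update (hγz : ∀ j, IsLinGain (γz j)) {γ : ℝ → ℝ}
    (hγ : IsClassKInf γ) (hγs : IsLinGain γ) (hI : ZSubsystemISS S j id (γz j) γ)
    (h : ∀ i < j, LevelAdmissible S γz L ψ γx i) :
    ∃ L' ψ' γx', ∀ i ≤ j, LevelAdmissible S γz L' ψ' γx' i := by
  set θ := (uniformDesign L ψ γx).θ S.b with hθdef
  have hθ : ∀ i < j, ContDiff ℝ 1 (θ i) := fun i hi => contDiff_θ_uniformDesign (h i hi)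
  have hθ0 : ∀ i < j, θ i 0 = 0 := fun i _ => BacksteppingDesign.θ_zero _ _ _
  obtain ⟨ℓ, hℓ1, hℓ2, hℓ3, hℓ4, hℓ5⟩ :=
    (linBdd_levelSize_fbar (S := S) j hθ hθ0).exists_majorant (levelSize_nonneg j)
  obtain ⟨M, hM1, hM2, hM3⟩ := (linBdd_colNorm_x_of_xbar j hθ hθ0).exists_gain
    fun _ => colNorm_nonneg _ _
  set ℓ' : ℝ → ℝ := fun s => 3 * ℓ (3 * s) with hℓ'
  set γ' : ℝ → ℝ := fun s => γ (M s) with hγ'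
  have hℓ'1 : ContDiff ℝ 1 ℓ' := contDiff_const.mul (hℓ1.comp (by fun_prop))
  have hℓ'mono : MonotoneOn ℓ' (Ici 0) := fun s hs t ht hst => by
    have hs : 0 ≤ s := hs
    have ht : 0 ≤ t := ht
    exact mul_le_mul_of_nonneg_left (hℓ3 (mem_Ici.2 (by positivity)) (mem_Ici.2 (by positivity))
      (by linarith)) (by norm_num)
  have hℓ'one : ∀ s, 1 ≤ ℓ' s := fun s => by
    have := hℓ4 (3 * s)
    simp only [hℓ']; linarith
  have hγ'lin : IsLinGain γ' := hγs.comp hM2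
  set g := (uniformDesign L ψ (Function.update γx j γ')).gainZX γz j with hg
  have hglin : IsLinGain g := by
    refine BacksteppingDesign.isLinGain_gainZX_of hγz j (fun i hi => ?_) fun i hi => ?_
    · rw [uniformDesign_gainX_congr (L' := L) (γx' := γx) rfl]
      exact (h i hi).isLinGain_gainX
    · change IsLinGain (Function.update γx j γ' i)
      rcases hi.eq_or_lt with rfl | hi
      · rwa [Function.update_self]
      · rw [Function.update_of_ne hi.ne]; exact (h i hi).γx_lin
  obtain ⟨φ, hφ1, hφ2, hφ3, hφ4, hφ5⟩ := exists_psi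
    (Q := fun s => 4 * max (1 / (4 * 1) * ℓ' s ^ 2 * s ^ 2 / s ^ 2)
      (max (1 / (4 * 1) * ℓ' (g (2 * s)) ^ 2 * g (2 * s) ^ 2 / s ^ 2) 2)) (by
    intro k
    obtain ⟨C, hC0, hC⟩ := hglin.lin (2 * k)
    have hk : (0 : ℝ) ≤ k := Nat.cast_nonneg k
    refine ⟨4 * max (1 / (4 * 1) * ℓ' k ^ 2)
      (max (1 / (4 * 1) * ℓ' (g (2 * k)) ^ 2 * (C * 2) ^ 2) 2), fun s hs hsk => ?_⟩
    have h2s : 0 ≤ 2 * s := by positivity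
    have h2 : 0 < s ^ 2 := by positivity
    have h3 := zero_le_one.trans (hℓ'one s)
    have h4 := hℓ'mono (mem_Ici.2 hs.le) (mem_Ici.2 hk) hsk
    have h5 := zero_le_one.trans (hℓ'one (g (2 * s)))
    have h6 := hℓ'mono (mem_Ici.2 (hglin.nonneg h2s)) (mem_Ici.2 (hglin.nonneg (by positivity)))
      (hglin.mono h2s (by linarith : 2 * s ≤ 2 * k))
    have h7 := hC (2 * s) h2s (by linarith)
    have h8 := hglin.nonneg h2s
    refine mul_le_mul_of_nonneg_left (max_le_max ?_ (max_le_max ?_ le_rfl)) (by norm_num)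
    · rw [mul_div_assoc, div_self h2.ne', mul_one]
      gcongr
    · rw [div_le_iff₀ h2]
      calc 1 / (4 * 1) * ℓ' (g (2 * s)) ^ 2 * g (2 * s) ^ 2
          ≤ 1 / (4 * 1) * ℓ' (g (2 * k)) ^ 2 * (C * (2 * s)) ^ 2 := by gcongr
        _ = _ := by ring)
  set L' := Function.update L j ℓ' with hL'
  set ψ' := Function.update ψ j φ with hψ'
  set γx' := Function.update γx j γ' with hγx'
  have hL'i : ∀ i < j, L i = L' i := fun i hi => (Function.update_of_ne hi.ne _ _).symm
  have hψ'i : ∀ i < j, ψ i = ψ' i := fun i hi => (Function.update_of_ne hi.ne _ _).symm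
  have hγ'i : ∀ i < j, γx i = γx' i := fun i hi => (Function.update_of_ne hi.ne _ _).symm
  have hL'j : L' j = ℓ' := Function.update_self ..
  have hψ'j : ψ' j = φ := Function.update_self ..
  have hγ'j : γx' j = γ' := Function.update_self ..
  refine ⟨L', ψ', γx', fun i hi => ?_⟩
  rcases hi.lt_or_eq with hi | rfl
  · exact (h i hi).congr (fun k hk => hL'i k (hk.trans_lt hi)) (fun k hk => hψ'i k (hk.trans_lt hi))
      fun k hk => hγ'i k (hk.trans_lt hi)
  have hθ' : ∀ k < i, θ k = (uniformDesign L' ψ' γx').θ S.b k := fun k hk =>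
    uniformDesign_θ_congr (hL'i k hk) (hψ'i k hk) S.b
  have hg' : g = (uniformDesign L' ψ' γx').gainZX γz i :=
    uniformDesign_gainZX_congr i hψ'i fun _ _ => rfl
  refine ⟨hL'j ▸ hℓ'1, hL'j ▸ hℓ'mono, hL'j ▸ hℓ'one, fun z x w hw => ?_, hγ'j ▸ hγ.comp hM1,
    hγ'j ▸ hγ'lin, hγ'j ▸ zSubsystemISS_congr hθ' ?_, hψ'j ▸ hφ1, hψ'j ▸ hφ2, hψ'j ▸ hφ3,
    hψ'j ▸ hφ4, fun s hs => ?_⟩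
  · rw [← fbar_congr i hθ', ← xbar_congr i hθ',
      ← colNorm_xbar_congr hθ' (Finset.Iio_subset_Iic_self), hL'j]
    have h1 := hℓ5 (z, x, ⟨w, hw⟩)
    have h2 : levelSize S θ i (z, x, ⟨w, hw⟩) ≤ colNorm (Finset.Iic i) z +
        colNorm (Finset.Iio i) (xbar θ x) + |xbar θ x i| := by
      rw [levelSize, add_assoc]
      refine add_le_add le_rfl ?_
      rw [colNorm_Iic, ← colNorm_Iio, Real.sqrt_le_left (add_nonneg (colNorm_nonneg _ _)
        (abs_nonneg _)), Real.norm_eq_abs]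
      nlinarith [mul_nonneg (colNorm_nonneg (Finset.Iio i) (xbar θ x)) (abs_nonneg (xbar θ x i))]
    have h3 : ℓ' |xbar θ x i| = ℓ' (xbar θ x i) := by
      rcases abs_choice (xbar θ x i) with h | h <;> rw [h]
      simp only [hℓ', mul_neg, hℓ2]
    refine h1.trans ((mul_self_le_sum_three hℓ3 hℓ4 (levelSize_nonneg _ _) (colNorm_nonneg _ _)
      (colNorm_nonneg _ _) (abs_nonneg _) h2).trans (le_of_eq ?_))
    rw [← h3]
  · exact hI.comp_gain (fun k hk => (hθ k hk).continuous) hγ.isGain hM1.isGain fun x => by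
      have := hM3 x
      rwa [abs_of_nonneg (colNorm_nonneg _ _)] at this
  · have := hφ5 s hs
    rw [← hg', hψ'j]
    simpa only [BacksteppingDesign.mbar, BacksteppingDesign.iotabar, uniformDesign, hL'j] using this

/-- Existence of an admissible design, level by level. -/
theorem exists_admissible (hγz : ∀ j, IsLinGain (γz j)) {γ : Fin (N + 1) → ℝ → ℝ}
    (hγ : ∀ j, IsClassKInf (γ j)) (hγs : ∀ j, IsLinGain (γ j))
    (hI : ∀ j, ZSubsystemISS S j id (γz j) (γ j)) :
    ∃ D : BacksteppingDesign N, D.Admissible S γz := by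
  have key : ∀ j : Fin (N + 1), ∃ L ψ γx, ∀ i ≤ j, LevelAdmissible S γz L ψ γx i := by
    intro j
    induction j using Fin.induction with
    | zero =>
      exact exists_levelAdmissible_update (L := 0) (ψ := 0) (γx := 0) hγz (hγ 0) (hγs 0) (hI 0)
        fun i hi => absurd hi (Fin.not_lt_zero i)
    | succ i ih =>
      obtain ⟨L, ψ, γx, h⟩ := ih
      exact exists_levelAdmissible_update hγz (hγ _) (hγs _) (hI _)
        fun k hk => h k (Fin.le_castSucc_iff.2 hk)
  obtain ⟨L, ψ, γx, h⟩ := key (Fin.last N)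
  exact ⟨_, admissible_uniformDesign fun j => h j (Fin.le_last j)⟩

/-- Existence of the gains `γ_ξ^z`, `γ_ξ^x`, `γ_ξ^r`; all three can be taken equal. -/
theorem exists_xiBound {θ : Fin (N + 1) → ℝ → ℝ} (hθ : ∀ i, ContDiff ℝ 1 (θ i))
    (hθ0 : ∀ i, θ i 0 = 0) : ∃ γξz γξx γξr, XiBound S θ γξz γξx γξr := by
  set σ : (ZState n × XState N × S.W) × ℝ → ℝ := fun a => levelSize S θ (Fin.last N) a.1 + |a.2|
    with hσdef
  have hσ : ∀ a, 0 ≤ σ a := fun a => add_nonneg (levelSize_nonneg _ _) (abs_nonneg _)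
  have hsize : LinBdd σ (fun a => levelSize S θ (Fin.last N) a.1) :=
    LinBdd.of_abs_le_self fun a => by
      rw [abs_of_nonneg (levelSize_nonneg _ _)]
      exact le_add_of_nonneg_right (abs_nonneg _)
  have hv : LinBdd σ (fun a => a.2) :=
    LinBdd.of_abs_le_self fun a => le_add_of_nonneg_left (levelSize_nonneg _ _)
  have hx : LinBdd σ (fun a => xbar θ a.1.2.1 (Fin.last N)) :=
    ((linBdd_levelSize_xbar (S := S) (θ := θ) (le_refl (Fin.last N))).comp_right
      (f := Prod.fst)).trans hsize
  have hf : LinBdd σ (fun a => fbar S θ (Fin.last N) a.1.1 a.1.2.1 a.1.2.2) :=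
    ((linBdd_levelSize_fbar (S := S) (Fin.last N) (fun i _ => hθ i) fun i _ => hθ0 i).comp_right
      (f := Prod.fst)).trans hsize
  have hξ : LinBdd σ (fun a => deriv (θ (Fin.last N)) (xbar θ a.1.2.1 (Fin.last N)) *
      (fbar S θ (Fin.last N) a.1.1 a.1.2.1 a.1.2.2 +
        S.b (Fin.last N) * (θ (Fin.last N) (xbar θ a.1.2.1 (Fin.last N)) + a.2))) := by
    refine LinBdd.loc_mul (LocBdd.comp ((hθ _).continuous_deriv le_rfl) hx.locBdd) (hf.add ?_)
    refine LinBdd.const_mul (LinBdd.add ?_ hv) _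
    exact ((linBdd_of_contDiff_real (hθ _) (hθ0 _)).comp_right
      (f := fun a : (ZState n × XState N × S.W) × ℝ => xbar θ a.1.2.1 (Fin.last N))).trans
        hx.abs_size
  obtain ⟨G, hG1, hG2, hG3⟩ := hξ.exists_gain hσ
  have h3 : IsClassKInf (fun s : ℝ => 3 * s) :=
    ⟨⟨by simp, by fun_prop, fun s _ t _ hst => by simpa using hst⟩,
      tendsto_id.const_mul_atTop (by norm_num)⟩
  have hK : IsClassKInf (fun s => G (3 * s)) := hG1.comp h3
  have hL : FiniteSlopeAtZero (fun s => G (3 * s)) :=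
    (hG2.comp (IsLinGain.id.const_mul (by norm_num))).finiteSlope
  refine ⟨_, _, _, hK, hK, hK, hL, hL, hL, fun z x w hw v => (hG3 ((z, x, ⟨w, hw⟩), v)).trans ?_⟩
  have ha := colNorm_nonneg Finset.univ z
  have hb := colNorm_nonneg Finset.univ (xbar θ x)
  have hσe : σ ((z, x, ⟨w, hw⟩), v) =
      colNorm Finset.univ z + colNorm Finset.univ (xbar θ x) + |v| := by
    simp only [hσdef, levelSize, colNorm_Iic_last]
  rw [← hK.isGain.map_max hb (abs_nonneg v), ← hK.isGain.map_max ha (le_max_of_le_left hb)]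
  refine hG1.isGain.mono (hσ _) ?_
  rw [hσe]
  have h1 := le_max_left (colNorm Finset.univ z) (max (colNorm Finset.univ (xbar θ x)) |v|)
  have h2 := (le_max_left (colNorm Finset.univ (xbar θ x)) |v|).trans
    (le_max_right (colNorm Finset.univ z) (max (colNorm Finset.univ (xbar θ x)) |v|))
  have h3 := (le_max_right (colNorm Finset.univ (xbar θ x)) |v|).trans
    (le_max_right (colNorm Finset.univ z) (max (colNorm Finset.univ (xbar θ x)) |v|))
  linarith

end design

/-! ### Estimates along closed-loop trajectories -/

section trajectory

variable {N p : ℕ} {n : Fin (N + 1) → ℕ} {S : LowerTriangularSystem N p n}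
  {θ : Fin (N + 1) → ℝ → ℝ} {γbar : ℝ → ℝ} {w : EuclideanSpace ℝ (Fin p)} {T : EReal}
  {t : ℕ → EReal} {z : ℝ → ZState n} {x : ℝ → XState N}

theorem Icc_subset_timeDomain {s : ℝ} (hs : s ∈ timeDomain T) : Icc 0 s ⊆ timeDomain T :=
  fun _ hτ => ⟨hτ.1, (EReal.coe_le_coe_iff.2 hτ.2).trans_lt hs.2⟩

/-- The value of `x̄_{ℓ+1} = u - ϑ_ℓ(x̄_ℓ)` at time `s`, the input `u` being held constant between
the sampling times `t k`. -/
noncomputable def holdError (θ : Fin (N + 1) → ℝ → ℝ) (t : ℕ → EReal) (x : ℝ → XState N)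
    (s : ℝ) : ℝ :=
  open Classical in
  if h : ∃ k, t k ≤ (s : EReal) ∧ (s : EReal) < t (k + 1) then
    feedback θ (x (t h.choose).toReal) - feedback θ (x s)
  else 0

theorem le_sInf_triggerTimes (a : EReal) : a ≤ sInf (triggerTimes θ γbar T x a) :=
  le_sInf fun _ hb => by
    obtain ⟨s, rfl, has, -⟩ := hb
    exact has.le

namespace IsClosedLoopTrajectory

variable (h : IsClosedLoopTrajectory S θ γbar w T t z x)
include h

theorem t_le_succ (k : ℕ) : t k ≤ t (k + 1) := by
  rw [h.t_succ]
  exact le_sInf_triggerTimes _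

theorem t_nonneg (k : ℕ) : 0 ≤ t k := by
  induction k with
  | zero => rw [h.t_zero]
  | succ k ih => exact ih.trans (h.t_le_succ k)

theorem exists_sample {s : ℝ} (hs : s ∈ timeDomain T) : ∃ (k : ℕ) (a : ℝ), t k = (a : EReal) ∧
    0 ≤ a ∧ a ≤ s ∧ (s : EReal) < t (k + 1) ∧
    holdError θ t x s = feedback θ (x a) - feedback θ (x s) := by
  have hex := h.covers s hs
  have hk := hex.choose_spec
  have h1 : t hex.choose ≠ ⊤ := ne_top_of_le_ne_top (EReal.coe_ne_top s) hk.1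
  have h2 : t hex.choose ≠ ⊥ := ne_bot_of_le_ne_bot (by simp) (h.t_nonneg _)
  have h3 := EReal.coe_toReal h1 h2
  refine ⟨hex.choose, (t hex.choose).toReal, h3.symm, ?_, ?_, hk.2, ?_⟩
  · rw [← EReal.coe_le_coe_iff, h3]; exact h.t_nonneg _
  · rw [← EReal.coe_le_coe_iff, h3]; exact hk.1
  · rw [holdError, dif_pos hex]

theorem continuousOn_feedback (hθ : ∀ j, Continuous (θ j)) :
    ContinuousOn (fun s => feedback θ (x s)) (timeDomain T) :=
  (continuous_feedback hθ).comp_continuousOn h.x_continuousOn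

theorem hasDerivWithinAt_xbar (hθ : ∀ j, Differentiable ℝ (θ j)) {s : ℝ} (hs : s ∈ timeDomain T)
    (j : Fin (N + 1)) :
    HasDerivWithinAt (fun τ => xbar θ (x τ) j) (fbar S θ j (z s) (x s) w + S.b j *
      (θ j (xbar θ (x s) j) + above (xbar θ (x s)) (holdError θ t x s) j)) (Ici s) s := by
  obtain ⟨k, a, hk, -, has, hsk, he⟩ := h.exists_sample hs
  have h1 := h.x_ode k s hs (hk.trans_le (EReal.coe_le_coe_iff.2 has)) hsk
  rw [hk, EReal.toReal_coe] at h1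
  rw [he]
  exact _root_.hasDerivWithinAt_xbar hθ h1 j

theorem hasDerivWithinAt_feedback (hθ : ∀ j, Differentiable ℝ (θ j)) {s : ℝ}
    (hs : s ∈ timeDomain T) :
    HasDerivWithinAt (fun τ => feedback θ (x τ))
      (deriv (θ (Fin.last N)) (xbar θ (x s) (Fin.last N)) *
      (fbar S θ (Fin.last N) (z s) (x s) w + S.b (Fin.last N) *
      (θ (Fin.last N) (xbar θ (x s) (Fin.last N)) + holdError θ t x s))) (Ici s) s := by
  have h1 := h.hasDerivWithinAt_xbar hθ hs (Fin.last N)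
  rw [above_last] at h1
  exact (hθ _).differentiableAt.hasDerivAt.comp_hasDerivWithinAt s h1

end IsClosedLoopTrajectory

/-- Input-to-state stability along a trajectory, restarted at an arbitrary time `a`. -/
theorem ZSubsystemISS.exists_window {j : Fin (N + 1)} {γz γx : ℝ → ℝ}
    (hI : ZSubsystemISS S j (xbar θ) γz γx) (hγz : IsGain γz) (hγx : IsGain γx) :
    ∃ β, IsClassKL β ∧ ∀ γbar w T t z x, w ∈ S.W → IsClosedLoopTrajectory S θ γbar w T t z x →
      ∀ a s c₁ c₂, 0 ≤ a → a < s → s ∈ timeDomain T →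
      (∀ τ ∈ Icc a s, colNorm (Finset.Iio j) (z τ) ≤ c₁) →
      (∀ τ ∈ Icc a s, colNorm (Finset.Iic j) (xbar θ (x τ)) ≤ c₂) →
      ‖z s j‖ ≤ max (β ‖z a j‖ (s - a)) (max (γz c₁) (γx c₂)) := by
  obtain ⟨β, hβ, hI⟩ := hI
  refine ⟨β, hβ, fun γbar w T t z x hw h a s c₁ c₂ ha has hs h₁ h₂ => ?_⟩
  have hsub : ∀ τ ∈ Icc 0 (s - a), a + τ ∈ timeDomain T := fun τ hτ =>
    Icc_subset_timeDomain hs ⟨add_nonneg ha hτ.1, by linarith [hτ.2]⟩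
  have hshift : ContinuousOn (fun τ => a + τ) (Icc 0 (s - a)) := by fun_prop
  have h3 := hI w hw (s - a) (sub_pos.2 has) (fun τ => z (a + τ)) (fun τ => x (a + τ))
    (h.z_continuousOn.comp hshift hsub) (h.x_continuousOn.comp hshift hsub) (fun τ hτ => by
      have h4 := h.z_ode (a + τ) (hsub τ (Ico_subset_Icc_self hτ)) j
      have h5 : HasDerivWithinAt (fun τ => a + τ) 1 (Ici τ) τ :=
        ((hasDerivAt_id τ).const_add a).hasDerivWithinAt
      have h6 := h4.scomp τ h5 fun σ (hσ : τ ≤ σ) => mem_Ici.2 (by linarith)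
      rw [one_smul] at h6
      exact h6)
  simp only [add_zero, add_sub_cancel] at h3
  have hIcc : ∀ τ ∈ Icc 0 (s - a), a + τ ∈ Icc a s := fun τ hτ =>
    ⟨by linarith [hτ.1], by linarith [hτ.2]⟩
  have h0 : (0 : ℝ) ∈ Icc 0 (s - a) := ⟨le_rfl, by linarith⟩
  refine h3.trans (max_le_max le_rfl (max_le_max (hγz.mono ?_ ?_) (hγx.mono ?_ ?_)))
  · exact Real.sSup_nonneg (by rintro _ ⟨τ, -, rfl⟩; exact colNorm_nonneg _ _)
  · exact supOn_le h0.2 fun τ hτ => h₁ _ (hIcc τ hτ)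
  · exact Real.sSup_nonneg (by rintro _ ⟨τ, -, rfl⟩; exact colNorm_nonneg _ _)
  · exact supOn_le h0.2 fun τ hτ => h₂ _ (hIcc τ hτ)

theorem above_abs (Y : Fin (N + 1) → ℝ) (r : ℝ) (j : Fin (N + 1)) :
    |above Y r j| = above (fun i => |Y i|) |r| j := by
  refine Fin.lastCases ?_ (fun i => ?_) j <;> simp

/-- Estimate for `|x̄_j|` on a time window with bounded inputs: as long as it exceeds `c`, it
decreases at a definite rate. -/
theorem BacksteppingDesign.Admissible.sq_xbar_le {γz : Fin (N + 1) → ℝ → ℝ}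
    {D : BacksteppingDesign N} (hD : D.Admissible S γz) (hw : w ∈ S.W)
    (h : IsClosedLoopTrajectory S (D.θ S.b) γbar w T t z x) (j : Fin (N + 1))
    {a s c c₁ c₂ c₃ η : ℝ} (ha : 0 ≤ a) (has : a ≤ s) (hs : s ∈ timeDomain T) (hc : 0 ≤ c)
    (hη : 0 < η) (h₁ : ∀ τ ∈ Icc a s, colNorm (Finset.Iic j) (z τ) ≤ c₁)
    (h₂ : ∀ τ ∈ Icc a s, colNorm (Finset.Iio j) (xbar (D.θ S.b) (x τ)) ≤ c₂)
    (h₃ : ∀ τ ∈ Icc a s,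
      |above (xbar (D.θ S.b) (x τ)) (holdError (D.θ S.b) t x τ) j| ≤ c₃)
    (hA : D.iotabar j c₁ + D.mbar j c₂ + c₃ ^ 2 + η ≤ D.rho j c) :
    xbar (D.θ S.b) (x s) j ^ 2 ≤
      max (c ^ 2) (xbar (D.θ S.b) (x a) j ^ 2 - 2 * η * (s - a)) := by
  have hsub : Icc a s ⊆ timeDomain T :=
    (Icc_subset_Icc_left ha).trans (Icc_subset_timeDomain hs)
  have hder := fun τ (hτ : τ ∈ Ico a s) =>
    h.hasDerivWithinAt_xbar hD.differentiable_θ (hsub (Ico_subset_Icc_self hτ)) j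
  refine le_max_of_decreasing_above (f := fun τ => xbar (D.θ S.b) (x τ) j ^ 2) has
    (mul_pos two_pos hη) ?_ (fun τ hτ => (hder τ hτ).pow 2) fun τ hτ hcτ => ?_
  · exact ((continuous_xbar_apply j fun i _ => hD.continuous_θ i).comp_continuousOn
      (h.x_continuousOn.mono hsub)).pow 2
  · have hτ' := Ico_subset_Icc_self hτ
    have hdis := hD.dissipation j (z τ) (x τ) hw
      (above (xbar (D.θ S.b) (x τ)) (holdError (D.θ S.b) t x τ) j)
    have hcx : c ≤ |xbar (D.θ S.b) (x τ) j| := by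
      rw [← abs_of_nonneg hc]; exact sq_le_sq.1 hcτ
    have h4 := (hD.rho_classK j).isGain.mono hc hcx
    have h5 := (hD.isGain_iotabar j).mono (colNorm_nonneg _ _) (h₁ τ hτ')
    have h6 := (hD.isGain_mbar j).mono (colNorm_nonneg _ _) (h₂ τ hτ')
    have h7 := sq_le_sq' (by linarith [abs_le.1 (h₃ τ hτ')]) (abs_le.1 (h₃ τ hτ')).2
    simp only [Nat.cast_ofNat, Nat.add_one_sub_one, pow_one]
    linarith

/-- Consequence of the triggering condition: the sampling error is controlled by the size of
`ξ = dϑ_ℓ(x̄_ℓ)/dt` over a time window of fixed length. -/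
theorem IsClosedLoopTrajectory.gbar_holdError_le {γξz γξx γξr : ℝ → ℝ} {c₀ : ℝ}
    (h : IsClosedLoopTrajectory S θ γbar w T t z x) (hξ : XiBound S θ γξz γξx γξr) (hw : w ∈ S.W)
    (hθ : ∀ j, Differentiable ℝ (θ j)) (hγbar : IsClassKInf γbar) (hc₀ : 0 < c₀)
    (hlin : ∀ s, 0 ≤ s → c₀ * s ≤ γbar s) {s c₁ c₂ c₃ : ℝ} (hs : s ∈ timeDomain T)
    (h₁ : ∀ τ ∈ Icc (max 0 (s - 1 / c₀)) s, colNorm Finset.univ (z τ) ≤ c₁)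
    (h₂ : ∀ τ ∈ Icc (max 0 (s - 1 / c₀)) s, colNorm Finset.univ (xbar θ (x τ)) ≤ c₂)
    (h₃ : ∀ τ ∈ Icc (max 0 (s - 1 / c₀)) s, |holdError θ t x τ| ≤ c₃) :
    γbar |holdError θ t x s| ≤ max (γξz c₁) (max (γξx c₂) (γξr c₃)) := by
  have hc1 : 0 < 1 / c₀ := by positivity
  have hss : s ∈ Icc (max 0 (s - 1 / c₀)) s := ⟨max_le hs.1 (by linarith), le_rfl⟩
  have hpos : 0 ≤ max (γξz c₁) (max (γξx c₂) (γξr c₃)) := le_max_of_le_left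
    (hξ.z_classKInf.nonneg ((colNorm_nonneg _ _).trans (h₁ s hss)))
  obtain ⟨k, a, hk, ha, has, hsk, he⟩ := h.exists_sample hs
  rcases eq_or_ne (holdError θ t x s) 0 with h0 | h0
  · rw [h0, abs_zero, hγbar.zero]; exact hpos
  have has' : a < s := by
    refine lt_of_le_of_ne has fun hEq => h0 ?_
    rw [he, hEq, sub_self]
  have hsub : Icc a s ⊆ timeDomain T :=
    (Icc_subset_Icc_left ha).trans (Icc_subset_timeDomain hs)
  set P := samplingErrorSup θ x a s with hP
  have hcont : ContinuousOn (fun τ => |feedback θ (x τ) - feedback θ (x a)|) (Icc a s) :=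
    (((h.continuousOn_feedback fun j => (hθ j).continuous).mono hsub).sub continuousOn_const).abs
  have hrP : |holdError θ t x s| ≤ P := by
    rw [he, abs_sub_comm]
    exact le_supOn hcont (right_mem_Icc.2 has)
  have hPpos : 0 < P := (abs_pos.2 h0).trans_le hrP
  have hnot : (s - a) * γbar P < P := by
    by_contra! hcon
    have hmem : (s : EReal) ∈ triggerTimes θ γbar T x (t k) := by
      refine ⟨s, rfl, ?_, hs.2, ?_, ?_⟩
      · rw [hk]; exact EReal.coe_lt_coe_iff.2 has'
      · rw [hk, EReal.toReal_coe]; exact hcon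
      · rw [hk, EReal.toReal_coe]; exact hPpos.ne'
    have := sInf_le hmem
    rw [← h.t_succ] at this
    exact absurd hsk (not_lt.2 this)
  have hsa : s - 1 / c₀ ≤ a := by
    have h4 := mul_le_mul_of_nonneg_left (hlin P hPpos.le) (sub_nonneg.2 has)
    have h5 : (s - a) * c₀ < 1 := by
      by_contra! h6
      nlinarith
    have h6 : s - a < 1 / c₀ := by rwa [lt_div_iff₀ hc₀]
    linarith
  have hwin : Icc a s ⊆ Icc (max 0 (s - 1 / c₀)) s := Icc_subset_Icc_left (max_le ha hsa)
  have hPle : P ≤ max (γξz c₁) (max (γξx c₂) (γξr c₃)) * (s - a) := by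
    refine supOn_le has fun τ hτ => ?_
    refine (norm_image_sub_le_of_norm_deriv_right_le_segment
      ((h.continuousOn_feedback fun j => (hθ j).continuous).mono hsub)
      (fun σ hσ => h.hasDerivWithinAt_feedback hθ (hsub (Ico_subset_Icc_self hσ)))
      (fun σ hσ => ?_) τ hτ).trans (mul_le_mul_of_nonneg_left (by linarith [hτ.2]) hpos)
    have hσ' := hwin (Ico_subset_Icc_self hσ)
    exact (hξ.bound _ _ w hw _).trans (max_le_max
      (hξ.z_classKInf.isGain.mono (colNorm_nonneg _ _) (h₁ σ hσ'))
      (max_le_max (hξ.x_classKInf.isGain.mono (colNorm_nonneg _ _) (h₂ σ hσ'))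
        (hξ.r_classKInf.isGain.mono (abs_nonneg _) (h₃ σ hσ'))))
  have hlt : γbar P < max (γξz c₁) (max (γξx c₂) (γξr c₃)) := by
    have := hnot.trans_le hPle
    rw [mul_comm] at this
    exact lt_of_mul_lt_mul_right this (sub_nonneg.2 has)
  exact (hγbar.isGain.mono (abs_nonneg _) hrP).trans hlt.le

end trajectory

/-! ### Global asymptotic stability -/

/-- A trajectory together with its parameter, horizon and sampling times, and a time. -/
structure TimedTrajectory (N p : ℕ) (n : Fin (N + 1) → ℕ) where
  w : EuclideanSpace ℝ (Fin p)
  T : EReal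
  t : ℕ → EReal
  z : ℝ → ZState n
  x : ℝ → XState N
  time : ℝ

/-- Convergence of the time to infinity, uniformly over all trajectories with initial state of norm
at most `R` and all parameters in `W`. -/
noncomputable def uniformAtTop {N p : ℕ} {n : Fin (N + 1) → ℕ} (S : LowerTriangularSystem N p n)
    (θ : Fin (N + 1) → ℝ → ℝ) (γbar : ℝ → ℝ) (R : ℝ) : Filter (TimedTrajectory N p n) :=
  comap TimedTrajectory.time atTop ⊓
    𝓟 {q | q.w ∈ S.W ∧ IsClosedLoopTrajectory S θ γbar q.w q.T q.t q.z q.x ∧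
      stateNorm (q.z 0) (q.x 0) ≤ R ∧ q.time ∈ timeDomain q.T}

section stable

variable {N p : ℕ} {n : Fin (N + 1) → ℕ} {S : LowerTriangularSystem N p n}
  {γz : Fin (N + 1) → ℝ → ℝ} {D : BacksteppingDesign N} {γξz γξx γξr γbar : ℝ → ℝ} {ε : ℝ}

theorem eventually_uniformAtTop {θ : Fin (N + 1) → ℝ → ℝ} {R : ℝ}
    {Q : TimedTrajectory N p n → Prop} :
    (∀ᶠ q in uniformAtTop S θ γbar R, Q q) ↔ ∃ τ : ℝ, ∀ w T t z x s, w ∈ S.W →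
      IsClosedLoopTrajectory S θ γbar w T t z x → stateNorm (z 0) (x 0) ≤ R →
      s ∈ timeDomain T → τ ≤ s → Q ⟨w, T, t, z, x, s⟩ := by
  rw [uniformAtTop, eventually_inf_principal, eventually_comap, eventually_atTop]
  constructor
  · rintro ⟨τ, hτ⟩
    exact ⟨τ, fun w T t z x s hw h hR hs hτs => hτ s hτs ⟨w, T, t, z, x, s⟩ rfl ⟨hw, h, hR, hs⟩⟩
  · rintro ⟨τ, hτ⟩
    refine ⟨τ, ?_⟩
    rintro _ hs ⟨w, T, t, z, x, s⟩ rfl ⟨hw, h, hR, hs'⟩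
    exact hτ w T t z x s hw h hR hs' hs

theorem stateNorm_nonneg (z : ZState n) (x : XState N) : 0 ≤ stateNorm z x := Real.sqrt_nonneg _

theorem colNorm_z_le_stateNorm (z : ZState n) (x : XState N) :
    colNorm Finset.univ z ≤ stateNorm z x := Real.le_sqrt_of_sq_le (by nlinarith)

theorem colNorm_x_le_stateNorm (z : ZState n) (x : XState N) :
    colNorm Finset.univ x ≤ stateNorm z x := Real.le_sqrt_of_sq_le (by nlinarith)

theorem stateNorm_le_add (z : ZState n) (x : XState N) :
    stateNorm z x ≤ colNorm Finset.univ z + colNorm Finset.univ x := by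
  have h1 := colNorm_nonneg Finset.univ z
  have h2 := colNorm_nonneg Finset.univ x
  rw [stateNorm, Real.sqrt_le_left (add_nonneg h1 h2)]
  nlinarith

theorem continuous_stateNorm :
    Continuous fun y : ZState n × XState N => stateNorm y.1 y.2 := by
  have h1 : Continuous fun y : ZState n × XState N => colNorm Finset.univ y.1 :=
    (continuous_colNorm _).comp continuous_fst
  have h2 : Continuous fun y : ZState n × XState N => colNorm Finset.univ y.2 :=
    (continuous_colNorm _).comp continuous_snd
  unfold stateNorm
  fun_prop

theorem BacksteppingDesign.Admissible.linear_le_gbar (hD : D.Admissible S γz)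
    (hξ : XiBound S (D.θ S.b) γξz γξx γξr) (hε : 1 < ε) (hγbar : IsClassKInf γbar)
    (hle : ∀ s, 0 < s → ε * loopGain D γz γξz γξx γξr s ≤ γbar s)
    {w : EuclideanSpace ℝ (Fin p)} (hw : w ∈ S.W) {s : ℝ} (hs : 0 ≤ s) :
    |deriv (D.θ S.b (Fin.last N)) 0 * S.b (Fin.last N)| * s ≤ γbar s := by
  rcases hs.eq_or_lt with rfl | hs
  · rw [mul_zero, hγbar.zero]
  have h1 := hD.linear_le_of_xiBound hξ hw hs.le
  have h2 := hle s hs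
  have h3 : γξr s ≤ loopGain D γz γξz γξx γξr s := (le_max_right _ _).trans (le_max_right _ _)
  have h4 := hξ.r_classKInf.nonneg hs.le
  nlinarith

/-- Uniform stability, and boundedness of the sampling error. -/
theorem BacksteppingDesign.Admissible.exists_uniform_bound (hD : D.Admissible S γz)
    (hγz : ∀ j, IsLinGain (γz j)) (hξ : XiBound S (D.θ S.b) γξz γξx γξr) (hε : 1 < ε)
    (hγbar : IsClassKInf γbar)
    (hle : ∀ s, 0 < s → ε * loopGain D γz γξz γξx γξr s ≤ γbar s) :
    ∃ Ψ, IsGain Ψ ∧ ∀ w T t z x, w ∈ S.W → IsClosedLoopTrajectory S (D.θ S.b) γbar w T t z x →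
      ∀ s ∈ timeDomain T, colNorm Finset.univ (z s) ≤ Ψ (stateNorm (z 0) (x 0)) ∧
        colNorm Finset.univ (xbar (D.θ S.b) (x s)) ≤ Ψ (stateNorm (z 0) (x 0)) ∧
        |holdError (D.θ S.b) t x s| ≤ Ψ (stateNorm (z 0) (x 0)) := by
  obtain ⟨Φ, hΦ, hsmall⟩ := hD.exists_eventually_le hγz hξ hε hγbar hle
  have hγx := fun j => (hD.γx_classKInf j).isGain
  choose β hβ hwin using fun j =>
    (hD.γx_gain j).exists_window (hγz j).toIsGain (hγx j)
  choose G hG1 hG2 hG using fun j =>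
    (linBdd_xbar hD.contDiff_θ (D.θ_zero S.b) j).exists_gain fun _ => colNorm_nonneg _ _
  have hβ0 := fun j => ((hβ j).classK 0 le_rfl).isGain
  have hρ := fun j => (hD.rho_classK j).isGain
  obtain ⟨E₁, hE₁, hE₁le⟩ := IsGain.exists_forall_le Finset.univ hβ0
  obtain ⟨E₂, hE₂, hE₂le⟩ := IsGain.exists_forall_le Finset.univ
    fun j => (hρ j).comp (hG1 j).isGain
  have hE := IsGain.id.sup (hE₁.sup hE₂)
  refine ⟨_, hΦ.comp hE, fun w T t z x hw h s hs => ?_⟩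
  set R := stateNorm (z 0) (x 0) with hR
  have hR0 : 0 ≤ R := stateNorm_nonneg _ _
  set e := max R (max (E₁ R) (E₂ R)) with he
  have hRe : R ≤ e := le_max_left _ _
  have hβe : ∀ j, β j R 0 ≤ e := fun j => (hE₁le j (Finset.mem_univ j) R).trans
    ((le_max_left _ _).trans (le_max_right _ _))
  have hρe : ∀ j, D.rho j (G j R) ≤ e := fun j => (hE₂le j (Finset.mem_univ j) R).trans
    ((le_max_right _ _).trans (le_max_right _ _))
  have hz0 : ∀ j, ‖z 0 j‖ ≤ R := fun j =>
    (norm_le_colNorm (Finset.mem_univ j) (z 0)).trans (colNorm_z_le_stateNorm _ _)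
  have hx0 : ∀ j, |xbar (D.θ S.b) (x 0) j| ≤ G j R := fun j => (hG j (x 0)).trans
    ((hG1 j).isGain.mono (colNorm_nonneg _ _) (colNorm_x_le_stateNorm _ _))
  have hsub := Icc_subset_timeDomain hs
  have hxc : ContinuousOn (fun τ => xbar (D.θ S.b) (x τ)) (Icc 0 s) :=
    (continuous_xbar hD.continuous_θ).comp_continuousOn (h.x_continuousOn.mono hsub)
  have hbdd : ∀ f : ℝ → ℝ, ContinuousOn f (Icc 0 s) → ∃ c, ∀ᶠ τ in 𝓟 (Icc 0 s), f τ ≤ c :=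
    fun f hf => by
      obtain ⟨c, hc⟩ := isCompact_Icc.exists_bound_of_continuousOn hf
      exact ⟨c, eventually_principal.2 fun τ hτ => (le_abs_self _).trans (hc τ hτ)⟩
  have L : LoopEstimates D γz γξz γξx γξr γbar (𝓟 (Icc 0 s)) e
      (fun j τ => colNorm (Finset.Iic j) (z τ))
      (fun j τ => colNorm (Finset.Iic j) (xbar (D.θ S.b) (x τ))) (fun j τ => ‖z τ j‖)
      (fun j τ => |xbar (D.θ S.b) (x τ) j|) (fun τ => |holdError (D.θ S.b) t x τ|) := by
    refine ⟨hR0.trans hRe, fun _ _ => norm_nonneg _, fun _ _ => abs_nonneg _,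
      fun _ => abs_nonneg _, fun j τ => colNorm_Iic j (z τ), fun j τ => colNorm_Iic j _,
      fun j => hbdd _ ((continuous_colNorm _).comp_continuousOn (h.z_continuousOn.mono hsub)),
      fun j => hbdd _ ((continuous_colNorm _).comp_continuousOn hxc), ?_, ?_, ?_, ?_⟩
    · obtain ⟨c, hc⟩ := isCompact_Icc.exists_bound_of_continuousOn
        ((h.continuousOn_feedback hD.continuous_θ).mono hsub)
      refine ⟨c + c, eventually_principal.2 fun τ hτ => ?_⟩
      obtain ⟨k, a, -, ha, haτ, -, hv⟩ := h.exists_sample (hsub hτ)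
      rw [hv]
      exact (norm_sub_le _ _).trans (add_le_add (hc a ⟨ha, haτ.trans hτ.2⟩) (hc τ hτ))
    · intro j c₁ c₂ δ hc₁ hc₂ hδ h₁ h₂
      rw [eventually_principal] at h₁ h₂ ⊢
      intro τ hτ
      rcases hτ.1.eq_or_lt with rfl | hτ0
      · exact le_max_of_le_left (((hz0 j).trans hRe).trans (le_add_of_nonneg_right hδ.le))
      · refine (hwin j γbar w T t z x hw h 0 τ c₁ c₂ le_rfl hτ0 (hsub hτ) (fun σ hσ => ?_)
          fun σ hσ => h₂ σ ⟨hσ.1, hσ.2.trans hτ.2⟩).trans (max_le_max ?_ le_rfl)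
        · rw [colNorm_Iio]; exact h₁ σ ⟨hσ.1, hσ.2.trans hτ.2⟩
        · have h3 := (hβ j).antitoneOn ‖z 0 j‖ (norm_nonneg _) (mem_Ici.2 le_rfl)
            (mem_Ici.2 (by linarith : (0 : ℝ) ≤ τ - 0)) (by linarith)
          have h4 := (hβ0 j).mono (norm_nonneg _) (hz0 j)
          linarith [hβe j]
    · intro j c c₁ c₂ c₃ hc hc₁ hc₂ hc₃ h₁ h₂ h₃ hlt
      rw [eventually_principal] at h₁ h₂ h₃ ⊢
      intro τ hτ
      obtain ⟨hlt1, hlt2⟩ := max_lt_iff.1 hlt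
      have hx0c : |xbar (D.θ S.b) (x 0) j| ≤ c := by
        have h4 := (hρ j).mono (abs_nonneg _) (hx0 j)
        exact ((hD.rho_classK j).le_iff_le (abs_nonneg _) hc).1
          ((h4.trans (hρe j)).trans hlt1.le)
      have hmem : ∀ σ ∈ Icc 0 τ, σ ∈ Icc 0 s := fun σ hσ => ⟨hσ.1, hσ.2.trans hτ.2⟩
      have h4 := hD.sq_xbar_le (c := c) (c₁ := c₁) (c₂ := c₂) (c₃ := c₃)
        (η := D.rho j c - (D.iotabar j c₁ + D.mbar j c₂ + c₃ ^ 2)) hw h j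
        le_rfl hτ.1 (hsub hτ) hc (sub_pos.2 hlt2) (fun σ hσ => h₁ σ (hmem σ hσ))
        (fun σ hσ => by rw [colNorm_Iio]; exact h₂ σ (hmem σ hσ))
        (fun σ hσ => by rw [above_abs]; exact h₃ σ (hmem σ hσ)) (by linarith)
      have h5 : xbar (D.θ S.b) (x 0) j ^ 2 ≤ c ^ 2 :=
        sq_le_sq.2 (by rwa [abs_of_nonneg hc])
      have h6 := mul_nonneg (sub_pos.2 hlt2).le hτ.1
      have h7 : xbar (D.θ S.b) (x τ) j ^ 2 ≤ c ^ 2 :=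
        h4.trans (max_le le_rfl (by linarith))
      rw [← abs_of_nonneg hc]
      exact sq_le_sq.1 h7
    · intro c₁ c₂ c₃ hc₁ hc₂ hc₃ h₁ h₂ h₃
      rw [eventually_principal] at h₁ h₂ h₃ ⊢
      intro τ hτ
      have hmem : ∀ {a σ : ℝ}, σ ∈ Icc (max 0 a) τ → σ ∈ Icc 0 s := fun hσ =>
        ⟨(le_max_left _ _).trans hσ.1, hσ.2.trans hτ.2⟩
      exact (h.gbar_holdError_le hξ hw hD.differentiable_θ hγbar
        (hD.abs_deriv_θ_zero_mul_pos _) (fun σ hσ => hD.linear_le_gbar hξ hε hγbar hle hw hσ)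
        (hsub hτ) (fun σ hσ => by rw [← colNorm_Iic_last]; exact h₁ σ (hmem hσ))
        (fun σ hσ => by rw [← colNorm_Iic_last]; exact h₂ σ (hmem hσ))
        (fun σ hσ => h₃ σ (hmem hσ))).trans (le_max_right _ _)
  have hfin : ∀ c, Φ e < c → colNorm Finset.univ (z s) ≤ c ∧
      colNorm Finset.univ (xbar (D.θ S.b) (x s)) ≤ c ∧ |holdError (D.θ S.b) t x s| ≤ c := by
    intro c hc
    have := hsmall _ _ _ _ _ _ _ L c hc
    rw [eventually_principal] at this
    simpa only [colNorm_Iic_last] using this s ⟨hs.1, le_rfl⟩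
  exact ⟨le_of_forall_gt_imp_ge_of_dense fun c hc => (hfin c hc).1,
    le_of_forall_gt_imp_ge_of_dense fun c hc => (hfin c hc).2.1,
    le_of_forall_gt_imp_ge_of_dense fun c hc => (hfin c hc).2.2⟩

/-- Uniform attractivity. -/
theorem BacksteppingDesign.Admissible.exists_uniform_time (hD : D.Admissible S γz)
    (hγz : ∀ j, IsLinGain (γz j)) (hξ : XiBound S (D.θ S.b) γξz γξx γξr) (hε : 1 < ε)
    (hγbar : IsClassKInf γbar)
    (hle : ∀ s, 0 < s → ε * loopGain D γz γξz γξx γξr s ≤ γbar s) (R : ℝ) {c : ℝ} (hc : 0 < c) :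
    ∃ τ : ℝ, ∀ w T t z x s, w ∈ S.W → IsClosedLoopTrajectory S (D.θ S.b) γbar w T t z x →
      stateNorm (z 0) (x 0) ≤ R → s ∈ timeDomain T → τ ≤ s →
      colNorm Finset.univ (z s) ≤ c ∧ colNorm Finset.univ (xbar (D.θ S.b) (x s)) ≤ c := by
  obtain ⟨Φ, hΦ, hsmall⟩ := hD.exists_eventually_le hγz hξ hε hγbar hle
  obtain ⟨Ψ, hΨ, hbound⟩ := hD.exists_uniform_bound hγz hξ hε hγbar hle
  have hγx := fun j => (hD.γx_classKInf j).isGain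
  choose β hβ hwin using fun j =>
    (hD.γx_gain j).exists_window (hγz j).toIsGain (hγx j)
  set M := Ψ (max R 0) with hM
  have hM0 : 0 ≤ M := hΨ.nonneg (le_max_right _ _)
  have hb : ∀ w T t z x s, w ∈ S.W → IsClosedLoopTrajectory S (D.θ S.b) γbar w T t z x →
      stateNorm (z 0) (x 0) ≤ R → s ∈ timeDomain T → colNorm Finset.univ (z s) ≤ M ∧
      colNorm Finset.univ (xbar (D.θ S.b) (x s)) ≤ M ∧ |holdError (D.θ S.b) t x s| ≤ M :=
    fun w T t z x s hw h hR hs => by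
      have h1 : Ψ (stateNorm (z 0) (x 0)) ≤ M :=
        hΨ.mono (stateNorm_nonneg _ _) (hR.trans (le_max_left _ _))
      obtain ⟨h2, h3, h4⟩ := hbound w T t z x hw h s hs
      exact ⟨h2.trans h1, h3.trans h1, h4.trans h1⟩
  have L : LoopEstimates D γz γξz γξx γξr γbar (uniformAtTop S (D.θ S.b) γbar R) 0
      (fun j q => colNorm (Finset.Iic j) (q.z q.time))
      (fun j q => colNorm (Finset.Iic j) (xbar (D.θ S.b) (q.x q.time)))
      (fun j q => ‖q.z q.time j‖) (fun j q => |xbar (D.θ S.b) (q.x q.time) j|)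
      (fun q => |holdError (D.θ S.b) q.t q.x q.time|) := by
    refine ⟨le_rfl, fun _ _ => norm_nonneg _, fun _ _ => abs_nonneg _,
      fun _ => abs_nonneg _, fun j q => colNorm_Iic j _, fun j q => colNorm_Iic j _,
      fun j => ⟨M, eventually_uniformAtTop.2 ⟨0, fun w T t z x s hw h hR hs _ =>
        (colNorm_mono (Finset.subset_univ _) _).trans (hb w T t z x s hw h hR hs).1⟩⟩,
      fun j => ⟨M, eventually_uniformAtTop.2 ⟨0, fun w T t z x s hw h hR hs _ =>
        (colNorm_mono (Finset.subset_univ _) _).trans (hb w T t z x s hw h hR hs).2.1⟩⟩,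
      ⟨M, eventually_uniformAtTop.2 ⟨0, fun w T t z x s hw h hR hs _ =>
        (hb w T t z x s hw h hR hs).2.2⟩⟩, ?_, ?_, ?_⟩
    · intro j c₁ c₂ δ hc₁ hc₂ hδ h₁ h₂
      rw [eventually_uniformAtTop] at h₁ h₂ ⊢
      obtain ⟨τ₁, h₁⟩ := h₁
      obtain ⟨τ₂, h₂⟩ := h₂
      obtain ⟨σ, hσ0, hσ⟩ := ((eventually_gt_atTop 0).and
        (((hβ j).tendsto_zero M hM0).eventually_lt_const hδ)).exists
      refine ⟨max 0 (max τ₁ τ₂) + σ, fun w T t z x s hw h hR hs hτs => ?_⟩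
      have ha : max 0 (max τ₁ τ₂) ≤ s - σ := by linarith
      have ha0 : 0 ≤ s - σ := (le_max_left _ _).trans ha
      have hmem : ∀ u ∈ Icc (s - σ) s, u ∈ timeDomain T := fun u hu =>
        Icc_subset_timeDomain hs ⟨ha0.trans hu.1, hu.2⟩
      have hτ₁ : ∀ u ∈ Icc (s - σ) s, τ₁ ≤ u := fun u hu =>
        ((le_max_left _ _).trans (le_max_right _ _)).trans (ha.trans hu.1)
      have hτ₂ : ∀ u ∈ Icc (s - σ) s, τ₂ ≤ u := fun u hu =>
        ((le_max_right _ _).trans (le_max_right _ _)).trans (ha.trans hu.1)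
      refine (hwin j γbar w T t z x hw h (s - σ) s c₁ c₂ ha0 (by linarith) hs (fun u hu => ?_)
        fun u hu => h₂ w T t z x u hw h hR (hmem u hu) (hτ₂ u hu)).trans (max_le_max ?_ le_rfl)
      · rw [colNorm_Iio]; exact h₁ w T t z x u hw h hR (hmem u hu) (hτ₁ u hu)
      · have h3 : ‖z (s - σ) j‖ ≤ M := (norm_le_colNorm (Finset.mem_univ j) _).trans
          (hb w T t z x (s - σ) hw h hR (hmem _ ⟨le_rfl, by linarith⟩)).1
        have h4 := ((hβ j).classK σ hσ0.le).isGain.mono (norm_nonneg _) h3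
        rw [sub_sub_cancel, zero_add]
        exact h4.trans hσ.le
    · intro j c c₁ c₂ c₃ hc hc₁ hc₂ hc₃ h₁ h₂ h₃ hlt
      rw [eventually_uniformAtTop] at h₁ h₂ h₃ ⊢
      obtain ⟨τ₁, h₁⟩ := h₁
      obtain ⟨τ₂, h₂⟩ := h₂
      obtain ⟨τ₃, h₃⟩ := h₃
      have hlt2 := (max_lt_iff.1 hlt).2
      set η := D.rho j c - (D.iotabar j c₁ + D.mbar j c₂ + c₃ ^ 2) with hη
      have hη0 : 0 < η := sub_pos.2 hlt2
      -- After a time of length `M² / (2η)` the decrease has exhausted the initial value.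
      refine ⟨max 0 (max τ₁ (max τ₂ τ₃)) + M ^ 2 / (2 * η), fun w T t z x s hw h hR hs hτs => ?_⟩
      set a := max 0 (max τ₁ (max τ₂ τ₃)) with hadef
      have ha0 : 0 ≤ a := le_max_left _ _
      have hlen : 0 ≤ M ^ 2 / (2 * η) := by positivity
      have hmem : ∀ u ∈ Icc a s, u ∈ timeDomain T := fun u hu =>
        Icc_subset_timeDomain hs ⟨ha0.trans hu.1, hu.2⟩
      have hτ : ∀ u ∈ Icc a s, τ₁ ≤ u ∧ τ₂ ≤ u ∧ τ₃ ≤ u := fun u hu => by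
        have := hu.1
        simp only [hadef, max_le_iff] at this
        exact this.2
      have h4 := hD.sq_xbar_le (c := c) (c₁ := c₁) (c₂ := c₂) (c₃ := c₃) (η := η) hw h j
        ha0 (by linarith) hs hc hη0
        (fun u hu => h₁ w T t z x u hw h hR (hmem u hu) (hτ u hu).1)
        (fun u hu => by
          rw [colNorm_Iio]; exact h₂ w T t z x u hw h hR (hmem u hu) (hτ u hu).2.1)
        (fun u hu => by
          rw [above_abs]; exact h₃ w T t z x u hw h hR (hmem u hu) (hτ u hu).2.2)
        (by linarith)
      have h5 : |xbar (D.θ S.b) (x a) j| ≤ M := (norm_le_colNorm (Finset.mem_univ j) _).trans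
        (hb w T t z x a hw h hR (hmem a ⟨le_rfl, by linarith⟩)).2.1
      have h6 : xbar (D.θ S.b) (x a) j ^ 2 ≤ M ^ 2 :=
        sq_le_sq.2 (by rwa [abs_of_nonneg hM0])
      have h7 : M ^ 2 ≤ 2 * η * (s - a) := by
        have : M ^ 2 / (2 * η) ≤ s - a := by linarith
        rwa [div_le_iff₀' (by positivity)] at this
      have h8 : xbar (D.θ S.b) (x s) j ^ 2 ≤ c ^ 2 :=
        h4.trans (max_le le_rfl (by linarith [sq_nonneg c]))
      change |xbar (D.θ S.b) (x s) j| ≤ c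
      rw [← abs_of_nonneg hc]
      exact sq_le_sq.1 h8
    · intro c₁ c₂ c₃ hc₁ hc₂ hc₃ h₁ h₂ h₃
      rw [eventually_uniformAtTop] at h₁ h₂ h₃ ⊢
      obtain ⟨τ₁, h₁⟩ := h₁
      obtain ⟨τ₂, h₂⟩ := h₂
      obtain ⟨τ₃, h₃⟩ := h₃
      set c₀ := |deriv (D.θ S.b (Fin.last N)) 0 * S.b (Fin.last N)| with hc₀def
      have hc₀ : 0 < c₀ := hD.abs_deriv_θ_zero_mul_pos _
      refine ⟨max τ₁ (max τ₂ τ₃) + 1 / c₀, fun w T t z x s hw h hR hs hτs => ?_⟩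
      have hmem : ∀ u ∈ Icc (max 0 (s - 1 / c₀)) s, u ∈ timeDomain T := fun u hu =>
        Icc_subset_timeDomain hs ⟨(le_max_left _ _).trans hu.1, hu.2⟩
      have hτ : ∀ u ∈ Icc (max 0 (s - 1 / c₀)) s, τ₁ ≤ u ∧ τ₂ ≤ u ∧ τ₃ ≤ u := fun u hu => by
        have h4 : max τ₁ (max τ₂ τ₃) ≤ u := by
          have := (le_max_right _ _).trans hu.1
          linarith
        simpa only [max_le_iff] using h4
      exact (h.gbar_holdError_le hξ hw hD.differentiable_θ hγbar hc₀
        (fun σ hσ => hD.linear_le_gbar hξ hε hγbar hle hw hσ) hs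
        (fun u hu => by
          rw [← colNorm_Iic_last]; exact h₁ w T t z x u hw h hR (hmem u hu) (hτ u hu).1)
        (fun u hu => by
          rw [← colNorm_Iic_last]; exact h₂ w T t z x u hw h hR (hmem u hu) (hτ u hu).2.1)
        (fun u hu => h₃ w T t z x u hw h hR (hmem u hu) (hτ u hu).2.2)).trans (le_max_right _ _)
  have h1 := hsmall _ _ _ _ _ _ _ L c (by rwa [hΦ.zero])
  rw [eventually_uniformAtTop] at h1
  obtain ⟨τ, h1⟩ := h1
  refine ⟨τ, fun w T t z x s hw h hR hs hτs => ?_⟩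
  have h2 := h1 w T t z x s hw h hR hs hτs
  simp only [colNorm_Iic_last] at h2
  exact ⟨h2.1, h2.2.1⟩

end stable

/-- Uniform stability and uniform attractivity give a class `𝒦ℒ` estimate. The relation `Q r s y`
says that `y` is the norm at time `s` of the state of a trajectory with initial norm `r`. The
supremum of the admissible values is smoothed by averaging over `[r, 2r]`. -/
theorem exists_classKL {Q : ℝ → ℝ → ℝ → Prop} {Ψ : ℝ → ℝ} (hΨ : IsGain Ψ)
    (hr : ∀ r s y, Q r s y → 0 ≤ r) (hbound : ∀ r s y, Q r s y → y ≤ Ψ r)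
    (hattr : ∀ R δ, 0 < δ → ∃ τ, ∀ r s y, Q r s y → r ≤ R → τ ≤ s → y ≤ δ) :
    ∃ β, IsClassKL β ∧ ∀ r s y, Q r s y → y ≤ β r s := by
  set A : ℝ → ℝ → Set ℝ := fun R τ => insert 0 {y | ∃ r s, Q r s y ∧ r ≤ R ∧ τ ≤ s} with hA
  set B : ℝ → ℝ → ℝ := fun R τ => sSup (A R τ) with hB
  have hAle : ∀ R τ, ∀ y ∈ A R τ, y ≤ Ψ (max R 0) := by
    rintro R τ y (rfl | ⟨r, s, hQ, hrR, -⟩)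
    · exact hΨ.nonneg (le_max_right _ _)
    · exact (hbound r s y hQ).trans (hΨ.mono (hr r s y hQ) (hrR.trans (le_max_left _ _)))
  have hbdd : ∀ R τ, BddAbove (A R τ) := fun R τ => ⟨_, hAle R τ⟩
  have hne : ∀ R τ, (A R τ).Nonempty := fun R τ => ⟨0, Or.inl rfl⟩
  have hB0 : ∀ R τ, 0 ≤ B R τ := fun R τ => le_csSup (hbdd R τ) (Or.inl rfl)
  have hBΨ : ∀ R τ, B R τ ≤ Ψ (max R 0) := fun R τ => csSup_le (hne R τ) (hAle R τ)
  have hmono : ∀ τ, Monotone fun R => B R τ := fun τ R R' hRR' =>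
    csSup_le_csSup (hbdd R' τ) (hne R τ) (insert_subset_insert
      fun y ⟨r, s, hQ, h1, h2⟩ => ⟨r, s, hQ, h1.trans hRR', h2⟩)
  have hanti : ∀ R τ τ', τ ≤ τ' → B R τ' ≤ B R τ := fun R τ τ' hττ' =>
    csSup_le_csSup (hbdd R τ) (hne R τ') (insert_subset_insert
      fun y ⟨r, s, hQ, h1, h2⟩ => ⟨r, s, hQ, h1, hττ'.trans h2⟩)
  have hlim : ∀ R, Tendsto (B R) atTop (𝓝 0) := fun R => by
    refine tendsto_order.2 ⟨fun a ha => Eventually.of_forall fun τ => ha.trans_le (hB0 R τ),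
      fun a ha => ?_⟩
    obtain ⟨τ, hτ⟩ := hattr R (a / 2) (by positivity)
    filter_upwards [eventually_ge_atTop τ] with τ' hτ'
    refine (csSup_le (hne R τ') ?_).trans_lt (by linarith : a / 2 < a)
    rintro y (rfl | ⟨r, s, hQ, h1, h2⟩)
    · positivity
    · exact hτ r s y hQ h1 (hτ'.trans h2)
  have hint : ∀ τ a b, IntervalIntegrable (fun R => B R τ) MeasureTheory.volume a b :=
    fun τ a b => (hmono τ).intervalIntegrable
  set F : ℝ → ℝ → ℝ := fun s τ => ∫ σ in (1 : ℝ)..2, B (s * σ) τ with hF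
  have hmono' : ∀ τ s, 0 ≤ s → Monotone fun σ => B (s * σ) τ := fun τ s hs σ σ' hσ =>
    hmono τ (mul_le_mul_of_nonneg_left hσ hs)
  have hint' : ∀ τ s, 0 ≤ s → IntervalIntegrable (fun σ => B (s * σ) τ) MeasureTheory.volume 1 2 :=
    fun τ s hs => (hmono' τ s hs).intervalIntegrable
  have hFle : ∀ τ s, 0 ≤ s → F s τ ≤ B (s * 2) τ := fun τ s hs => by
    have := intervalIntegral.integral_mono_on one_le_two (hint' τ s hs)
      (intervalIntegrable_const (c := B (s * 2) τ)) fun σ hσ => hmono' τ s hs hσ.2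
    rw [intervalIntegral.integral_const] at this
    norm_num at this
    exact this
  have hFge : ∀ τ s, 0 ≤ s → B s τ ≤ F s τ := fun τ s hs => by
    have := intervalIntegral.integral_mono_on one_le_two
      (intervalIntegrable_const (c := B s τ)) (hint' τ s hs) fun σ hσ => by
        have := hmono' τ s hs hσ.1
        simpa using this
    rw [intervalIntegral.integral_const] at this
    norm_num at this
    exact this
  have hF0 : ∀ τ s, 0 ≤ s → 0 ≤ F s τ := fun τ s hs => (hB0 s τ).trans (hFge τ s hs)
  have hFzero : ∀ τ, F 0 τ = 0 := fun τ => by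
    refine le_antisymm ((hFle τ 0 le_rfl).trans ((hBΨ _ _).trans ?_)) (hF0 τ 0 le_rfl)
    rw [zero_mul, max_self, hΨ.zero]
  have hFcont : ∀ τ, ContinuousOn (fun s => F s τ) (Ici 0) := fun τ s hs => by
    rcases (show (0 : ℝ) ≤ s from hs).eq_or_lt with rfl | hs
    · change Tendsto (fun s => F s τ) (𝓝[≥] 0) (𝓝 (F 0 τ))
      rw [hFzero]
      have hΨ0 : Tendsto (fun s => Ψ (s * 2)) (𝓝[Ici 0] 0) (𝓝 0) := by
        have := (hΨ.comp (IsGain.id.const_mul zero_le_two)).continuousOn 0 (mem_Ici.2 le_rfl)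
        simpa [ContinuousWithinAt, hΨ.zero, mul_comm] using this
      refine tendsto_of_tendsto_of_tendsto_of_le_of_le' tendsto_const_nhds hΨ0 ?_ ?_
      · filter_upwards [self_mem_nhdsWithin] with s hs using hF0 τ s hs
      · filter_upwards [self_mem_nhdsWithin] with s hs
        have hs : 0 ≤ s := hs
        have := hBΨ (s * 2) τ
        rw [max_eq_left (by positivity)] at this
        exact (hFle τ s hs).trans this
    · have hprim : Continuous fun b => ∫ R in (0 : ℝ)..b, B R τ :=
        intervalIntegral.continuous_primitive (fun a b => hint τ a b) 0
      have hEq : ∀ᶠ u in 𝓝 s, F u τ = u⁻¹ * ((∫ R in (0 : ℝ)..(u * 2), B R τ) -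
          ∫ R in (0 : ℝ)..u, B R τ) := by
        filter_upwards [eventually_gt_nhds hs] with u hu
        rw [hF]
        simp only
        rw [intervalIntegral.integral_comp_mul_left (fun R => B R τ) hu.ne', mul_one, smul_eq_mul,
          intervalIntegral.integral_interval_sub_left (hint τ _ _) (hint τ _ _)]
      refine (ContinuousAt.congr ?_ (hEq.mono fun _ h => h.symm)).continuousWithinAt
      exact (continuousAt_inv₀ hs.ne').mul
        (((hprim.comp (continuous_mul_const 2)).sub hprim).continuousAt)
  refine ⟨fun s τ => F s τ + s * Real.exp (-τ), ⟨fun τ hτ => ⟨?_, ?_, ?_⟩, ?_, ?_⟩, ?_⟩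
  · simp [hFzero]
  · exact (hFcont τ).add (by fun_prop)
  · intro s hs s' hs' hss'
    have hs : 0 ≤ s := hs
    have hs' : 0 ≤ s' := hs'
    have h1 : F s τ ≤ F s' τ := intervalIntegral.integral_mono_on one_le_two (hint' τ s hs)
      (hint' τ s' hs') fun σ hσ => hmono τ
        (mul_le_mul_of_nonneg_right hss'.le (zero_le_one.trans hσ.1))
    exact add_lt_add_of_le_of_lt h1 (mul_lt_mul_of_pos_right hss' (Real.exp_pos _))
  · intro s hs τ _ τ' _ hττ'
    refine add_le_add (intervalIntegral.integral_mono_on one_le_two (hint' τ' s hs) (hint' τ s hs)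
      fun σ _ => hanti _ _ _ hττ') (mul_le_mul_of_nonneg_left ?_ hs)
    exact Real.exp_le_exp.2 (by linarith)
  · intro s hs
    have h1 : Tendsto (fun τ => F s τ) atTop (𝓝 0) :=
      tendsto_of_tendsto_of_tendsto_of_le_of_le tendsto_const_nhds (hlim (s * 2))
        (fun τ => hF0 τ s hs) fun τ => hFle τ s hs
    have h2 : Tendsto (fun τ : ℝ => s * Real.exp (-τ)) atTop (𝓝 (s * 0)) :=
      (Real.tendsto_exp_neg_atTop_nhds_zero).const_mul s
    simpa using h1.add h2
  · intro r s y hQ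
    have hr0 := hr r s y hQ
    have h1 : y ≤ B r s := le_csSup (hbdd r s) (Or.inr ⟨r, s, hQ, le_rfl, le_rfl⟩)
    have h2 := mul_nonneg hr0 (Real.exp_pos (-s)).le
    linarith [hFge s r hr0]

section stable

variable {N p : ℕ} {n : Fin (N + 1) → ℕ} {S : LowerTriangularSystem N p n}
  {γz : Fin (N + 1) → ℝ → ℝ} {D : BacksteppingDesign N} {γξz γξx γξr γbar : ℝ → ℝ} {ε : ℝ}

/-- Global asymptotic stability of the closed loop, in terms of a class `𝒦ℒ` function. -/
theorem BacksteppingDesign.Admissible.exists_stable (hD : D.Admissible S γz)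
    (hγz : ∀ j, IsLinGain (γz j)) (hξ : XiBound S (D.θ S.b) γξz γξx γξr) (hε : 1 < ε)
    (hγbar : IsClassKInf γbar)
    (hle : ∀ s, 0 < s → ε * loopGain D γz γξz γξx γξr s ≤ γbar s) :
    ∃ β : ℝ → ℝ → ℝ, IsClassKL β ∧
      ∀ w ∈ S.W, ∀ T t z x, IsClosedLoopTrajectory S (D.θ S.b) γbar w T t z x →
        ∀ s ∈ timeDomain T, stateNorm (z s) (x s) ≤ β (stateNorm (z 0) (x 0)) s := by
  obtain ⟨Ψ, hΨ, hbound⟩ := hD.exists_uniform_bound hγz hξ hε hγbar hle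
  obtain ⟨M, hM1, hM2, hM⟩ := (linBdd_colNorm_x_of_xbar (Fin.last N)
    (fun i _ => hD.contDiff_θ i) fun i _ => D.θ_zero S.b i).exists_gain
    fun _ => colNorm_nonneg _ _
  have hM' : ∀ x : XState N, colNorm Finset.univ x ≤
      M (colNorm Finset.univ (xbar (D.θ S.b) x)) := fun x => by
    have := hM x
    rwa [abs_of_nonneg (colNorm_nonneg _ _), colNorm_Iic_last, colNorm_Iic_last] at this
  have hstate : ∀ (z : ZState n) (x : XState N) c, colNorm Finset.univ z ≤ c →
      colNorm Finset.univ (xbar (D.θ S.b) x) ≤ c → stateNorm z x ≤ c + M c := fun z x c hz hx =>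
    (stateNorm_le_add z x).trans (add_le_add hz ((hM' x).trans
      (hM1.isGain.mono (colNorm_nonneg _ _) hx)))
  have hG : IsGain fun c => c + M c := IsGain.id.add hM1.isGain
  let Q : ℝ → ℝ → ℝ → Prop := fun r s y => ∃ w T t z x, w ∈ S.W ∧
    IsClosedLoopTrajectory S (D.θ S.b) γbar w T t z x ∧
      s ∈ timeDomain T ∧ r = stateNorm (z 0) (x 0) ∧ y = stateNorm (z s) (x s)
  have hQ0 : ∀ r s y, Q r s y → 0 ≤ r := by
    rintro r s y ⟨w, T, t, z, x, hw, h, hs, rfl, rfl⟩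
    exact stateNorm_nonneg _ _
  have hQb : ∀ r s y, Q r s y → y ≤ Ψ r + M (Ψ r) := by
    rintro r s y ⟨w, T, t, z, x, hw, h, hs, rfl, rfl⟩
    obtain ⟨h1, h2, -⟩ := hbound w T t z x hw h s hs
    exact hstate _ _ _ h1 h2
  have hQa : ∀ R δ, 0 < δ → ∃ τ, ∀ r s y, Q r s y → r ≤ R → τ ≤ s → y ≤ δ := by
    intro R δ hδ
    obtain ⟨c, hc, hcδ⟩ := hG.exists_gt_lt le_rfl (by rw [hG.zero]; exact hδ)
    obtain ⟨τ, hτ⟩ := hD.exists_uniform_time hγz hξ hε hγbar hle R hc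
    refine ⟨τ, ?_⟩
    rintro r s y ⟨w, T, t, z, x, hw, h, hs, rfl, rfl⟩ hrR hτs
    obtain ⟨h1, h2⟩ := hτ w T t z x s hw h hrR hs hτs
    exact (hstate _ _ _ h1 h2).trans (hcδ c hc.le le_rfl).le
  obtain ⟨β, hβ, hle'⟩ := exists_classKL (hG.comp hΨ) hQ0 hQb hQa
  exact ⟨β, hβ, fun w hw T t z x h s hs => hle' _ _ _ ⟨w, T, t, z, x, hw, h, hs, rfl, rfl⟩⟩

end stable

/-! ### Dwell time between sampling times -/

section zeno

variable {N p : ℕ} {n : Fin (N + 1) → ℕ} {S : LowerTriangularSystem N p n}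
  {θ : Fin (N + 1) → ℝ → ℝ} {γbar : ℝ → ℝ}

/-- A linear bound on `γbar` on the range of the sampling error gives a dwell time. -/
theorem add_le_of_mem_triggerTimes {T : EReal} {x : ℝ → XState N} {C M a t : ℝ} (hC0 : 0 < C)
    (hC : ∀ P, 0 ≤ P → P ≤ M → γbar P ≤ C * P)
    (ht : (t : EReal) ∈ triggerTimes θ γbar T x (a : EReal))
    (hM : ∀ s ∈ Icc a t, |feedback θ (x s) - feedback θ (x a)| ≤ M) : a + 1 / C ≤ t := by
  obtain ⟨t', ht', hat, -, hle, hne⟩ := ht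
  rw [EReal.coe_eq_coe_iff] at ht'
  subst ht'
  rw [EReal.toReal_coe] at hle hne
  rw [EReal.coe_lt_coe_iff] at hat
  set P := samplingErrorSup θ x a t
  have hP0 : 0 ≤ P := Real.sSup_nonneg (by rintro _ ⟨τ, -, rfl⟩; exact abs_nonneg _)
  have hPpos : 0 < P := lt_of_le_of_ne hP0 (Ne.symm hne)
  have h1 := hC P hP0 (supOn_le hat.le hM)
  have h2 := mul_le_mul_of_nonneg_left h1 (sub_nonneg.2 hat.le)
  have h3 : 1 ≤ (t - a) * C := by
    by_contra! h4
    nlinarith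
  have h4 : 1 / C ≤ t - a := by rwa [div_le_iff₀ hC0]
  linarith

theorem norm_le_colNorm_univ (x : XState N) : ‖x‖ ≤ colNorm Finset.univ x :=
  (pi_norm_le_iff_of_nonneg (colNorm_nonneg _ _)).2 fun i => norm_le_colNorm (Finset.mem_univ i) x

/-- The feedback is bounded on bounded sets. -/
theorem exists_abs_feedback_le (hθ : ∀ j, Continuous (θ j)) (M : ℝ) :
    ∃ C, 0 ≤ C ∧ ∀ x : XState N, ‖x‖ ≤ M → |feedback θ x| ≤ C := by
  obtain ⟨C, hC⟩ := (isCompact_closedBall (0 : XState N) M).exists_bound_of_continuousOn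
    (continuous_feedback hθ).continuousOn
  exact ⟨max C 0, le_max_right _ _, fun x hx =>
    (hC x (by simpa using hx)).trans (le_max_left _ _)⟩

/-- A stable closed loop has no Zeno behaviour. -/
theorem exists_dwell_time (hθ : ∀ j, Continuous (θ j)) (hγbar : IsLinGain γbar)
    {β : ℝ → ℝ → ℝ} (hβ : IsClassKL β)
    (hstable : ∀ w ∈ S.W, ∀ T t z x, IsClosedLoopTrajectory S θ γbar w T t z x →
      ∀ s ∈ timeDomain T, stateNorm (z s) (x s) ≤ β (stateNorm (z 0) (x 0)) s) (R : ℝ) :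
    ∃ τ : ℝ, 0 < τ ∧ ∀ w ∈ S.W, ∀ T t z x, IsClosedLoopTrajectory S θ γbar w T t z x →
      stateNorm (z 0) (x 0) ≤ R → ∀ k, t k + (τ : EReal) ≤ t (k + 1) := by
  obtain ⟨M, hM0, hM⟩ := exists_abs_feedback_le hθ (β R 0)
  obtain ⟨C, hC0, hC⟩ := hγbar.lin (M + M)
  refine ⟨1 / (C + 1), by positivity, fun w hw T t z x h hR k => ?_⟩
  have hb : ∀ s ∈ timeDomain T, |feedback θ (x s)| ≤ M := fun s hs => by
    refine hM _ (((norm_le_colNorm_univ _).trans (colNorm_x_le_stateNorm (z s) (x s))).trans ?_)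
    have h1 := stateNorm_nonneg (z 0) (x 0)
    have h2 := hβ.antitoneOn _ h1 (mem_Ici.2 le_rfl) (mem_Ici.2 hs.1) hs.1
    exact ((hstable w hw T t z x h s hs).trans h2).trans ((hβ.classK 0 le_rfl).isGain.mono h1 hR)
  rcases eq_or_ne (t k) ⊤ with htop | htop
  · have h1 : t (k + 1) = ⊤ := top_le_iff.1 (htop ▸ h.t_le_succ k)
    rw [h1]; exact le_top
  have h2 : t k ≠ ⊥ := ne_bot_of_le_ne_bot (by simp) (h.t_nonneg k)
  lift t k to ℝ using ⟨htop, h2⟩ with a ha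
  have ha0 : 0 ≤ a := by
    rw [← EReal.coe_le_coe_iff, ha]; exact h.t_nonneg k
  rw [h.t_succ, ← ha]
  refine le_sInf fun b hbmem => ?_
  have hbmem' := hbmem
  obtain ⟨s, rfl, has, hsT, -⟩ := hbmem
  rw [EReal.coe_lt_coe_iff] at has
  have hs : s ∈ timeDomain T := ⟨ha0.trans has.le, hsT⟩
  rw [← EReal.coe_add, EReal.coe_le_coe_iff]
  refine add_le_of_mem_triggerTimes (by positivity) (M := M + M) (fun P hP hPM => ?_) hbmem'
    fun σ hσ => ?_
  · have := hC P hP hPM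
    linarith
  · exact (norm_sub_le (feedback θ (x σ)) (feedback θ (x a))).trans (add_le_add
      (hb σ (Icc_subset_timeDomain hs ⟨ha0.trans hσ.1, hσ.2⟩))
      (hb a (Icc_subset_timeDomain hs ⟨ha0, has.le⟩)))

end zeno

/-! ### Existence of closed-loop trajectories -/

/-- Global solutions of an autonomous equation with a bounded and Lipschitz right-hand side. -/
theorem exists_global_solution {E : Type*} [NormedAddCommGroup E] [NormedSpace ℝ E]
    [CompleteSpace E] {K C : NNReal} {v : E → E} (hv : LipschitzWith K v) (hC : ∀ y, ‖v y‖ ≤ C)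
    (y₀ : E) : ∃ Y : ℝ → E, Y 0 = y₀ ∧ ∀ s, 0 ≤ s → HasDerivWithinAt Y (v (Y s)) (Ici 0) s := by
  have hloc : ∀ m : ℕ, ∃ Y : ℝ → E, Y 0 = y₀ ∧
      ∀ s ∈ Icc (0 : ℝ) (m + 1), HasDerivWithinAt Y (v (Y s)) (Icc 0 (m + 1)) s := by
    intro m
    have hP : IsPicardLindelof (fun _ => v) (tmin := 0) (tmax := m + 1)
        ⟨0, le_rfl, by positivity⟩ y₀ (C * (m + 1)) 0 C K :=
      { lipschitzOnWith := fun _ _ => hv.lipschitzOnWith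
        continuousOn := fun _ _ => continuousOn_const
        norm_le := fun _ _ y _ => hC y
        mul_max_le := by
          have : (0 : ℝ) ≤ m + 1 := by positivity
          simp [this] }
    exact hP.exists_eq_forall_mem_Icc_hasDerivWithinAt₀
  choose Y hY0 hY using hloc
  have hright : ∀ (m : ℕ), ∀ s ∈ Ico (0 : ℝ) (m + 1),
      HasDerivWithinAt (Y m) (v (Y m s)) (Ici s) s :=
    fun m s hs => ((hY m s (Ico_subset_Icc_self hs)).mono
      (Icc_subset_Icc_left hs.1)).mono_of_mem_nhdsWithin (Icc_mem_nhdsGE hs.2)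
  have huniq : ∀ m m' : ℕ, m ≤ m' → EqOn (Y m) (Y m') (Icc 0 (m + 1)) := by
    intro m m' hmm'
    have hle : (m : ℝ) + 1 ≤ m' + 1 := by exact_mod_cast Nat.succ_le_succ hmm'
    exact ODE_solution_unique (v := fun _ => v) (K := K) (fun _ => hv)
      (fun s hs => (hY m s hs).continuousWithinAt) (hright m)
      (fun s hs => ((hY m' s ⟨hs.1, hs.2.trans hle⟩).continuousWithinAt).mono
        (Icc_subset_Icc_right hle))
      (fun s hs => hright m' s ⟨hs.1, hs.2.trans_le hle⟩) (by rw [hY0, hY0])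
  have hval : ∀ (m : ℕ) (s : ℝ), 0 ≤ s → s ≤ m + 1 → Y ⌈s⌉₊ s = Y m s := by
    intro m s hs hsm
    rcases le_total ⌈s⌉₊ m with hle | hle
    · exact huniq _ _ hle ⟨hs, (Nat.le_ceil s).trans (by linarith)⟩
    · exact (huniq _ _ hle ⟨hs, hsm⟩).symm
  refine ⟨fun s : ℝ => Y ⌈s⌉₊ s, by simpa using hY0 0, fun s hs => ?_⟩
  have hlt : s < ⌈s⌉₊ + 1 := (Nat.le_ceil s).trans_lt (lt_add_one _)
  have h1 : HasDerivWithinAt (Y ⌈s⌉₊) (v (Y ⌈s⌉₊ s)) (Ici 0) s := by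
    refine (hY ⌈s⌉₊ s ⟨hs, hlt.le⟩).mono_of_mem_nhdsWithin ?_
    filter_upwards [self_mem_nhdsWithin, mem_nhdsWithin_of_mem_nhds (eventually_lt_nhds hlt)]
      with u hu hu' using ⟨hu, hu'.le⟩
  refine h1.congr_of_eventuallyEq ?_ rfl
  filter_upwards [self_mem_nhdsWithin, mem_nhdsWithin_of_mem_nhds (eventually_lt_nhds hlt)]
    with u hu hu' using hval _ u hu hu'.le

section hold

variable {N : ℕ} {n : Fin (N + 1) → ℕ} {θ : Fin (N + 1) → ℝ → ℝ} {γbar : ℝ → ℝ}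
  {Φ : ℝ → ZState n × XState N → ℝ → ZState n × XState N}

/-- Membership in the set of triggering times depends only on the signal up to that time. -/
theorem mem_triggerTimes_congr {T : EReal} {x x' : ℝ → XState N} {a b : ℝ}
    (h : EqOn x x' (Icc a b)) :
    (b : EReal) ∈ triggerTimes θ γbar T x (a : EReal) ↔
      (b : EReal) ∈ triggerTimes θ γbar T x' (a : EReal) := by
  have key : ∀ {x x' : ℝ → XState N}, EqOn x x' (Icc a b) →
      (b : EReal) ∈ triggerTimes θ γbar T x (a : EReal) →
      (b : EReal) ∈ triggerTimes θ γbar T x' (a : EReal) := by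
    rintro x x' h ⟨b', hb', hab, hbT, h1, h2⟩
    rw [EReal.coe_eq_coe_iff] at hb'
    subst hb'
    have hab' := EReal.coe_lt_coe_iff.1 hab
    have he : samplingErrorSup θ x a b = samplingErrorSup θ x' a b := by
      unfold samplingErrorSup supOn
      refine congrArg sSup (image_congr fun s hs => ?_)
      simp only [h hs, h (left_mem_Icc.2 hab'.le)]
    simp only [EReal.toReal_coe] at h1 h2
    rw [he] at h1 h2
    exact ⟨b, rfl, hab, hbT, by simpa only [EReal.toReal_coe] using h1,
      by simpa only [EReal.toReal_coe] using h2⟩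
  exact ⟨key h, key h.symm⟩

theorem triggerTimes_top (T : EReal) (x : ℝ → XState N) : triggerTimes θ γbar T x ⊤ = ∅ := by
  refine eq_empty_of_forall_notMem ?_
  rintro _ ⟨b, rfl, hb, -⟩
  exact absurd hb (not_lt.2 le_top)

/-- The running supremum of the sampling error is continuous. -/
theorem continuousOn_samplingErrorSup (hθ : ∀ j, Continuous (θ j)) {x : ℝ → XState N} {a : ℝ}
    (hx : ContinuousOn x (Ici a)) : ContinuousOn (samplingErrorSup θ x a) (Ici a) := by
  have hc : Continuous fun s => x (max a s) :=
    hx.comp_continuous (by fun_prop) fun s => mem_Ici.2 (le_max_left _ _)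
  have hφ : Continuous fun s => |feedback θ (x (max a s)) - feedback θ (x a)| :=
    (((continuous_feedback hθ).comp hc).sub continuous_const).abs
  have h1 : Continuous fun b => sSup ((fun s => |feedback θ (x (max a (a + s * (b - a)))) -
      feedback θ (x a)|) '' Icc (0 : ℝ) 1) := by
    refine isCompact_Icc.continuous_sSup (f := fun b s =>
      |feedback θ (x (max a (a + s * (b - a)))) - feedback θ (x a)|) ?_
    exact hφ.comp (f := fun q : ℝ × ℝ => a + q.2 * (q.1 - a)) (by fun_prop)
  refine h1.continuousOn.congr fun b hb => ?_
  have hb : a ≤ b := hb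
  unfold samplingErrorSup supOn
  congr 1
  ext r
  constructor
  · rintro ⟨s, hs, rfl⟩
    rcases eq_or_lt_of_le hb with rfl | hlt
    · refine ⟨0, by simp, ?_⟩
      have : s = a := le_antisymm hs.2 hs.1
      simp [this]
    · have hpos : 0 < b - a := sub_pos.2 hlt
      refine ⟨(s - a) / (b - a), ⟨div_nonneg (by linarith [hs.1]) hpos.le,
        (div_le_one hpos).2 (by linarith [hs.2])⟩, ?_⟩
      have : a + (s - a) / (b - a) * (b - a) = s := by field_simp; ring
      simp only [this, max_eq_right hs.1]
  · rintro ⟨s, hs, rfl⟩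
    have h2 : 0 ≤ s * (b - a) := mul_nonneg hs.1 (sub_nonneg.2 hb)
    have h3 : s * (b - a) ≤ 1 * (b - a) := mul_le_mul_of_nonneg_right hs.2 (sub_nonneg.2 hb)
    refine ⟨a + s * (b - a), ⟨by linarith, by linarith⟩, ?_⟩
    simp only [max_eq_right (by linarith : a ≤ a + s * (b - a))]

/-- If the sampling error does not vanish at the infimum of the triggering times, then that infimum
is itself a triggering time. -/
theorem mem_triggerTimes_of_eq_sInf (hθ : ∀ j, Continuous (θ j)) (hγbar : IsGain γbar)
    {x : ℝ → XState N} {a b : ℝ} (hab : a < b) (hx : ContinuousOn x (Ici a))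
    (hb : (b : EReal) = sInf (triggerTimes θ γbar ⊤ x (a : EReal)))
    (hne : feedback θ (x b) ≠ feedback θ (x a)) :
    (b : EReal) ∈ triggerTimes θ γbar ⊤ x (a : EReal) := by
  have hP := continuousOn_samplingErrorSup hθ hx
  have hP0 : ∀ s, 0 ≤ samplingErrorSup θ x a s := fun s =>
    Real.sSup_nonneg (by rintro _ ⟨τ, -, rfl⟩; exact abs_nonneg _)
  have hpos : 0 < samplingErrorSup θ x a b :=
    (abs_pos.2 (sub_ne_zero.2 hne)).trans_le (le_supOn (((continuous_feedback hθ).comp_continuousOn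
      (hx.mono Icc_subset_Ici_self)).sub continuousOn_const).abs (right_mem_Icc.2 hab.le))
  refine ⟨b, rfl, EReal.coe_lt_coe_iff.2 hab, EReal.coe_lt_top b, ?_, ?_⟩
  swap
  · rw [EReal.toReal_coe]; exact hpos.ne'
  rw [EReal.toReal_coe]
  have hright : ContinuousWithinAt (samplingErrorSup θ x a) (Ici b) b :=
    (hP b hab.le).mono (Ici_subset_Ici.2 hab.le)
  have hγ : ContinuousWithinAt (fun s => (s - a) * γbar (samplingErrorSup θ x a s)) (Ici b) b :=
    ContinuousWithinAt.mul (by fun_prop) ((hγbar.continuousOn _ (hP0 b)).comp hright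
      fun s _ => hP0 s)
  refine le_of_tendsto_of_tendsto_of_frequently hright hγ ?_
  rw [frequently_iff]
  intro U hU
  obtain ⟨c, hc, hcU⟩ := mem_nhdsGE_iff_exists_Ico_subset.1 hU
  have hc' : sInf (triggerTimes θ γbar ⊤ x (a : EReal)) < (c : EReal) := by
    rw [← hb]; exact EReal.coe_lt_coe_iff.2 hc
  obtain ⟨s', hs', hsc⟩ := sInf_lt_iff.1 hc'
  have hbs := hb.le.trans (sInf_le hs')
  obtain ⟨s, rfl, has, -, hle, -⟩ := hs'
  rw [EReal.toReal_coe] at hle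
  exact ⟨s, hcU ⟨EReal.coe_le_coe_iff.1 hbs, EReal.coe_lt_coe_iff.1 hsc⟩, hle⟩

/-- The curve that starts from the state `q.2` at time `q.1` and follows the flow `Φ` with the input
held constant at the value of the feedback in `q.2`. -/
noncomputable def holdCurve (θ : Fin (N + 1) → ℝ → ℝ)
    (Φ : ℝ → ZState n × XState N → ℝ → ZState n × XState N) (q : EReal × (ZState n × XState N))
    (s : ℝ) : ZState n × XState N :=
  Φ (feedback θ q.2.2) q.2 (s - q.1.toReal)

/-- The `k`-th sampling time and the state at that time; the state is meaningless if the sampling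
time is infinite. -/
noncomputable def samples (θ : Fin (N + 1) → ℝ → ℝ) (γbar : ℝ → ℝ)
    (Φ : ℝ → ZState n × XState N → ℝ → ZState n × XState N) (y₀ : ZState n × XState N) :
    ℕ → EReal × (ZState n × XState N)
  | 0 => (0, y₀)
  | k + 1 =>
    let b := sInf (triggerTimes θ γbar ⊤
      (fun s => (holdCurve θ Φ (samples θ γbar Φ y₀ k) s).2) (samples θ γbar Φ y₀ k).1)
    (b, holdCurve θ Φ (samples θ γbar Φ y₀ k) b.toReal)

/-- The concatenation of the curves between consecutive sampling times. -/
noncomputable def sampledCurve (θ : Fin (N + 1) → ℝ → ℝ) (γbar : ℝ → ℝ)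
    (Φ : ℝ → ZState n × XState N → ℝ → ZState n × XState N) (y₀ : ZState n × XState N) (s : ℝ) :
    ZState n × XState N :=
  open Classical in
  if h : ∃ k, (samples θ γbar Φ y₀ k).1 ≤ (s : EReal) ∧
      (s : EReal) < (samples θ γbar Φ y₀ (k + 1)).1 then
    holdCurve θ Φ (samples θ γbar Φ y₀ h.choose) s
  else y₀

theorem samples_succ_fst (y₀ : ZState n × XState N) (k : ℕ) :
    (samples θ γbar Φ y₀ (k + 1)).1 = sInf (triggerTimes θ γbar ⊤
      (fun s => (holdCurve θ Φ (samples θ γbar Φ y₀ k) s).2) (samples θ γbar Φ y₀ k).1) := rfl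

theorem samples_succ_snd (y₀ : ZState n × XState N) (k : ℕ) :
    (samples θ γbar Φ y₀ (k + 1)).2 =
      holdCurve θ Φ (samples θ γbar Φ y₀ k) (samples θ γbar Φ y₀ (k + 1)).1.toReal := rfl

theorem monotone_samples_fst (y₀ : ZState n × XState N) :
    Monotone fun k => (samples θ γbar Φ y₀ k).1 :=
  monotone_nat_of_le_succ fun k => by
    rw [samples_succ_fst]; exact le_sInf_triggerTimes _

theorem samples_fst_nonneg (y₀ : ZState n × XState N) (k : ℕ) : 0 ≤ (samples θ γbar Φ y₀ k).1 :=
  monotone_samples_fst y₀ (Nat.zero_le k)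

theorem coe_toReal_samples_fst (y₀ : ZState n × XState N) {k : ℕ}
    (hk : (samples θ γbar Φ y₀ k).1 ≠ ⊤) :
    (((samples θ γbar Φ y₀ k).1.toReal : ℝ) : EReal) = (samples θ γbar Φ y₀ k).1 :=
  EReal.coe_toReal hk (ne_bot_of_le_ne_bot (by simp) (samples_fst_nonneg y₀ k))

section flow

variable {H : ℝ → ZState n × XState N → ZState n × XState N} {K C : NNReal}
  (hΦ0 : ∀ u y, Φ u y 0 = y)
  (hΦ : ∀ u y s, 0 ≤ s → HasDerivWithinAt (Φ u y) (H u (Φ u y s)) (Ici 0) s)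
include hΦ

theorem continuousOn_holdCurve (q : EReal × (ZState n × XState N)) :
    ContinuousOn (holdCurve θ Φ q) (Ici q.1.toReal) := by
  have h1 : ContinuousOn (Φ (feedback θ q.2.2) q.2) (Ici 0) := fun s hs =>
    (hΦ _ _ s hs).continuousWithinAt
  exact h1.comp (by fun_prop) fun s hs => mem_Ici.2 (sub_nonneg.2 hs)

theorem hasDerivWithinAt_holdCurve (q : EReal × (ZState n × XState N)) {s : ℝ}
    (hs : q.1.toReal ≤ s) : HasDerivWithinAt (holdCurve θ Φ q)
      (H (feedback θ q.2.2) (holdCurve θ Φ q s)) (Ici s) s := by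
  have h1 := hΦ (feedback θ q.2.2) q.2 (s - q.1.toReal) (sub_nonneg.2 hs)
  have h2 : HasDerivWithinAt (fun τ => τ - q.1.toReal) 1 (Ici s) s :=
    ((hasDerivAt_id s).sub_const _).hasDerivWithinAt
  have h3 := h1.scomp s h2 fun τ (hτ : s ≤ τ) => mem_Ici.2 (by linarith)
  rwa [one_smul] at h3

include hΦ0

theorem norm_holdCurve_le (hC : ∀ u y, ‖H u y‖ ≤ C) (q : EReal × (ZState n × XState N)) {s : ℝ}
    (hs : q.1.toReal ≤ s) : ‖holdCurve θ Φ q s‖ ≤ ‖q.2‖ + C * (s - q.1.toReal) := by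
  have h1 := norm_image_sub_le_of_norm_deriv_right_le_segment (C := C)
    ((continuousOn_holdCurve (θ := θ) hΦ q).mono Icc_subset_Ici_self)
    (fun τ hτ => hasDerivWithinAt_holdCurve (θ := θ) hΦ q hτ.1) (fun τ _ => hC _ _) s ⟨hs, le_rfl⟩
  have h2 : holdCurve θ Φ q q.1.toReal = q.2 := by rw [holdCurve, sub_self, hΦ0]
  rw [h2] at h1
  have h3 := norm_le_norm_add_norm_sub' (holdCurve θ Φ q s) q.2
  linarith

/-- Restarting the flow at a later time with the same input does not change the curve. -/
theorem holdCurve_eq_of_feedback_eq (hK : ∀ u, LipschitzWith K (H u))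
    {q q' : EReal × (ZState n × XState N)} (hq : q.1.toReal ≤ q'.1.toReal)
    (h2 : q'.2 = holdCurve θ Φ q q'.1.toReal) (hF : feedback θ q'.2.2 = feedback θ q.2.2) {s : ℝ}
    (hs : q'.1.toReal ≤ s) : holdCurve θ Φ q s = holdCurve θ Φ q' s := by
  refine ODE_solution_unique (v := fun _ => H (feedback θ q.2.2)) (K := K) (a := q'.1.toReal)
    (b := s) (fun _ => hK _)
    ((continuousOn_holdCurve hΦ q).mono (Icc_subset_Ici_self.trans (Ici_subset_Ici.2 hq)))
    (fun τ hτ => hasDerivWithinAt_holdCurve hΦ q (hq.trans hτ.1))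
    ((continuousOn_holdCurve hΦ q').mono Icc_subset_Ici_self)
    (fun τ hτ => hF ▸ hasDerivWithinAt_holdCurve hΦ q' hτ.1) ?_ (right_mem_Icc.2 hs)
  rw [← h2, holdCurve, sub_self, hΦ0]

theorem norm_samples_snd_le (hC : ∀ u y, ‖H u y‖ ≤ C) (y₀ : ZState n × XState N) (k : ℕ)
    (hk : (samples θ γbar Φ y₀ k).1 ≠ ⊤) : ‖(samples θ γbar Φ y₀ k).2‖ ≤
      ‖y₀‖ + C * (samples θ γbar Φ y₀ k).1.toReal := by
  induction k with
  | zero => simp [samples]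
  | succ k ih =>
    have hle := monotone_samples_fst (θ := θ) (γbar := γbar) (Φ := Φ) y₀ (Nat.le_succ k)
    have hk' := ne_top_of_le_ne_top hk hle
    have hle' : (samples θ γbar Φ y₀ k).1.toReal ≤ (samples θ γbar Φ y₀ (k + 1)).1.toReal := by
      rw [← EReal.coe_le_coe_iff, coe_toReal_samples_fst y₀ hk, coe_toReal_samples_fst y₀ hk']
      exact hle
    rw [samples_succ_snd]
    refine (norm_holdCurve_le hΦ0 hΦ hC _ hle').trans ?_
    have := ih hk'
    linarith

/-- Up to any finite time, consecutive sampling times are separated. -/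
theorem exists_samples_dwell (hC : ∀ u y, ‖H u y‖ ≤ C) (hθ : ∀ j, Continuous (θ j))
    (hγbar : IsLinGain γbar) (y₀ : ZState n × XState N) (c : ℝ) : ∃ τ : ℝ, 0 < τ ∧
      ∀ (k : ℕ) (a : ℝ), (samples θ γbar Φ y₀ k).1 = (a : EReal) →
        ((min (a + τ) c : ℝ) : EReal) ≤ (samples θ γbar Φ y₀ (k + 1)).1 := by
  obtain ⟨M, hM0, hM⟩ := exists_abs_feedback_le hθ (‖y₀‖ + C * c)
  obtain ⟨L, hL0, hL⟩ := hγbar.lin (M + M)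
  refine ⟨1 / (L + 1), by positivity, fun k a ha => ?_⟩
  have hne : (samples θ γbar Φ y₀ k).1 ≠ ⊤ := by rw [ha]; exact EReal.coe_ne_top a
  have ha' : (samples θ γbar Φ y₀ k).1.toReal = a := by rw [ha, EReal.toReal_coe]
  rw [samples_succ_fst, ha]
  refine le_sInf fun b hbmem => ?_
  have hbmem' := hbmem
  obtain ⟨s, rfl, has, -⟩ := hbmem
  rw [EReal.coe_lt_coe_iff] at has
  rw [EReal.coe_le_coe_iff]
  rcases le_total c s with hcs | hsc
  · exact (min_le_right _ _).trans hcs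
  refine (min_le_left _ _).trans ?_
  have hb : ∀ σ ∈ Icc a s, |feedback θ (holdCurve θ Φ (samples θ γbar Φ y₀ k) σ).2| ≤ M := by
    intro σ hσ
    refine hM _ ((norm_snd_le _).trans ?_)
    have h1 := norm_holdCurve_le (θ := θ) hΦ0 hΦ hC (samples θ γbar Φ y₀ k) (ha'.trans_le hσ.1)
    have h2 := norm_samples_snd_le (θ := θ) (γbar := γbar) hΦ0 hΦ hC y₀ k hne
    rw [ha'] at h1 h2
    have h3 : (C : ℝ) * σ ≤ C * c := mul_le_mul_of_nonneg_left (hσ.2.trans hsc) C.2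
    linarith
  refine add_le_of_mem_triggerTimes (by positivity) (M := M + M) (fun P hP hPM => ?_) hbmem'
    fun σ hσ => ?_
  · have := hL P hP hPM
    linarith
  · exact (norm_sub_le (feedback θ (holdCurve θ Φ (samples θ γbar Φ y₀ k) σ).2)
      (feedback θ (holdCurve θ Φ (samples θ γbar Φ y₀ k) a).2)).trans
      (add_le_add (hb σ hσ) (hb a ⟨le_rfl, has.le⟩))

theorem samples_fst_lt_succ (hC : ∀ u y, ‖H u y‖ ≤ C) (hθ : ∀ j, Continuous (θ j))
    (hγbar : IsLinGain γbar) (y₀ : ZState n × XState N) {k : ℕ}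
    (hk : (samples θ γbar Φ y₀ k).1 ≠ ⊤) :
    (samples θ γbar Φ y₀ k).1 < (samples θ γbar Φ y₀ (k + 1)).1 := by
  have ha := (coe_toReal_samples_fst y₀ hk).symm
  obtain ⟨τ, hτ, h⟩ := exists_samples_dwell hΦ0 hΦ hC hθ hγbar y₀
    ((samples θ γbar Φ y₀ k).1.toReal + 1)
  refine lt_of_lt_of_le ?_ (h k _ ha)
  rw [ha, EReal.coe_lt_coe_iff, EReal.toReal_coe]
  exact lt_min (by linarith) (by linarith)

/-- The sampling times of the concatenated curve do not accumulate. -/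
theorem exists_samples_cover (hC : ∀ u y, ‖H u y‖ ≤ C) (hθ : ∀ j, Continuous (θ j))
    (hγbar : IsLinGain γbar) (y₀ : ZState n × XState N) {s : ℝ} (hs : 0 ≤ s) :
    ∃ k, (samples θ γbar Φ y₀ k).1 ≤ (s : EReal) ∧
      (s : EReal) < (samples θ γbar Φ y₀ (k + 1)).1 := by
  obtain ⟨τ, hτ, h⟩ := exists_samples_dwell hΦ0 hΦ hC hθ hγbar y₀ (s + 1)
  have hlow : ∀ k : ℕ, ((min (k * τ) (s + 1) : ℝ) : EReal) ≤ (samples θ γbar Φ y₀ k).1 := by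
    intro k
    induction k with
    | zero =>
      rw [Nat.cast_zero, zero_mul, min_eq_left (by linarith), EReal.coe_zero]
      exact samples_fst_nonneg y₀ 0
    | succ k ih =>
      by_cases hk : (samples θ γbar Φ y₀ k).1 = ⊤
      · have h1 := monotone_samples_fst (θ := θ) (γbar := γbar) (Φ := Φ) y₀ (Nat.le_succ k)
        exact le_top.trans (hk.symm.le.trans h1)
      · have ha := (coe_toReal_samples_fst y₀ hk).symm
        refine le_trans ?_ (h k _ ha)
        rw [ha, EReal.coe_le_coe_iff] at ih
        rw [EReal.coe_le_coe_iff]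
        push_cast
        rcases min_le_iff.1 ih with h1 | h1
        · exact min_le_min (by linarith) le_rfl
        · exact (min_le_right _ _).trans (le_min (by linarith) le_rfl)
  have hex : ∃ k, (s : EReal) < (samples θ γbar Φ y₀ k).1 := by
    obtain ⟨k, hk⟩ := exists_nat_gt (s / τ)
    refine ⟨k, lt_of_lt_of_le ?_ (hlow k)⟩
    rw [EReal.coe_lt_coe_iff]
    exact lt_min ((div_lt_iff₀ hτ).1 hk) (lt_add_one s)
  classical
  have hpos : Nat.find hex ≠ 0 := fun h0 => by
    have h1 := Nat.find_spec hex
    rw [h0] at h1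
    exact absurd h1 (not_lt.2 (EReal.coe_nonneg.2 hs))
  obtain ⟨k, hk⟩ := Nat.exists_eq_succ_of_ne_zero hpos
  have hspec := Nat.find_spec hex
  rw [hk] at hspec
  exact ⟨k, not_lt.1 (Nat.find_min hex (hk ▸ Nat.lt_succ_self k)), hspec⟩

/-- The concatenated curve coincides with the `k`-th piece up to and including the next sampling
time. -/
theorem sampledCurve_eq (hC : ∀ u y, ‖H u y‖ ≤ C) (hθ : ∀ j, Continuous (θ j))
    (hγbar : IsLinGain γbar) (y₀ : ZState n × XState N) {k : ℕ} {s : ℝ}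
    (h1 : (samples θ γbar Φ y₀ k).1 ≤ (s : EReal))
    (h2 : (s : EReal) ≤ (samples θ γbar Φ y₀ (k + 1)).1) :
    sampledCurve θ γbar Φ y₀ s = holdCurve θ Φ (samples θ γbar Φ y₀ k) s := by
  have hmono := monotone_samples_fst (θ := θ) (γbar := γbar) (Φ := Φ) y₀
  have huniq : ∀ {i j : ℕ}, (samples θ γbar Φ y₀ i).1 ≤ (s : EReal) →
      (s : EReal) < (samples θ γbar Φ y₀ (j + 1)).1 → i ≤ j := fun {i j} hi hj => by
    by_contra! hlt
    exact absurd (hj.trans_le (hmono hlt)) (not_lt.2 hi)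
  have key : ∀ i, (samples θ γbar Φ y₀ i).1 ≤ (s : EReal) →
      (s : EReal) < (samples θ γbar Φ y₀ (i + 1)).1 →
      sampledCurve θ γbar Φ y₀ s = holdCurve θ Φ (samples θ γbar Φ y₀ i) s := fun i hi hi' => by
    have hex : ∃ k, (samples θ γbar Φ y₀ k).1 ≤ (s : EReal) ∧
      (s : EReal) < (samples θ γbar Φ y₀ (k + 1)).1 := ⟨i, hi, hi'⟩
    rw [sampledCurve, dif_pos hex,
      le_antisymm (huniq hex.choose_spec.1 hi') (huniq hi hex.choose_spec.2)]
  rcases lt_or_eq_of_le h2 with hlt | heq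
  · exact key k h1 hlt
  · have hne : (samples θ γbar Φ y₀ (k + 1)).1 ≠ ⊤ := heq ▸ EReal.coe_ne_top s
    have h3 := samples_fst_lt_succ hΦ0 hΦ hC hθ hγbar y₀ hne
    rw [key (k + 1) heq.ge (heq.trans_lt h3), holdCurve, samples_succ_snd, ← heq,
      EReal.toReal_coe, sub_self, hΦ0]

end flow

end hold

section sampled

variable {N : ℕ} {n : Fin (N + 1) → ℕ} {θ : Fin (N + 1) → ℝ → ℝ} {γbar : ℝ → ℝ}
  {Φ : ℝ → ZState n × XState N → ℝ → ZState n × XState N}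
  {H : ℝ → ZState n × XState N → ZState n × XState N} {K C : NNReal}
  (hΦ0 : ∀ u y, Φ u y 0 = y)
  (hΦ : ∀ u y s, 0 ≤ s → HasDerivWithinAt (Φ u y) (H u (Φ u y s)) (Ici 0) s)
  (hC : ∀ u y, ‖H u y‖ ≤ C) (hθ : ∀ j, Continuous (θ j)) (hγbar : IsLinGain γbar)
include hΦ0 hΦ hC hθ hγbar

theorem sampledCurve_samples (y₀ : ZState n × XState N) {k : ℕ}
    (hk : (samples θ γbar Φ y₀ k).1 ≠ ⊤) :
    sampledCurve θ γbar Φ y₀ (samples θ γbar Φ y₀ k).1.toReal = (samples θ γbar Φ y₀ k).2 := by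
  have ha := coe_toReal_samples_fst y₀ hk
  rw [sampledCurve_eq hΦ0 hΦ hC hθ hγbar y₀ ha.ge
    (ha.le.trans (monotone_samples_fst y₀ (Nat.le_succ k))), holdCurve, sub_self, hΦ0]

theorem hasDerivWithinAt_sampledCurve (y₀ : ZState n × XState N) {k : ℕ} {s : ℝ}
    (h1 : (samples θ γbar Φ y₀ k).1 ≤ (s : EReal))
    (h2 : (s : EReal) < (samples θ γbar Φ y₀ (k + 1)).1) :
    HasDerivWithinAt (sampledCurve θ γbar Φ y₀)
      (H (feedback θ (sampledCurve θ γbar Φ y₀ (samples θ γbar Φ y₀ k).1.toReal).2)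
        (sampledCurve θ γbar Φ y₀ s)) (Ici s) s := by
  have hk : (samples θ γbar Φ y₀ k).1 ≠ ⊤ := ne_top_of_le_ne_top (EReal.coe_ne_top s) h1
  have ha := coe_toReal_samples_fst y₀ hk
  have hs : (samples θ γbar Φ y₀ k).1.toReal ≤ s := by
    rw [← EReal.coe_le_coe_iff, ha]; exact h1
  have heq := sampledCurve_eq hΦ0 hΦ hC hθ hγbar y₀ h1 h2.le
  rw [sampledCurve_samples hΦ0 hΦ hC hθ hγbar y₀ hk, heq]
  refine (hasDerivWithinAt_holdCurve hΦ _ hs).congr_of_eventuallyEq ?_ heq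
  have hev : ∀ᶠ r : ℝ in 𝓝 s, (r : EReal) < (samples θ γbar Φ y₀ (k + 1)).1 :=
    (continuous_coe_real_ereal.tendsto s).eventually_lt_const h2
  filter_upwards [self_mem_nhdsWithin, mem_nhdsWithin_of_mem_nhds hev] with r hr hr'
  exact sampledCurve_eq hΦ0 hΦ hC hθ hγbar y₀ (h1.trans (EReal.coe_le_coe_iff.2 hr)) hr'.le

theorem continuousOn_sampledCurve (y₀ : ZState n × XState N) :
    ContinuousOn (sampledCurve θ γbar Φ y₀) (Ici 0) := by
  intro s hs
  have hs : 0 ≤ s := hs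
  obtain ⟨k, h1, h2⟩ := exists_samples_cover hΦ0 hΦ hC hθ hγbar y₀ hs
  have hright : ContinuousWithinAt (sampledCurve θ γbar Φ y₀) (Ici s) s :=
    (hasDerivWithinAt_sampledCurve hΦ0 hΦ hC hθ hγbar y₀ h1 h2).continuousWithinAt
  rcases eq_or_lt_of_le hs with rfl | hpos
  · exact hright
  -- a positive time also lies in an interval that is open at the preceding sampling time
  have hleft : ∃ i, (samples θ γbar Φ y₀ i).1 < (s : EReal) ∧
      (s : EReal) ≤ (samples θ γbar Φ y₀ (i + 1)).1 := by
    rcases lt_or_eq_of_le h1 with hlt | heq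
    · exact ⟨k, hlt, h2.le⟩
    · have hk0 : k ≠ 0 := by
        rintro rfl
        have h3 : (0 : EReal) = s := heq
        exact hpos.ne (EReal.coe_eq_coe_iff.1 (by rw [EReal.coe_zero]; exact h3))
      obtain ⟨i, rfl⟩ := Nat.exists_eq_succ_of_ne_zero hk0
      refine ⟨i, ?_, heq.ge⟩
      rw [← heq]
      refine samples_fst_lt_succ hΦ0 hΦ hC hθ hγbar y₀ (ne_top_of_le_ne_top ?_
        (monotone_samples_fst y₀ (Nat.le_succ i)))
      exact (congrArg (· ≠ ⊤) heq).mpr (EReal.coe_ne_top s)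
  obtain ⟨i, hi, hi'⟩ := hleft
  have ha := coe_toReal_samples_fst y₀ (ne_top_of_lt hi)
  have has : (samples θ γbar Φ y₀ i).1.toReal < s := by
    rw [← EReal.coe_lt_coe_iff, ha]; exact hi
  have hl : ContinuousWithinAt (sampledCurve θ γbar Φ y₀) (Iic s) s := by
    have h4 : EqOn (sampledCurve θ γbar Φ y₀) (holdCurve θ Φ (samples θ γbar Φ y₀ i))
        (Icc (samples θ γbar Φ y₀ i).1.toReal s) := fun r hr =>
      sampledCurve_eq hΦ0 hΦ hC hθ hγbar y₀ (ha.ge.trans (EReal.coe_le_coe_iff.2 hr.1))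
        ((EReal.coe_le_coe_iff.2 hr.2).trans hi')
    exact (((continuousOn_holdCurve hΦ _).mono Icc_subset_Ici_self).congr h4 s
      ⟨has.le, le_rfl⟩).mono_of_mem_nhdsWithin (Icc_mem_nhdsLE has)
  have hfull := hl.union hright
  rw [Iic_union_Ici, continuousWithinAt_univ] at hfull
  exact hfull.continuousWithinAt

/-- The sampling times are those prescribed by the triggering rule along the concatenated curve. The
delicate case is an infimum that is not attained: then the sampling error vanishes there, the
resampled input is the former one, and the curve goes on as if no sample had been taken. -/
theorem samples_fst_eq_sInf (hK : ∀ u, LipschitzWith K (H u)) (y₀ : ZState n × XState N) (k : ℕ) :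
    (samples θ γbar Φ y₀ (k + 1)).1 = sInf (triggerTimes θ γbar ⊤
      (fun s => (sampledCurve θ γbar Φ y₀ s).2) (samples θ γbar Φ y₀ k).1) := by
  by_cases hk : (samples θ γbar Φ y₀ k).1 = ⊤
  · rw [samples_succ_fst, hk, triggerTimes_top, triggerTimes_top]
  have ha := coe_toReal_samples_fst y₀ hk
  set a := (samples θ γbar Φ y₀ k).1.toReal with ha_def
  -- the triggering times of the two curves agree as long as the curves do
  have hagree : ∀ b : ℝ, (∀ s ∈ Icc a b, sampledCurve θ γbar Φ y₀ s =
      holdCurve θ Φ (samples θ γbar Φ y₀ k) s) →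
      ((b : EReal) ∈ triggerTimes θ γbar ⊤ (fun s => (sampledCurve θ γbar Φ y₀ s).2) (a : EReal) ↔
        (b : EReal) ∈ triggerTimes θ γbar ⊤
          (fun s => (holdCurve θ Φ (samples θ γbar Φ y₀ k) s).2) (a : EReal)) := fun b hb =>
    mem_triggerTimes_congr fun s hs => congrArg Prod.snd (hb s hs)
  have heq : ∀ s ∈ Ici a, (s : EReal) ≤ (samples θ γbar Φ y₀ (k + 1)).1 →
      sampledCurve θ γbar Φ y₀ s = holdCurve θ Φ (samples θ γbar Φ y₀ k) s := fun s hs hs' =>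
    sampledCurve_eq hΦ0 hΦ hC hθ hγbar y₀ (ha.ge.trans (EReal.coe_le_coe_iff.2 hs)) hs'
  have hdef : (samples θ γbar Φ y₀ (k + 1)).1 = sInf (triggerTimes θ γbar ⊤
      (fun s => (holdCurve θ Φ (samples θ γbar Φ y₀ k) s).2) (a : EReal)) := by
    rw [samples_succ_fst, ha]
  rw [← ha]
  refine le_antisymm (le_sInf fun b hb => ?_) ?_
  · by_contra! hlt
    have hb' := hb
    obtain ⟨s, rfl, -⟩ := hb
    rw [hagree s fun r hr => heq r hr.1 ((EReal.coe_le_coe_iff.2 hr.2).trans hlt.le)] at hb'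
    exact absurd (hdef.le.trans (sInf_le hb')) (not_le.2 hlt)
  by_cases htop : (samples θ γbar Φ y₀ (k + 1)).1 = ⊤
  · rw [htop]; exact le_top
  have hb := coe_toReal_samples_fst y₀ htop
  set b := (samples θ γbar Φ y₀ (k + 1)).1.toReal with hb_def
  have hab : a < b := by
    rw [← EReal.coe_lt_coe_iff, ha, hb]
    exact samples_fst_lt_succ hΦ0 hΦ hC hθ hγbar y₀ hk
  have hya : holdCurve θ Φ (samples θ γbar Φ y₀ k) a = (samples θ γbar Φ y₀ k).2 := by
    rw [holdCurve, sub_self, hΦ0]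
  by_cases hF : feedback θ (holdCurve θ Φ (samples θ γbar Φ y₀ k) b).2 =
      feedback θ (holdCurve θ Φ (samples θ γbar Φ y₀ k) a).2
  · have hlt := samples_fst_lt_succ hΦ0 hΦ hC hθ hγbar y₀ htop
    refine le_of_forall_gt fun c hc => ?_
    have hc' : sInf (triggerTimes θ γbar ⊤
        (fun s => (holdCurve θ Φ (samples θ γbar Φ y₀ k) s).2) (a : EReal)) <
        min c (samples θ γbar Φ y₀ (k + 1 + 1)).1 := by
      rw [← hdef]; exact lt_min hc hlt
    obtain ⟨d, hd, hdc⟩ := sInf_lt_iff.1 hc'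
    have hd' := hd
    obtain ⟨s, rfl, -⟩ := hd
    refine (sInf_le ((hagree s fun r hr => ?_).2 hd')).trans_lt (hdc.trans_le (min_le_left _ _))
    rcases le_total r b with hrb | hbr
    · exact heq r hr.1 ((EReal.coe_le_coe_iff.2 hrb).trans hb.le)
    · rw [sampledCurve_eq hΦ0 hΦ hC hθ hγbar y₀ (hb.ge.trans (EReal.coe_le_coe_iff.2 hbr))
        ((EReal.coe_le_coe_iff.2 hr.2).trans (hdc.le.trans (min_le_right _ _)))]
      refine (holdCurve_eq_of_feedback_eq hΦ0 hΦ hK hab.le (samples_succ_snd y₀ k) ?_ hbr).symm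
      rw [samples_succ_snd, ← hb_def, hF, hya]
  · have hmem := mem_triggerTimes_of_eq_sInf hθ hγbar.toIsGain hab
      (continuous_snd.comp_continuousOn (continuousOn_holdCurve hΦ (samples θ γbar Φ y₀ k)))
      (hb.trans hdef) hF
    rw [← hb]
    exact sInf_le ((hagree b fun r hr => heq r hr.1
      ((EReal.coe_le_coe_iff.2 hr.2).trans hb.le)).2 hmem)

end sampled

section complete

variable {N p : ℕ} {n : Fin (N + 1) → ℕ} (S : LowerTriangularSystem N p n)

/-- The right-hand side of the system as a function of the input and the state. -/
noncomputable def LowerTriangularSystem.field (w : EuclideanSpace ℝ (Fin p)) (u : ℝ)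
    (y : ZState n × XState N) : ZState n × XState N :=
  (fun j => S.q j y.1 y.2 w,
    fun j => S.f j y.1 y.2 w + S.b j * Fin.snoc (α := fun _ => ℝ) y.2 u j.succ)

theorem LowerTriangularSystem.contDiff_field (w : EuclideanSpace ℝ (Fin p)) :
    ContDiff ℝ 1 fun a : ℝ × (ZState n × XState N) => S.field w a.1 a.2 := by
  have hin : ContDiff ℝ 1 fun a : ℝ × (ZState n × XState N) => (a.2.1, a.2.2, w) := by fun_prop
  refine ContDiff.prodMk (contDiff_pi.2 fun j => (S.q_smooth j).comp hin)
    (contDiff_pi.2 fun j => ((S.f_smooth j).comp hin).add (contDiff_const.mul ?_))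
  refine Fin.lastCases ?_ (fun i => ?_) j
  · simp only [Fin.succ_last, Fin.snoc_last]
    exact contDiff_fst
  · simp only [Fin.succ_castSucc, Fin.snoc_castSucc]
    fun_prop

theorem norm_le_stateNorm (y : ZState n × XState N) : ‖y‖ ≤ stateNorm y.1 y.2 := by
  refine max_le ?_ ((norm_le_colNorm_univ _).trans (colNorm_x_le_stateNorm _ _))
  refine le_trans ?_ (colNorm_z_le_stateNorm _ _)
  exact (pi_norm_le_iff_of_nonneg (colNorm_nonneg _ _)).2 fun i =>
    norm_le_colNorm (Finset.mem_univ i) y.1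

variable {S}

/-- A bounded and Lipschitz vector field, depending on the input, that agrees with the field of the
system on a given ball. -/
theorem LowerTriangularSystem.exists_cutoff (w : EuclideanSpace ℝ (Fin p)) (ϱ : ℝ) :
    ∃ (H : ℝ → ZState n × XState N → ZState n × XState N) (K C : NNReal),
      (∀ u, LipschitzWith K (H u)) ∧ (∀ u y, ‖H u y‖ ≤ C) ∧
      ∀ u y, |u| ≤ ϱ → ‖y‖ ≤ ϱ → H u y = S.field w u y := by
  let χ : ContDiffBump (0 : ℝ × (ZState n × XState N)) :=
    { rIn := max ϱ 1
      rOut := max ϱ 1 + 1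
      rIn_pos := lt_max_of_lt_right one_pos
      rIn_lt_rOut := lt_add_one _ }
  let G : ℝ × (ZState n × XState N) → ZState n × XState N := fun a => χ a • S.field w a.1 a.2
  have hG : ContDiff ℝ 1 G := χ.contDiff.smul (S.contDiff_field w)
  have hGc : HasCompactSupport G := χ.hasCompactSupport.smul_right
  obtain ⟨K, hK⟩ := hG.lipschitzWith_of_hasCompactSupport hGc one_ne_zero
  obtain ⟨C, hC⟩ := hGc.exists_bound_of_continuous hG.continuous
  refine ⟨fun u y => G (u, y), K, ⟨max C 0, le_max_right _ _⟩, fun u => ?_, fun u y =>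
    (hC _).trans (le_max_left _ _), fun u y hu hy => ?_⟩
  · have h1 := hK.comp (LipschitzWith.prodMk_left (β := ZState n × XState N) u)
    rw [mul_one] at h1
    exact h1
  · have h1 : χ (u, y) = 1 := χ.one_of_mem_closedBall (by
      rw [mem_closedBall_zero_iff]
      exact (max_le hu hy).trans (le_max_left _ _))
    simp only [G, h1, one_smul]

/-- The next sampling time of the trajectory restricted to `[0, T)`: sampling times not before `T`
become infinite. -/
theorem sInf_triggerTimes_of_lt {θ : Fin (N + 1) → ℝ → ℝ} {γbar : ℝ → ℝ} (T : EReal)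
    (x : ℝ → XState N) (a : EReal) :
    sInf (triggerTimes θ γbar T x a) = if sInf (triggerTimes θ γbar ⊤ x a) < T then
      sInf (triggerTimes θ γbar ⊤ x a) else ⊤ := by
  have hsub : triggerTimes θ γbar T x a ⊆ triggerTimes θ γbar ⊤ x a := by
    rintro _ ⟨s, rfl, h1, -, h2⟩
    exact ⟨s, rfl, h1, EReal.coe_lt_top s, h2⟩
  split_ifs with hlt
  · refine le_antisymm (le_of_forall_gt fun c hc => ?_) (sInf_le_sInf hsub)
    obtain ⟨b, hb, hbc⟩ := sInf_lt_iff.1 (lt_min hc hlt)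
    obtain ⟨s, rfl, h1, -, h2⟩ := hb
    have hb' : (s : EReal) ∈ triggerTimes θ γbar T x a :=
      ⟨s, rfl, h1, hbc.trans_le (min_le_right _ _), h2⟩
    exact (sInf_le hb').trans_lt
      (hbc.trans_le (min_le_left _ _))
  · rw [sInf_eq_top]
    intro b hb
    have h1 := sInf_le (hsub hb)
    obtain ⟨s, rfl, -, h2, -⟩ := hb
    exact absurd (h1.trans_lt h2) hlt

/-- As long as its state and its input stay in the ball where the cutoff field agrees with the
field of the system, the concatenated curve is a closed-loop trajectory. -/
theorem isClosedLoopTrajectory_sampledCurve {θ : Fin (N + 1) → ℝ → ℝ} {γbar : ℝ → ℝ}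
    {Φ : ℝ → ZState n × XState N → ℝ → ZState n × XState N}
    {H : ℝ → ZState n × XState N → ZState n × XState N} {K C : NNReal}
    {w : EuclideanSpace ℝ (Fin p)} {ϱ : ℝ}
    (hΦ0 : ∀ u y, Φ u y 0 = y)
    (hΦ : ∀ u y s, 0 ≤ s → HasDerivWithinAt (Φ u y) (H u (Φ u y s)) (Ici 0) s)
    (hC : ∀ u y, ‖H u y‖ ≤ C) (hθ : ∀ j, Continuous (θ j)) (hγbar : IsLinGain γbar)
    (hK : ∀ u, LipschitzWith K (H u))
    (hH : ∀ u y, |u| ≤ ϱ → ‖y‖ ≤ ϱ → H u y = S.field w u y) {y₀ : ZState n × XState N}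
    {T : EReal} (hT : 0 < T)
    (hy : ∀ s ∈ timeDomain T, ‖sampledCurve θ γbar Φ y₀ s‖ ≤ ϱ ∧
      |feedback θ (sampledCurve θ γbar Φ y₀ s).2| ≤ ϱ) :
    IsClosedLoopTrajectory S θ γbar w T
      (fun k => if (samples θ γbar Φ y₀ k).1 < T then (samples θ γbar Φ y₀ k).1 else ⊤)
      (fun s => (sampledCurve θ γbar Φ y₀ s).1) (fun s => (sampledCurve θ γbar Φ y₀ s).2) := by
  have hcont : ContinuousOn (sampledCurve θ γbar Φ y₀) (timeDomain T) :=
    (continuousOn_sampledCurve hΦ0 hΦ hC hθ hγbar y₀).mono fun s hs => hs.1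
  have hode : ∀ k, ∀ s ∈ timeDomain T, (samples θ γbar Φ y₀ k).1 ≤ (s : EReal) →
      (s : EReal) < (samples θ γbar Φ y₀ (k + 1)).1 →
      HasDerivWithinAt (sampledCurve θ γbar Φ y₀) (S.field w
        (feedback θ (sampledCurve θ γbar Φ y₀ (samples θ γbar Φ y₀ k).1.toReal).2)
        (sampledCurve θ γbar Φ y₀ s)) (Ici s) s := fun k s hs h1 h2 => by
    have ha := coe_toReal_samples_fst y₀ (ne_top_of_le_ne_top (EReal.coe_ne_top s) h1)
    have hmem : (samples θ γbar Φ y₀ k).1.toReal ∈ timeDomain T :=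
      ⟨by rw [← EReal.coe_le_coe_iff, ha]; exact samples_fst_nonneg y₀ k,
        ha.trans_lt (h1.trans_lt hs.2)⟩
    rw [← hH _ _ (hy _ hmem).2 (hy s hs).1]
    exact hasDerivWithinAt_sampledCurve hΦ0 hΦ hC hθ hγbar y₀ h1 h2
  refine
    { horizon_pos := hT
      z_continuousOn := continuous_fst.comp_continuousOn hcont
      x_continuousOn := continuous_snd.comp_continuousOn hcont
      t_zero := if_pos hT
      t_succ := fun k => ?_
      covers := fun s hs => ?_
      z_ode := fun s hs j => ?_
      x_ode := fun k s hs h1 h2 j => ?_ }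
  · by_cases hk : (samples θ γbar Φ y₀ k).1 < T
    · simp only [if_pos hk]
      rw [sInf_triggerTimes_of_lt, ← samples_fst_eq_sInf hΦ0 hΦ hC hθ hγbar hK]
    · have hk' : ¬ (samples θ γbar Φ y₀ (k + 1)).1 < T := fun h1 =>
        hk ((monotone_samples_fst y₀ (Nat.le_succ k)).trans_lt h1)
      simp only [if_neg hk, if_neg hk', triggerTimes_top, sInf_empty]
  · obtain ⟨k, h1, h2⟩ := exists_samples_cover hΦ0 hΦ hC hθ hγbar y₀ hs.1
    refine ⟨k, ?_, ?_⟩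
    · simp only [if_pos (h1.trans_lt hs.2)]; exact h1
    · split_ifs
      · exact h2
      · exact EReal.coe_lt_top s
  · obtain ⟨k, h1, h2⟩ := exists_samples_cover hΦ0 hΦ hC hθ hγbar y₀ hs.1
    exact hasDerivWithinAt_pi.1 (hode k s hs h1 h2).fst j
  · have hk : (samples θ γbar Φ y₀ k).1 < T := by
      by_contra hcon
      rw [if_neg hcon] at h1
      exact absurd h1 (not_le.2 (EReal.coe_lt_top s))
    rw [if_pos hk] at h1 ⊢
    have h2' : (s : EReal) < (samples θ γbar Φ y₀ (k + 1)).1 := by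
      split_ifs at h2 with hk'
      · exact h2
      · exact hs.2.trans_le (not_lt.1 hk')
    exact hasDerivWithinAt_pi.1 (hode k s hs h1 h2').snd j

/-- A stable closed loop has trajectories on `[0, ∞)`: the a priori bound keeps the trajectory of
the cutoff system in the region where the cutoff is not active. -/
theorem exists_complete_trajectory {θ : Fin (N + 1) → ℝ → ℝ} {γbar : ℝ → ℝ}
    (hθ : ∀ j, Continuous (θ j)) (hγbar : IsLinGain γbar) {β : ℝ → ℝ → ℝ} (hβ : IsClassKL β)
    {w : EuclideanSpace ℝ (Fin p)}
    (hstable : ∀ T t z x, IsClosedLoopTrajectory S θ γbar w T t z x →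
      ∀ s ∈ timeDomain T, stateNorm (z s) (x s) ≤ β (stateNorm (z 0) (x 0)) s)
    (y₀ : ZState n × XState N) : ∃ t z x, IsClosedLoopTrajectory S θ γbar w ⊤ t z x ∧
      z 0 = y₀.1 ∧ x 0 = y₀.2 := by
  set R := stateNorm y₀.1 y₀.2
  set M := max R (β R 0)
  obtain ⟨L, -, hL⟩ := exists_abs_feedback_le hθ (M + 1)
  obtain ⟨H, K, C, hK, hC, hH⟩ := S.exists_cutoff w (max (M + 1) L)
  choose Φ hΦ0 hΦ using fun u y => exists_global_solution (hK u) (hC u) y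
  set Y := sampledCurve θ γbar Φ y₀ with hY
  have hYc : ContinuousOn Y (Ici 0) := continuousOn_sampledCurve hΦ0 hΦ hC hθ hγbar y₀
  have hY0 : Y 0 = y₀ := by
    have h1 := sampledCurve_samples hΦ0 hΦ hC hθ hγbar y₀ (k := 0) (by simp [samples])
    simpa [samples] using h1
  have htraj : ∀ T : EReal, 0 < T → (∀ s ∈ timeDomain T, stateNorm (Y s).1 (Y s).2 ≤ M + 1) →
      ∃ t, IsClosedLoopTrajectory S θ γbar w T t (fun s => (Y s).1) (fun s => (Y s).2) :=
    fun T hT hb => ⟨_, isClosedLoopTrajectory_sampledCurve hΦ0 hΦ hC hθ hγbar hK hH hT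
      fun s hs => by
        have h1 := (norm_le_stateNorm (Y s)).trans (hb s hs)
        exact ⟨h1.trans (le_max_left _ _),
          (hL _ ((norm_snd_le _).trans h1)).trans (le_max_right _ _)⟩⟩
  have hR0 : stateNorm (Y 0).1 (Y 0).2 = R := by rw [hY0]
  have hnorm : ContinuousOn (fun s => stateNorm (Y s).1 (Y s).2) (Ici 0) :=
    continuous_stateNorm.comp_continuousOn hYc
  have hall : ∀ s, 0 ≤ s → stateNorm (Y s).1 (Y s).2 ≤ M + 1 := by
    by_contra! hcon
    obtain ⟨s₁, hs₁, hbad⟩ := hcon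
    -- the first exit time
    set B : Set ℝ := Ici 0 ∩ (fun s => stateNorm (Y s).1 (Y s).2) ⁻¹' Ici (M + 1)
    have hBc : IsClosed B := hnorm.preimage_isClosed_of_isClosed isClosed_Ici isClosed_Ici
    have hBb : BddBelow B := ⟨0, fun s hs => hs.1⟩
    have hmem : sInf B ∈ B := hBc.csInf_mem ⟨s₁, hs₁, hbad.le⟩ hBb
    set e := sInf B
    have he : M + 1 ≤ stateNorm (Y e).1 (Y e).2 := hmem.2
    have hepos : 0 < e := by
      refine lt_of_le_of_ne hmem.1 fun h0 => ?_
      rw [← h0, hR0] at he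
      linarith [le_max_left R (β R 0)]
    obtain ⟨t, ht⟩ := htraj (e : EReal) (EReal.coe_pos.2 hepos) fun s hs => by
      by_contra! hlt
      exact absurd (csInf_le hBb ⟨hs.1, hlt.le⟩) (not_le.2 (EReal.coe_lt_coe_iff.1 hs.2))
    have hM : ∀ s ∈ Ico 0 e, stateNorm (Y s).1 (Y s).2 ≤ M := fun s hs => by
      have h1 := hstable _ _ _ _ ht s ⟨hs.1, EReal.coe_lt_coe_iff.2 hs.2⟩
      rw [hR0] at h1
      have h2 := hβ.antitoneOn R (stateNorm_nonneg _ _) (mem_Ici.2 le_rfl) (mem_Ici.2 hs.1) hs.1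
      exact (h1.trans h2).trans (le_max_right _ _)
    have hlim : Tendsto (fun s => stateNorm (Y s).1 (Y s).2) (𝓝[<] e)
        (𝓝 (stateNorm (Y e).1 (Y e).2)) :=
      (hnorm.continuousAt (Ici_mem_nhds hepos)).tendsto.mono_left nhdsWithin_le_nhds
    have hle := le_of_tendsto hlim (by
      filter_upwards [Ico_mem_nhdsLT hepos] with s hs using hM s hs)
    linarith
  obtain ⟨t, ht⟩ := htraj ⊤ (by simp) fun s hs => hall s hs.1
  exact ⟨t, _, _, ht, by rw [hY0], by rw [hY0]⟩

end complete

theorem theorem3 {N p : ℕ} {n : Fin (N + 1) → ℕ} (S : LowerTriangularSystem N p n)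
    (γz γx : Fin (N + 1) → ℝ → ℝ)
    (hγz : ∀ j, IsClassKInf (γz j)) (hγx : ∀ j, IsClassKInf (γx j))
    (hγz_slope : ∀ j, FiniteSlopeAtZero (γz j)) (hγx_slope : ∀ j, FiniteSlopeAtZero (γx j))
    (hISS : ∀ j, ZSubsystemISS S j id (γz j) (γx j)) :
    (∃ D : BacksteppingDesign N, D.Admissible S γz ∧
      ∃ γξz γξx γξr : ℝ → ℝ, XiBound S (D.θ S.b) γξz γξx γξr) ∧
    ∀ D : BacksteppingDesign N, D.Admissible S γz →
      ∀ γξz γξx γξr : ℝ → ℝ, XiBound S (D.θ S.b) γξz γξx γξr →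
        FiniteSlopeAtZero (loopGain D γz γξz γξx γξr) ∧
        ∀ (ε : ℝ) (γbar : ℝ → ℝ), 1 < ε → IsClassKInf γbar → FiniteSlopeAtZero γbar →
          (∀ s, 0 < s → ε * loopGain D γz γξz γξx γξr s ≤ γbar s) →
          EventTriggeredObjectives S (D.θ S.b) γbar := by
  have hz : ∀ j, IsLinGain (γz j) := fun j => (hγz j).isGain.isLinGain (hγz_slope j)
  have hx : ∀ j, IsLinGain (γx j) := fun j => (hγx j).isGain.isLinGain (hγx_slope j)
  refine ⟨?_, fun D hD γξz γξx γξr hξ => ⟨(hξ.isLinGain_loopGain hD hz).finiteSlope,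
    fun ε γbar hε hγbar hslope hle => ?_⟩⟩
  · obtain ⟨D, hD⟩ := exists_admissible hz hγx hx hISS
    exact ⟨D, hD, exists_xiBound hD.contDiff_θ (D.θ_zero S.b)⟩
  · have hlin : IsLinGain γbar := hγbar.isGain.isLinGain hslope
    obtain ⟨β, hβ, hstable⟩ := hD.exists_stable hz hξ hε hγbar hle
    exact
      { complete := fun w hw z₀ x₀ =>
          exists_complete_trajectory hD.continuous_θ hlin hβ (hstable w hw) (z₀, x₀)
        stable := ⟨β, hβ, hstable⟩
        zenoFree := fun R _ => exists_dwell_time hD.continuous_θ hlin hβ hstable R }
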